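/- **Conventions.** A *nonsingular directed manifold of rank $r$* is a complex manifold $M$ with a holomorphic subbundle $V\subset T_M$ of rank $r$. Put $\tilde M=P(V)$, the bundle of lines in $V$, with projection $\pi:\tilde M\to M$ and tautological line subbundle $\mathcal O_{\tilde M}(-1)\subset\pi^*V$, and $\tilde V_{(x,[v])}=\{\xi\in T_{\tilde M,(x,[v])} : \pi_*\xi\in\mathbb C v\}$. Then $(\tilde M,\tilde V)$ is again a nonsingular directed manifold of rank $r$. Iterating $(M,V)\mapsto(\tilde M,\tilde V)$ gives the Semple tower $(X_k,V_k)$, $(X_0,V_0)=(M,V)$, with projections $\pi_k:X_k\to X_{k-1}$ and $\pi_{k,\ell}:X_k\to X_\ell$, and $\mathcal O_{X_k}(m\cdot\underline 1)=\bigotimes_{j=1}^k\pi_{k,j}^*\mathcal O_{X_j}(m)$. There are exact sequences $$0\to T_{X_k/X_{k-1}}\to V_k\xrightarrow{d\pi_k}\mathcal O_{X_k}(-1)\to0,\qquad 0\to\mathcal O_{X_k}\to\pi_k^*V_{k-1}\otimes\mathcal O_{X_k}(1)\to T_{X_k/X_{k-1}}\to0 .$$ For $p\ge1$ let $$\Psi_{k,p}:\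 \pi_k^*\Lambda^pV_{k-1}^*\otimes\mathcal O_{X_k}(-(p-1))\to\Lambda^{p-1}T^*_{X_k/X_{k-1}}\otimes\mathcal O_{X_k}(1)\to\Lambda^pV_k^*$$ be the composite of the contraction with the Euler vector field of the second sequence (twisted by $\mathcal O_{X_k}(1)$) and the wedge multiplication $\gamma\otimes\lambda\mapsto\lambda\wedge\gamma$ induced by the dual of the first. A *directed structure* on a complex manifold $X$ is a closed irreducible analytic subset $V\subset T_X$ (possibly singular as a bundle) all of whose fibers $V_x$ are vector subspaces; its rank is $r=\min_x\dim V_x$, and $X'\subset X$ is the open set of points near which $V$ is a subbundle of rank $r$, $V'=V_{|X'}$. Let $(X'_k,V'_k)$ be the Semple tower of $(X',V')$ and $(X^a_k,V^a_k)$ that of $(X,T_X)$. **Proposition.** (1) Let $(X,V)$ be a nonsingular directed manifold of rank $r$ and $1\le p\le r$. There is exactly one family of fiberwise linear maps $$\Phi_{k,p}=\Phi_{k,p}^{X,V}:\ \pi_{k,0}^*\Lambda^pV^*\otimes\mathcal O_{X_k}(-(p-1)\underline 1)\to\Lambda^pV_k^*,\qquad k\ge0,$$ with $\Phi_{0,p}=\mathrm{id}$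 and $\Phi_{k,p}=\Psi_{k,p}\circ(\pi_k^*\Phi_{k-1,p}\otimes\mathrm{id})$ for $k\ge1$, and each $\Phi_{k,p}$ is a holomorphic morphism of vector bundles on $X_k$. (2) Let $X$ be a complex manifold (for example a nonsingular projective variety), $V$ a directed structure on $X$ of rank $r$, possibly singular, and $1\le p\le r$. The inclusion $X'\subset X$ induces injective holomorphic immersions $\iota_k:X'_k\to X^a_k$ with $\iota_0$ the inclusion, $\iota_{k}(w,[v])=(\iota_{k-1}(w),[d\iota_{k-1}(v)])$ and $d\iota_k(V'_k)\subset V^a_k$. Let $X_k$ be the closure of $\iota_k(X'_k)$ in $X^a_k$. Then: * (a) $\Phi^{X',V'}_{k,p}$ is the restriction of $\Phi^{X,T_X}_{k,p}$ along $\iota_k$: if $\sigma'$ is the restriction to $V'$ of an element $\sigma$ of the fiber of $\pi_{k,0}^*\Lambda^pT_X^*\otimes\mathcal O_{X^a_k}(-(p-1)\underline1)$ at $\iota_k(w)$, then $\Phi^{X',V'}_{k,p}(\sigma')$ is the restriction to $V'_k$ of $\Phi^{X,T_X}_{k,p}(\sigma)$. * (b) On $X_k$ let $\pi_{k,0}^*\Lambda^pV^*\otimes\mathcal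 O_{X_k}(-(p-1)\underline1)$, respectively $\Lambda^pV_k^*$, be the sheaf whose sections over $U\cap X_k$ ($U\subset X^a_k$ open) are the sections over $\iota_k^{-1}(U)$ of the corresponding bundle of $(X'_k,V'_k)$ that, locally near every point of $U\cap X_k$, are restrictions of holomorphic sections over open subsets of $X^a_k$ of $\pi_{k,0}^*\Lambda^pT_X^*\otimes\mathcal O_{X^a_k}(-(p-1)\underline1)$, respectively of $\Lambda^p(V^a_k)^*$. Then $\Phi^{X',V'}_{k,p}$ maps sections of the first sheaf to sections of the second, so it extends to a morphism $\Phi^{X,V}_{k,p}:\pi_{k,0}^*\Lambda^pV^*\otimes\mathcal O_{X_k}(-(p-1)\underline1)\to\Lambda^pV_k^*$ of sheaves on $X_k$. * (c) If $\sigma$ is a holomorphic section of $\pi_{k,0}^*\Lambda^pT_X^*\otimes\mathcal O_{X^a_k}(-(p-1)\underline1)$ over an open set $U\subset X^a_k$ whose restriction to $V'$ vanishes on $\iota_k^{-1}(U)$, then $\Phi^{X,T_X}_{k,p}(\sigma)$ vanishes on all $p$-tuples of vectors over points of $U$ that lie in the closure of the set of $p$-tuples of vectors of $d\iota_k(V'_k)$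 with a common base point. -/

import Mathlib

open Set Topology
open scoped Manifold ContDiff LinearAlgebra.Projectivization

universe u

namespace Semple

/-- The coordinates of `u` in the linearly independent family `e` (if `u` is in its span). -/
noncomputable def coef {ι W : Type*} [Fintype ι] [AddCommGroup W] [Module ℂ W]
    (e : ι → W) (u : W) : ι → ℂ :=
  Function.invFun (fun c : ι → ℂ => ∑ i, c i • e i) u

theorem coef_sum {ι W : Type*} [Fintype ι] [AddCommGroup W] [Module ℂ W] {e : ι → W}
    (he : LinearIndependent ℂ e) (c : ι → ℂ) : coef e (∑ i, c i • e i) = c := by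
  have hinj : Function.Injective (fun c : ι → ℂ => ∑ i, c i • e i) :=
     linearIndependent_iff_injective_fintypeLinearCombination.1 he
  exact Function.leftInverse_invFun hinj c

theorem sum_coef {ι W : Type*} [Fintype ι] [AddCommGroup W] [Module ℂ W] {e : ι → W} {u : W}
    (hu : u ∈ Submodule.span ℂ (range e)) : ∑ i, coef e u i • e i = u := by
  obtain ⟨c, hc⟩ := (Submodule.mem_span_range_iff_exists_fun ℂ).1 hu
  exact Function.invFun_eq (f := fun c : ι → ℂ => ∑ i, c i • e i) ⟨c, hc⟩

section

variable {E : Type} [NormedAddCommGroup E] [NormedSpace ℂ E]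
  {M : Type*} [TopologicalSpace M] [ChartedSpace E M]

/-- `s` is a holomorphic vector field on the set `U`. -/
def IsHolField [IsManifold 𝓘(ℂ, E) ω M] (s : ∀ x : M, TangentSpace 𝓘(ℂ, E) x) (U : Set M) : Prop :=
  ContMDiffOn 𝓘(ℂ, E) 𝓘(ℂ, E).tangent ω
    (fun x => (⟨x, s x⟩ : TangentBundle 𝓘(ℂ, E) M)) U

/-- The `e i` form a holomorphic frame of the family of subspaces `V` over the open set `U`. -/
structure IsHolFrameOn [IsManifold 𝓘(ℂ, E) ω M] {ι : Type*} (V : ∀ x : M, Submodule ℂ (TangentSpace 𝓘(ℂ, E) x))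
    (e : ι → ∀ x : M, TangentSpace 𝓘(ℂ, E) x) (U : Set M) : Prop where
  isOpen : IsOpen U
  hol : ∀ i, IsHolField (e i) U
  linInd : ∀ x ∈ U, LinearIndependent ℂ (fun i => e i x)
  span_eq : ∀ x ∈ U, Submodule.span ℂ (range fun i => e i x) = V x

/-- `V` is a holomorphic subbundle of rank `r` of the tangent bundle. -/
def IsHolSubbundle [IsManifold 𝓘(ℂ, E) ω M] 
    (V : ∀ x : M, Submodule ℂ (TangentSpace 𝓘(ℂ, E) x)) (r : ℕ) : Prop :=
  ∀ x₀ : M, ∃ (e : Fin r → ∀ x : M, TangentSpace 𝓘(ℂ, E) x) (U : Set M),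
    x₀ ∈ U ∧ IsHolFrameOn V e U

theorem IsHolFrameOn.reindex [IsManifold 𝓘(ℂ, E) ω M] {ι κ : Type*}
    {V : ∀ x : M, Submodule ℂ (TangentSpace 𝓘(ℂ, E) x)}
    {e : ι → ∀ x : M, TangentSpace 𝓘(ℂ, E) x} {U : Set M} (he : IsHolFrameOn V e U)
    (σ : κ ≃ ι) : IsHolFrameOn V (fun k => e (σ k)) U where
  isOpen := he.isOpen
  hol k := he.hol (σ k)
  linInd x hx := (he.linInd x hx).comp σ σ.injective
  span_eq x hx := by
    rw [← he.span_eq x hx]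
    congr 1
    exact σ.surjective.range_comp (fun i => e i x)

theorem coef_hol [FiniteDimensional ℂ E] [IsManifold 𝓘(ℂ, E) ω M] {ι : Type*} [Fintype ι]
    {V : ∀ x : M, Submodule ℂ (TangentSpace 𝓘(ℂ, E) x)}
    {e : ι → ∀ x : M, TangentSpace 𝓘(ℂ, E) x} {U : Set M} (he : IsHolFrameOn V e U)
    {s : ∀ x : M, TangentSpace 𝓘(ℂ, E) x} {U' : Set M} (hs : IsHolField s U')
    (hU' : IsOpen U') (hsV : ∀ x ∈ U', s x ∈ V x) (i : ι) :
    ContMDiffOn 𝓘(ℂ, E) 𝓘(ℂ) ω (fun x => coef (fun j => e j x) (s x) i) (U ∩ U') := by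
  classical
  rintro x₀ ⟨hx, hx'⟩
  apply ContMDiffAt.contMDiffWithinAt
  have : CompleteSpace E := FiniteDimensional.complete ℂ E
  set T := trivializationAt E (TangentSpace 𝓘(ℂ, E) : M → Type _) x₀ with hT
  have hsm : ContMDiffAt 𝓘(ℂ, E) 𝓘(ℂ, E) ω (fun x => (T ⟨x, s x⟩).2) x₀ :=
    (Bundle.contMDiffAt_section x₀).1 ((hs x₀ hx').contMDiffAt (hU'.mem_nhds hx'))
  have hem : ∀ j, ContMDiffAt 𝓘(ℂ, E) 𝓘(ℂ, E) ω (fun x => (T ⟨x, e j x⟩).2) x₀ := fun j =>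
    (Bundle.contMDiffAt_section x₀).1
      ((he.hol j x₀ hx).contMDiffAt (he.isOpen.mem_nhds hx))
  let A : M → ((ι → ℂ) →L[ℂ] E) := fun x =>
    ∑ j, (ContinuousLinearMap.proj (R := ℂ) (φ := fun _ : ι => ℂ) j).smulRight ((T ⟨x, e j x⟩).2)
  have hA : ContMDiffAt 𝓘(ℂ, E) 𝓘(ℂ, (ι → ℂ) →L[ℂ] E) ω A x₀ := by
    have : ∀ j, ContMDiffAt 𝓘(ℂ, E) 𝓘(ℂ, (ι → ℂ) →L[ℂ] E) ω (fun x => 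
      (ContinuousLinearMap.proj (R := ℂ) (φ := fun _ : ι => ℂ) j).smulRight ((T ⟨x, e j x⟩).2)) x₀ := by
      intro j
      exact ((ContinuousLinearMap.smulRightL ℂ (ι → ℂ) E
        (ContinuousLinearMap.proj (R := ℂ) (φ := fun _ : ι => ℂ) j)).contMDiff).contMDiffAt.comp x₀ (hem j)
    exact contMDiffAt_finsetSum (t := Finset.univ) (fun j _ => this j)
  have hAapp : ∀ x ∈ T.baseSet, ∀ c : ι → ℂ,
      A x c = T.linearMapAt ℂ x (∑ j, c j • e j x) := by
    intro x hx c
    simp only [A, map_sum, map_smul, T.coe_linearMapAt_of_mem hx]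
    simp
  have hb : x₀ ∈ T.baseSet := FiberBundle.mem_baseSet_trivializationAt' x₀
  have hinj : Function.Injective (A x₀) := by
    intro c c' h
    rw [hAapp _ hb, hAapp _ hb] at h
    have h2 : ∑ j, c j • e j x₀ = ∑ j, c' j • e j x₀ := by
      have := congrArg (T.symmₗ ℂ x₀) h
      rwa [T.symmₗ_linearMapAt hb, T.symmₗ_linearMapAt hb] at this
    rw [← coef_sum (he.linInd _ hx) c, ← coef_sum (he.linInd _ hx) c', h2]
  obtain ⟨L₀, hL₀⟩ := (A x₀).toLinearMap.exists_leftInverse_of_injective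
    (LinearMap.ker_eq_bot.2 hinj)
  let L : E →L[ℂ] (ι → ℂ) := L₀.toContinuousLinearMap
  have hL : L ∘L A x₀ = ContinuousLinearMap.id ℂ (ι → ℂ) := by
    ext1 c
    exact LinearMap.congr_fun hL₀ c
  have hLA : ContMDiffAt 𝓘(ℂ, E) 𝓘(ℂ, (ι → ℂ) →L[ℂ] (ι → ℂ)) ω (fun x => L ∘L A x) x₀ :=
    contMDiffAt_const.clm_comp hA
  have hinv : ContMDiffAt 𝓘(ℂ, E) 𝓘(ℂ, (ι → ℂ) →L[ℂ] (ι → ℂ)) ω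
      (fun x => ContinuousLinearMap.inverse (L ∘L A x)) x₀ := by
    have h1 : ContDiffAt ℂ ω (ContinuousLinearMap.inverse :
        ((ι → ℂ) →L[ℂ] (ι → ℂ)) → ((ι → ℂ) →L[ℂ] (ι → ℂ))) (L ∘L A x₀) := by
      rw [hL]
      exact contDiffAt_map_inverse (ContinuousLinearEquiv.refl ℂ (ι → ℂ))
    exact ContMDiffAt.comp x₀ h1.contMDiffAt hLA
  have hfin : ContMDiffAt 𝓘(ℂ, E) 𝓘(ℂ, ι → ℂ) ω
      (fun x => ContinuousLinearMap.inverse (L ∘L A x) (L ((T ⟨x, s x⟩).2))) x₀ :=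
    hinv.clm_apply (L.contMDiff.contMDiffAt.comp x₀ hsm)
  have hfin' : ContMDiffAt 𝓘(ℂ, E) 𝓘(ℂ) ω
      (fun x => ContinuousLinearMap.inverse (L ∘L A x) (L ((T ⟨x, s x⟩).2)) i) x₀ :=
    ((ContinuousLinearMap.proj (R := ℂ) (φ := fun _ : ι => ℂ) i).contMDiff).contMDiffAt.comp
      x₀ hfin
  refine hfin'.congr_of_eventuallyEq ?_
  have hunit : ∀ᶠ x in 𝓝 x₀, IsUnit (L ∘L A x) := by
    have : IsUnit (L ∘L A x₀) := by rw [hL]; exact isUnit_one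
    exact hLA.continuousAt.eventually_mem (Units.isOpen.mem_nhds this)
  filter_upwards [hunit, T.open_baseSet.mem_nhds hb, he.isOpen.mem_nhds hx, hU'.mem_nhds hx']
    with x h1 h2 h3 h4
  have h5 : (T ⟨x, s x⟩).2 = A x (coef (fun j => e j x) (s x)) := by
    rw [hAapp x h2, sum_coef, T.coe_linearMapAt_of_mem h2]
    rw [he.span_eq x h3]
    exact hsV x h4
  obtain ⟨u, hu⟩ := h1
  let w : (ι → ℂ) ≃L[ℂ] (ι → ℂ) := ContinuousLinearEquiv.unitsEquiv ℂ _ u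
  have hw : (w : (ι → ℂ) →L[ℂ] (ι → ℂ)) = L ∘L A x := hu
  rw [h5, ← hw, ContinuousLinearMap.inverse_equiv]
  have h6 : L (A x (coef (fun j => e j x) (s x))) = w (coef (fun j => e j x) (s x)) := by
    have := congrArg (fun f : (ι → ℂ) →L[ℂ] (ι → ℂ) => f (coef (fun j => e j x) (s x))) hw
    exact this.symm
  rw [h6]
  simp

theorem coef_add_smul {ι : Type*} {W : Type*} [Fintype ι] [AddCommGroup W] [Module ℂ W] {e : ι → W}
    (he : LinearIndependent ℂ e) {u : W} (hu : u ∈ Submodule.span ℂ (range e)) (c : ℂ) :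
    coef e (c • u) = c • coef e u := by
  conv_lhs => rw [← sum_coef hu, Finset.smul_sum]
  simp_rw [smul_smul]
  exact coef_sum he (fun i => c * coef e u i)

theorem coef_sum' {ι κ : Type*} {W : Type*} [Fintype ι] [Fintype κ] [AddCommGroup W] [Module ℂ W]
    {e : ι → W} (he : LinearIndependent ℂ e) {u : κ → W}
    (hu : ∀ k, u k ∈ Submodule.span ℂ (range e)) (c : κ → ℂ) (i : ι) :
    coef e (∑ k, c k • u k) i = ∑ k, c k * coef e (u k) i := by
  have : ∑ k, c k • u k = ∑ i, (∑ k, c k * coef e (u k) i) • e i := by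
    simp_rw [Finset.sum_smul]
    rw [Finset.sum_comm]
    refine Finset.sum_congr rfl fun k _ => ?_
    conv_lhs => rw [← sum_coef (hu k), Finset.smul_sum]
    simp_rw [smul_smul]
  rw [this, coef_sum he]

/-- The bundle `P(V)` of lines in `V`, as a set. -/
structure ProjBundle (V : ∀ x : M, Submodule ℂ (TangentSpace 𝓘(ℂ, E) x)) where
  base : M
  line : ℙ ℂ (V base)

namespace ProjBundle

variable {V : ∀ x : M, Submodule ℂ (TangentSpace 𝓘(ℂ, E) x)}

/-- The point `(x, [v])`. -/
noncomputable def mkVec (x : M) (v : TangentSpace 𝓘(ℂ, E) x) (hv : v ∈ V x) (h0 : v ≠ 0) : ProjBundle V :=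
  ⟨x, Projectivization.mk ℂ ⟨v, hv⟩ (fun h => h0 (congrArg Subtype.val h))⟩

/-- A nonzero vector on the line `q`. -/
noncomputable def vec (q : ProjBundle V) : TangentSpace 𝓘(ℂ, E) q.base := q.line.rep

theorem vec_mem (q : ProjBundle V) : q.vec ∈ V q.base := q.line.rep.2

theorem vec_ne (q : ProjBundle V) : q.vec ≠ 0 := fun h =>
  q.line.rep_nonzero (Subtype.ext h)

theorem mkVec_vec (q : ProjBundle V) : mkVec q.base q.vec q.vec_mem q.vec_ne = q := by
  cases q
  simp [mkVec, vec]

theorem mkVec_eq {x : M} {v w : TangentSpace 𝓘(ℂ, E) x} {hv : v ∈ V x} {h0 : v ≠ 0}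
    {hw : w ∈ V x} {hw0 : w ≠ 0} (c : ℂ) (h : c • w = v) :
    mkVec x v hv h0 = mkVec x w hw hw0 := by
  unfold mkVec
  congr 1
  rw [Projectivization.mk_eq_mk_iff']
  exact ⟨c, Subtype.ext h⟩

theorem exists_vec_mkVec {x : M} {v : TangentSpace 𝓘(ℂ, E) x} (hv : v ∈ V x) (h0 : v ≠ 0) :
    ∃ c : ℂ, c ≠ 0 ∧ (mkVec x v hv h0).vec = c • v := by
  obtain ⟨a, ha⟩ := Projectivization.exists_smul_eq_mk_rep ℂ (⟨v, hv⟩ : V x)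
    (fun h => h0 (congrArg Subtype.val h))
  exact ⟨a, a.ne_zero, (congrArg Subtype.val ha).symm⟩

end ProjBundle

/-- Data for a standard chart of `P(V)`: a chart of `M` and a frame of `V`. -/
structure FrameChart [IsManifold 𝓘(ℂ, E) ω M]
    (V : ∀ x : M, Submodule ℂ (TangentSpace 𝓘(ℂ, E) x)) (m : ℕ) where
  center : M
  dom : Set M
  e : Option (Fin m) → ∀ x : M, TangentSpace 𝓘(ℂ, E) x
  frame : IsHolFrameOn V e dom
  dom_sub : dom ⊆ (chartAt E center).source

namespace FrameChart

variable [IsManifold 𝓘(ℂ, E) ω M] {V : ∀ x : M, Submodule ℂ (TangentSpace 𝓘(ℂ, E) x)} {m : ℕ}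
  (F : FrameChart V m)

/-- The vector `e₀ + ∑ aⱼ eⱼ` at `x`. -/
noncomputable def vecAt (x : M) (a : Fin m → ℂ) : TangentSpace 𝓘(ℂ, E) x :=
  ∑ i, (Option.elim i 1 a : ℂ) • F.e i x

/-- The coordinates of a vector in the frame. -/
noncomputable def co (x : M) (v : TangentSpace 𝓘(ℂ, E) x) : Option (Fin m) → ℂ :=
  coef (fun i => F.e i x) v

theorem co_vecAt {x : M} (hx : x ∈ F.dom) (a : Fin m → ℂ) :
    F.co x (F.vecAt x a) = fun i => (Option.elim i 1 a : ℂ) :=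
  coef_sum (F.frame.linInd x hx) _

theorem vecAt_mem {x : M} (hx : x ∈ F.dom) (a : Fin m → ℂ) : F.vecAt x a ∈ V x := by
  rw [← F.frame.span_eq x hx]
  exact Submodule.sum_mem _ fun i _ => Submodule.smul_mem _ _ (Submodule.subset_span ⟨i, rfl⟩)

theorem vecAt_ne {x : M} (hx : x ∈ F.dom) (a : Fin m → ℂ) : F.vecAt x a ≠ 0 := by
  intro h
  have h1 := congrFun (F.co_vecAt hx a) none
  have h2 : F.co x ((0 : ℂ) • F.vecAt x a) = (0 : ℂ) • F.co x (F.vecAt x a) :=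
    coef_add_smul (F.frame.linInd x hx) (by rw [F.frame.span_eq x hx]; exact F.vecAt_mem hx a) 0
  rw [zero_smul, zero_smul, ← h] at h2
  rw [h2] at h1
  simp at h1

theorem co_smul {x : M} (hx : x ∈ F.dom) {v : TangentSpace 𝓘(ℂ, E) x} (hv : v ∈ V x) (c : ℂ) :
    F.co x (c • v) = c • F.co x v :=
  coef_add_smul (F.frame.linInd x hx) (by rwa [F.frame.span_eq x hx]) c

open Classical in
/-- The point `(x, [e₀ + ∑ aⱼ eⱼ])` of `P(V)`, with a default value outside the domain. -/
noncomputable def pt (p₀ : ProjBundle V) (x : M) (a : Fin m → ℂ) : ProjBundle V :=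
  if h : x ∈ F.dom then ProjBundle.mkVec x (F.vecAt x a) (F.vecAt_mem h a) (F.vecAt_ne h a)
  else p₀

/-- The standard chart `(x, [∑ cⱼ eⱼ]) ↦ (x, (cⱼ / c₀)ⱼ)` of `P(V)`. -/
noncomputable def chart (p₀ : ProjBundle V) :
    PartialEquiv (ProjBundle V) (E × (Fin m → ℂ)) where
  toFun q := (chartAt E F.center q.base,
    fun j => F.co q.base q.vec (some j) / F.co q.base q.vec none)
  invFun p := F.pt p₀ ((chartAt E F.center).symm p.1) p.2
  source := {q | q.base ∈ F.dom ∧ F.co q.base q.vec none ≠ 0}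
  target := {p | p.1 ∈ (chartAt E F.center).target ∧ (chartAt E F.center).symm p.1 ∈ F.dom}
  map_source' := by
    rintro q ⟨h1, h2⟩
    refine ⟨(chartAt E F.center).map_source (F.dom_sub h1), ?_⟩
    simp only
    rwa [(chartAt E F.center).left_inv (F.dom_sub h1)]
  map_target' := by
    rintro ⟨y, a⟩ ⟨h1, h2⟩
    simp only at h1 h2 ⊢
    rw [pt, dif_pos h2]
    refine ⟨h2, ?_⟩
    obtain ⟨c, hc, hv⟩ := ProjBundle.exists_vec_mkVec (F.vecAt_mem h2 a) (F.vecAt_ne h2 a)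
    rw [hv]
    change F.co ((chartAt E F.center).symm y) _ _ ≠ 0
    rw [F.co_smul h2 (F.vecAt_mem h2 a), F.co_vecAt h2]
    simpa using hc
  left_inv' := by
    rintro q ⟨h1, h2⟩
    simp only
    rw [(chartAt E F.center).left_inv (F.dom_sub h1), pt, dif_pos h1]
    conv_rhs => rw [← q.mkVec_vec]
    refine ProjBundle.mkVec_eq (F.co q.base q.vec none)⁻¹ ?_
    have hs : ∑ i, F.co q.base q.vec i • F.e i q.base = q.vec :=
      sum_coef (by rw [F.frame.span_eq _ h1]; exact q.vec_mem)
    set c := F.co q.base q.vec with hc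
    rw [← hs, Finset.smul_sum, vecAt]
    refine Finset.sum_congr rfl fun i _ => ?_
    rw [smul_smul]
    congr 1
    cases i with
    | none => exact inv_mul_cancel₀ h2
    | some j => exact (div_eq_inv_mul _ _).symm
  right_inv' := by
    rintro ⟨y, a⟩ ⟨h1, h2⟩
    simp only at h1 h2 ⊢
    rw [pt, dif_pos h2]
    obtain ⟨c, hc, hv⟩ := ProjBundle.exists_vec_mkVec (F.vecAt_mem h2 a) (F.vecAt_ne h2 a)
    rw [hv]
    refine Prod.ext ((chartAt E F.center).right_inv h1) ?_
    change (fun j => F.co ((chartAt E F.center).symm y) _ _ / 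
      F.co ((chartAt E F.center).symm y) _ _) = a
    rw [F.co_smul h2 (F.vecAt_mem h2 a), F.co_vecAt h2]
    funext j
    simp [hc]

/-- The transition matrix between two frames. -/
noncomputable def trans (F F' : FrameChart V m) (i j : Option (Fin m)) (x : M) : ℂ :=
  F'.co x (F.e j x) i

theorem trans_hol [FiniteDimensional ℂ E] (F F' : FrameChart V m) (i j : Option (Fin m)) :
    ContMDiffOn 𝓘(ℂ, E) 𝓘(ℂ) ω (trans F F' i j) (F'.dom ∩ F.dom) := by
  refine coef_hol F'.frame (F.frame.hol j) F.frame.isOpen (fun x hx => ?_) i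
  rw [← F.frame.span_eq x hx]
  exact Submodule.subset_span ⟨j, rfl⟩

theorem co_vecAt' (F F' : FrameChart V m) {x : M} (hx : x ∈ F.dom) (hx' : x ∈ F'.dom)
    (a : Fin m → ℂ) (i : Option (Fin m)) :
    F'.co x (F.vecAt x a) i = ∑ j, (Option.elim j 1 a : ℂ) * trans F F' i j x := by
  refine coef_sum' (F'.frame.linInd x hx') (fun j => ?_) _ i
  rw [F'.frame.span_eq x hx', ← F.frame.span_eq x hx]
  exact Submodule.subset_span ⟨j, rfl⟩

/-- The coordinates in the frame of `F'` of the vector with coordinates `p` in `F`. -/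
noncomputable def transCo (F F' : FrameChart V m) (i : Option (Fin m)) (p : E × (Fin m → ℂ)) : ℂ :=
  ∑ j, (Option.elim j 1 p.2 : ℂ) * trans F F' i j ((chartAt E F.center).symm p.1)

/-- The part of the base over which two charts overlap, in coordinates. -/
def overlap (F F' : FrameChart V m) : Set (E × (Fin m → ℂ)) :=
  Prod.fst ⁻¹' ((chartAt E F.center).target ∩
    (chartAt E F.center).symm ⁻¹' (F'.dom ∩ F.dom))

theorem isOpen_overlap (F F' : FrameChart V m) : IsOpen (overlap F F') :=
  ((chartAt E F.center).isOpen_inter_preimage_symm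
    (F'.frame.isOpen.inter F.frame.isOpen)).preimage continuous_fst

theorem transCo_hol [FiniteDimensional ℂ E] (F F' : FrameChart V m) (i : Option (Fin m)) :
    ContDiffOn ℂ ω (transCo F F' i) (overlap F F') := by
  unfold transCo
  refine ContDiffOn.sum fun j _ => ContDiffOn.mul ?_ ?_
  · cases j with
    | none => exact contDiffOn_const
    | some j =>
      exact ((contDiff_apply ℂ ℂ j).comp contDiff_snd).contDiffOn
  · have h1 : ContMDiffOn 𝓘(ℂ, E) 𝓘(ℂ) ω
        (fun y => trans F F' i j ((chartAt E F.center).symm y))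
        ((chartAt E F.center).target ∩ (chartAt E F.center).symm ⁻¹' (F'.dom ∩ F.dom)) :=
      (trans_hol F F' i j).comp (contMDiffOn_chart_symm.mono inter_subset_left)
        inter_subset_right
    exact (contMDiffOn_iff_contDiffOn.1 h1).comp contDiff_fst.contDiffOn (fun p hp => hp)

theorem chart_trans_source (p₀ p₁ : ProjBundle V) (F F' : FrameChart V m) :
    ((F.chart p₀).symm.trans (F'.chart p₁)).source =
      overlap F F' ∩ transCo F F' none ⁻¹' {0}ᶜ := by
  ext ⟨y, a⟩
  rw [PartialEquiv.trans_source, PartialEquiv.symm_source]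
  constructor
  · rintro ⟨⟨h1, h2⟩, h3⟩
    change (F.pt p₀ ((chartAt E F.center).symm y) a).base ∈ F'.dom ∧
      F'.co (F.pt p₀ ((chartAt E F.center).symm y) a).base
        (F.pt p₀ ((chartAt E F.center).symm y) a).vec none ≠ 0 at h3
    change (chartAt E F.center).symm y ∈ F.dom at h2
    rw [pt, dif_pos h2] at h3
    obtain ⟨h3, h4⟩ := h3
    change (chartAt E F.center).symm y ∈ F'.dom at h3
    refine ⟨⟨h1, h3, h2⟩, ?_⟩
    obtain ⟨c, hc, hv⟩ := ProjBundle.exists_vec_mkVec (F.vecAt_mem h2 a) (F.vecAt_ne h2 a)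
    rw [hv] at h4
    change F'.co ((chartAt E F.center).symm y) _ none ≠ 0 at h4
    rw [F'.co_smul h3 (F.vecAt_mem h2 a)] at h4
    simp only [Pi.smul_apply, co_vecAt' F F' h2 h3, smul_eq_mul, ne_eq, mul_eq_zero, hc,
      false_or] at h4
    exact h4
  · rintro ⟨⟨h1, h3, h2⟩, h4⟩
    refine ⟨⟨h1, h2⟩, ?_⟩
    change (F.pt p₀ ((chartAt E F.center).symm y) a).base ∈ F'.dom ∧
      F'.co (F.pt p₀ ((chartAt E F.center).symm y) a).base
        (F.pt p₀ ((chartAt E F.center).symm y) a).vec none ≠ 0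
    change (chartAt E F.center).symm y ∈ F'.dom at h3
    change (chartAt E F.center).symm y ∈ F.dom at h2
    rw [pt, dif_pos h2]
    refine ⟨h3, ?_⟩
    obtain ⟨c, hc, hv⟩ := ProjBundle.exists_vec_mkVec (F.vecAt_mem h2 a) (F.vecAt_ne h2 a)
    rw [hv]
    change F'.co ((chartAt E F.center).symm y) _ none ≠ 0
    rw [F'.co_smul h3 (F.vecAt_mem h2 a)]
    simp only [Pi.smul_apply, co_vecAt' F F' h2 h3, smul_eq_mul, ne_eq, mul_eq_zero, hc,
      false_or]
    exact h4

theorem chart_trans_apply (p₀ p₁ : ProjBundle V) (F F' : FrameChart V m) {p : E × (Fin m → ℂ)}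
    (hp : p ∈ overlap F F') :
    (F.chart p₀).symm.trans (F'.chart p₁) p =
      (chartAt E F'.center ((chartAt E F.center).symm p.1),
        fun j => transCo F F' (some j) p / transCo F F' none p) := by
  obtain ⟨y, a⟩ := p
  obtain ⟨h1, h3, h2⟩ := hp
  change (chartAt E F.center).symm y ∈ F'.dom at h3
  change (chartAt E F.center).symm y ∈ F.dom at h2
  change F'.chart p₁ (F.pt p₀ _ _) = _
  simp only
  rw [pt, dif_pos h2]
  obtain ⟨c, hc, hv⟩ := ProjBundle.exists_vec_mkVec (F.vecAt_mem h2 a) (F.vecAt_ne h2 a)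
  refine Prod.ext rfl ?_
  funext j
  change F'.co _ (ProjBundle.mkVec _ _ _ _).vec (some j) /
    F'.co _ (ProjBundle.mkVec _ _ _ _).vec none = _
  rw [hv]
  change F'.co ((chartAt E F.center).symm y) _ (some j) /
    F'.co ((chartAt E F.center).symm y) _ none = _
  rw [F'.co_smul h3 (F.vecAt_mem h2 a)]
  simp only [Pi.smul_apply, co_vecAt' F F' h2 h3, smul_eq_mul]
  rw [mul_div_mul_left _ _ hc]
  rfl

theorem chart_trans_hol [FiniteDimensional ℂ E] (p₀ p₁ : ProjBundle V) (F F' : FrameChart V m) :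
    ContDiffOn ℂ ω ((F.chart p₀).symm.trans (F'.chart p₁))
      ((F.chart p₀).symm.trans (F'.chart p₁)).source := by
  rw [chart_trans_source]
  have h1 : ContDiffOn ℂ ω (fun p : E × (Fin m → ℂ) =>
      (chartAt E F'.center ((chartAt E F.center).symm p.1),
        fun j => transCo F F' (some j) p / transCo F F' none p))
      (overlap F F' ∩ transCo F F' none ⁻¹' {0}ᶜ) := by
    refine ContDiffOn.prodMk ?_ (contDiffOn_pi.2 fun j => ?_)
    · have h2 : ContMDiffOn 𝓘(ℂ, E) 𝓘(ℂ, E) ω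
          (fun y => chartAt E F'.center ((chartAt E F.center).symm y))
          ((chartAt E F.center).target ∩ (chartAt E F.center).symm ⁻¹' (F'.dom ∩ F.dom)) :=
        contMDiffOn_chart.comp (contMDiffOn_chart_symm.mono inter_subset_left)
          (fun y hy => F'.dom_sub hy.2.1)
      exact (contMDiffOn_iff_contDiffOn.1 h2).comp contDiff_fst.contDiffOn (fun p hp => hp.1)
    · exact ((transCo_hol F F' _).mono inter_subset_left).div
        ((transCo_hol F F' _).mono inter_subset_left) (fun p hp => hp.2)
  exact h1.congr fun p hp => chart_trans_apply p₀ p₁ F F' hp.1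

theorem exists_chart (hV : IsHolSubbundle V (m + 1)) (q : ProjBundle V) :
    ∃ F : FrameChart V m, q ∈ (F.chart q).source := by
  obtain ⟨e, U, hU, he⟩ := hV q.base
  have hs : ∑ i, coef (fun i => e i q.base) q.vec i • e i q.base = q.vec :=
    sum_coef (by rw [he.span_eq _ hU]; exact q.vec_mem)
  obtain ⟨i₀, hi₀⟩ : ∃ i, coef (fun i => e i q.base) q.vec i ≠ 0 := by
    by_contra! h
    apply q.vec_ne
    rw [← hs]
    simp [h]
  let σ : Option (Fin m) ≃ Fin (m + 1) := (finSuccEquiv' i₀).symm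
  have hσ : σ none = i₀ := by simp [σ]
  have hr : ∀ x, range (fun i => e (σ i) x) = range (fun i => e i x) := fun x =>
    σ.surjective.range_comp (fun i => e i x)
  let F : FrameChart V m :=
    { center := q.base
      dom := U ∩ (chartAt E q.base).source
      e := fun i => e (σ i)
      frame :=
        { isOpen := he.isOpen.inter (chartAt E q.base).open_source
          hol := fun i => (he.hol (σ i)).mono inter_subset_left
          linInd := fun x hx => (he.linInd x hx.1).comp σ σ.injective
          span_eq := fun x hx => by rw [hr, he.span_eq x hx.1] }
      dom_sub := inter_subset_right }
  refine ⟨F, ⟨hU, mem_chart_source E q.base⟩, ?_⟩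
  have h2 : F.co q.base q.vec = fun i => coef (fun i => e i q.base) q.vec (σ i) := by
    have h3 : q.vec = ∑ i, coef (fun i => e i q.base) q.vec (σ i) • e (σ i) q.base := by
      conv_lhs => rw [← hs]
      exact (Equiv.sum_comp σ (fun i => coef (fun i => e i q.base) q.vec i • e i q.base)).symm
    have h4 := coef_sum (e := fun i => e (σ i) q.base)
      ((he.linInd q.base hU).comp σ σ.injective)
      (fun i => coef (fun i => e i q.base) q.vec (σ i))
    rw [← h3] at h4
    exact h4
  rw [h2]
  simpa [hσ] using hi₀

end FrameChart

end

section Pullback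

variable {E : Type} [NormedAddCommGroup E] [NormedSpace ℂ E] [FiniteDimensional ℂ E]
  {M : Type*} [TopologicalSpace M] [ChartedSpace E M] [IsManifold 𝓘(ℂ, E) ω M]
  {E' : Type} [NormedAddCommGroup E'] [NormedSpace ℂ E']
  {M' : Type*} [TopologicalSpace M'] [ChartedSpace E' M'] [IsManifold 𝓘(ℂ, E') ω M']

/-- Pullback of a frame by a local biholomorphism. -/
theorem IsHolFrameOn.pullback {ι : Type*} {V : ∀ x : M, Submodule ℂ (TangentSpace 𝓘(ℂ, E) x)}
    {V' : ∀ x : M', Submodule ℂ (TangentSpace 𝓘(ℂ, E') x)}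
    {e : ι → ∀ x : M', TangentSpace 𝓘(ℂ, E') x} {U' : Set M'} (he : IsHolFrameOn V' e U')
    {f : M → M'} {U : Set M} (hU : IsOpen U) (hf : ContMDiffOn 𝓘(ℂ, E) 𝓘(ℂ, E') ω f U)
    (hfU : MapsTo f U U')
    (hinv : ∀ x ∈ U, (mfderiv 𝓘(ℂ, E) 𝓘(ℂ, E') f x).IsInvertible)
    (hV : ∀ x ∈ U, V x = (V' (f x)).comap (mfderiv 𝓘(ℂ, E) 𝓘(ℂ, E') f x).toLinearMap) :
    IsHolFrameOn V (fun i => VectorField.mpullback 𝓘(ℂ, E) 𝓘(ℂ, E') f (e i)) U := by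
  have : CompleteSpace E := FiniteDimensional.complete ℂ E
  have key : ∀ x ∈ U, ∀ i, mfderiv 𝓘(ℂ, E) 𝓘(ℂ, E') f x
      (VectorField.mpullback 𝓘(ℂ, E) 𝓘(ℂ, E') f (e i) x) = e i (f x) := by
    intro x hx i
    rw [VectorField.mpullback_apply]
    exact ((hinv x hx).inverse_apply_eq.1 rfl).symm
  refine ⟨hU, fun i x hx => ?_, fun x hx => ?_, fun x hx => ?_⟩
  · refine ContMDiffAt.contMDiffWithinAt ?_
    refine ContMDiffAt.mpullback_vectorField_preimage (n := ω) ?_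
      ((hf x hx).contMDiffAt (hU.mem_nhds hx)) (hinv x hx) le_top
    exact (he.hol i (f x) (hfU hx)).contMDiffAt (he.isOpen.mem_nhds (hfU hx))
  · refine LinearIndependent.of_comp (mfderiv 𝓘(ℂ, E) 𝓘(ℂ, E') f x).toLinearMap ?_
    convert he.linInd (f x) (hfU hx) using 1
    funext i
    exact key x hx i
  · rw [hV x hx, ← he.span_eq (f x) (hfU hx)]
    have h1 : (range fun i => e i (f x)) = (mfderiv 𝓘(ℂ, E) 𝓘(ℂ, E') f x).toLinearMap ''
        (range fun i => VectorField.mpullback 𝓘(ℂ, E) 𝓘(ℂ, E') f (e i) x) := by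
      rw [← range_comp]
      congr 1
      funext i
      exact (key x hx i).symm
    rw [h1, ← Submodule.map_span, Submodule.comap_map_eq_of_injective]
    obtain ⟨L, hL⟩ := hinv x hx
    rw [← hL]
    exact L.injective

end Pullback

/-- A complex manifold `M` together with a holomorphic subbundle `V` of rank `r` of its tangent
bundle. -/
structure DirectedManifold (r : ℕ) where
  E : Type
  [normedAddCommGroup : NormedAddCommGroup E]
  [normedSpace : NormedSpace ℂ E]
  [finiteDimensional : FiniteDimensional ℂ E]
  M : Type u
  [topologicalSpace : TopologicalSpace M]
  [chartedSpace : ChartedSpace E M]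
  [isManifold : IsManifold 𝓘(ℂ, E) ω M]
  V : ∀ x : M, Submodule ℂ (TangentSpace 𝓘(ℂ, E) x)
  isHolSubbundle : IsHolSubbundle V r

namespace DirectedManifold

attribute [instance] normedAddCommGroup normedSpace finiteDimensional topologicalSpace
  chartedSpace isManifold

variable {r : ℕ} (D : DirectedManifold.{u} r)

/-- The total space of the bundle `P(V)` of lines in `V`. -/
abbrev P : Type u := ProjBundle D.V

/-- The model space of `P(V)`. -/
abbrev PE : Type := D.E × (Fin (r - 1) → ℂ)

theorem exists_chart (q : D.P) : ∃ F : FrameChart D.V (r - 1), q ∈ (F.chart q).source := by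
  refine FrameChart.exists_chart ?_ q
  have hr : r - 1 + 1 = r := by
    rcases r with _ | r
    · exfalso
      obtain ⟨e, U, hU, he⟩ := D.isHolSubbundle (ProjBundle.base q)
      have h := he.span_eq _ hU
      rw [range_eq_empty, Submodule.span_empty] at h
      have h1 := ProjBundle.vec_mem q
      rw [← h] at h1
      exact ProjBundle.vec_ne q h1
    · rfl
  rw [hr]
  exact D.isHolSubbundle

/-- The standard charts of `P(V)`. -/
noncomputable def core : ChartedSpaceCore D.PE D.P where
  atlas := {c | ∃ (F : FrameChart D.V (r - 1)) (p : ProjBundle D.V), c = F.chart p}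
  chartAt q := (D.exists_chart q).choose.chart q
  mem_chart_source q := (D.exists_chart q).choose_spec
  chart_mem_atlas q := ⟨_, q, rfl⟩
  open_source := by
    rintro _ _ ⟨F, p, rfl⟩ ⟨F', p', rfl⟩
    rw [FrameChart.chart_trans_source]
    exact (FrameChart.transCo_hol F F' none).continuousOn.isOpen_inter_preimage
      (FrameChart.isOpen_overlap F F') isOpen_compl_singleton
  continuousOn_toFun := by
    rintro _ _ ⟨F, p, rfl⟩ ⟨F', p', rfl⟩
    exact (FrameChart.chart_trans_hol p p' F F').continuousOn

noncomputable instance : TopologicalSpace D.P := D.core.toTopologicalSpace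

noncomputable instance : ChartedSpace D.PE D.P := D.core.toChartedSpace

instance : IsManifold 𝓘(ℂ, D.PE) ω D.P := by
  refine isManifold_of_contDiffOn _ _ _ ?_
  intro c c' hc hc'
  obtain ⟨_, ⟨c, rfl⟩, _, ⟨⟨F, p, rfl⟩, rfl⟩, rfl⟩ := hc
  obtain ⟨_, ⟨c', rfl⟩, _, ⟨⟨F', p', rfl⟩, rfl⟩, rfl⟩ := hc'
  have := FrameChart.chart_trans_hol p p' F F'
  simpa using! this

/-- The projection `π : P(V) → M`. -/
def proj (q : D.P) : D.M := ProjBundle.base q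

/-- The line in `T_{M,π(q)}` given by the point `q` of `P(V)`. -/
noncomputable def line (q : D.P) : Submodule ℂ (TangentSpace 𝓘(ℂ, D.E) (D.proj q)) :=
  (ProjBundle.line q).submodule.map (D.V (D.proj q)).subtype

/-- The differential of the projection `π : P(V) → M`. -/
noncomputable def dproj (q : D.P) :
    TangentSpace 𝓘(ℂ, D.PE) q →L[ℂ] TangentSpace 𝓘(ℂ, D.E) (D.proj q) :=
  mfderiv 𝓘(ℂ, D.PE) 𝓘(ℂ, D.E) D.proj q

/-- The subspace of all `ξ ∈ T_{P(V),(x,[v])}` such that `π_* ξ ∈ ℂ v`. -/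
noncomputable def liftV (q : D.P) : Submodule ℂ (TangentSpace 𝓘(ℂ, D.PE) q) :=
  (D.line q).comap (D.dproj q).toLinearMap

end DirectedManifold
namespace DirectedManifold

variable {r : ℕ} (D : DirectedManifold.{u} r)

theorem line_eq (q : D.P) : D.line q = Submodule.span ℂ {ProjBundle.vec q} := by
  rw [line, Projectivization.submodule_eq]
  exact (Submodule.map_span _ _).trans (congrArg (Submodule.span ℂ) image_singleton)

/-- A standard chart of `P(V)`. -/
noncomputable def frameChart (F : FrameChart D.V (r - 1)) (p : D.P) :
    OpenPartialHomeomorph D.P D.PE :=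
  D.core.openPartialHomeomorph (F.chart p) ⟨F, p, rfl⟩

theorem frameChart_mem_atlas (F : FrameChart D.V (r - 1)) (p : D.P) :
    D.frameChart F p ∈ atlas D.PE D.P :=
  mem_iUnion.2 ⟨F.chart p, mem_iUnion.2 ⟨⟨F, p, rfl⟩, rfl⟩⟩

theorem contMDiff_proj : ContMDiff 𝓘(ℂ, D.PE) 𝓘(ℂ, D.E) ω D.proj := by
  intro q
  obtain ⟨F, hF⟩ := D.exists_chart q
  have h1 : ContMDiffAt 𝓘(ℂ, D.PE) 𝓘(ℂ, D.PE) ω (D.frameChart F q) q :=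
    contMDiffAt_of_mem_maximalAtlas
      (IsManifold.subset_maximalAtlas (D.frameChart_mem_atlas F q)) hF
  have h2 : ContMDiffAt 𝓘(ℂ, D.PE) 𝓘(ℂ, D.E) ω (fun q' => (D.frameChart F q q').1) q :=
    (contDiff_fst.contMDiff.contMDiffAt).comp q h1
  have h3 : ContMDiffAt 𝓘(ℂ, D.E) 𝓘(ℂ, D.E) ω (chartAt D.E F.center).symm
      (D.frameChart F q q).1 :=
    contMDiffOn_chart_symm.contMDiffAt ((chartAt D.E F.center).open_target.mem_nhds
      ((chartAt D.E F.center).map_source (F.dom_sub hF.1)))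
  have h4 := h3.comp q h2
  refine h4.congr_of_eventuallyEq ?_
  filter_upwards [(D.frameChart F q).open_source.mem_nhds hF] with q' hq'
  exact ((chartAt D.E F.center).left_inv (F.dom_sub hq'.1)).symm

/-- In coordinates the differential of `π` is the first projection. -/
theorem chart_dproj {F : FrameChart D.V (r - 1)} {p q : D.P}
    (hq : q ∈ (D.frameChart F p).source) (ξ : TangentSpace 𝓘(ℂ, D.PE) q) :
    (mfderiv 𝓘(ℂ, D.E) 𝓘(ℂ, D.E) (chartAt D.E F.center) (D.proj q) (D.dproj q ξ) : D.E) =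
      (mfderiv 𝓘(ℂ, D.PE) 𝓘(ℂ, D.PE) (D.frameChart F p) q ξ : D.PE).1 := by
  have hb : D.proj q ∈ (chartAt D.E F.center).source := F.dom_sub hq.1
  have h1 : MDifferentiableAt 𝓘(ℂ, D.PE) 𝓘(ℂ, D.PE) (D.frameChart F p) q :=
    mdifferentiableAt_atlas (D.frameChart_mem_atlas F p) hq
  have h2 : MDifferentiableAt 𝓘(ℂ, D.E) 𝓘(ℂ, D.E) (chartAt D.E F.center) (D.proj q) :=
    mdifferentiableAt_atlas (chart_mem_atlas _ _) hb
  have h3 : MDifferentiableAt 𝓘(ℂ, D.PE) 𝓘(ℂ, D.E) D.proj q :=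
    (D.contMDiff_proj q).mdifferentiableAt (by simp)
  have h4 : MDifferentiableAt 𝓘(ℂ, D.PE) 𝓘(ℂ, D.E) (Prod.fst : D.PE → D.E)
      (D.frameChart F p q) := (contDiff_fst (n := ω)).contMDiff.mdifferentiableAt (by simp)
  have h5 := mfderiv_comp q h2 h3
  have h6 := mfderiv_comp q h4 h1
  have h7 : (chartAt D.E F.center : D.M → D.E) ∘ D.proj = Prod.fst ∘ D.frameChart F p := rfl
  rw [h7] at h5
  rw [h6] at h5
  have h8 := congrArg (fun L => L ξ) h5
  have h9 : mfderiv 𝓘(ℂ, D.PE) 𝓘(ℂ, D.E) (Prod.fst : D.PE → D.E) (D.frameChart F p q) =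
      ContinuousLinearMap.fst ℂ D.E (Fin (r - 1) → ℂ) := by
    rw [mfderiv_eq_fderiv]
    exact fderiv_fst
  rw [h9] at h8
  exact h8.symm

/-- The coordinate expression of the frame vector `eⱼ`. -/
noncomputable def hatE (F : FrameChart D.V (r - 1)) (j : Option (Fin (r - 1))) (y : D.E) : D.E :=
  mfderiv 𝓘(ℂ, D.E) 𝓘(ℂ, D.E) (chartAt D.E F.center) ((chartAt D.E F.center).symm y)
    (F.e j ((chartAt D.E F.center).symm y))

theorem hatE_hol (F : FrameChart D.V (r - 1)) (j : Option (Fin (r - 1))) :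
    ContDiffOn ℂ ω (D.hatE F j)
      ((chartAt D.E F.center).target ∩ (chartAt D.E F.center).symm ⁻¹' F.dom) := by
  rw [← contMDiffOn_iff_contDiffOn]
  have h1 : ContMDiffOn 𝓘(ℂ, D.E) 𝓘(ℂ, D.E) ω (fun x =>
      (trivializationAt D.E (TangentSpace 𝓘(ℂ, D.E) : D.M → Type _) F.center ⟨x, F.e j x⟩).2)
      F.dom :=
    (Bundle.Trivialization.contMDiffOn_section_iff _ F.frame.isOpen (by
      intro x hx
      simpa using! F.dom_sub hx)).1 (F.frame.hol j)
  refine (h1.comp (contMDiffOn_chart_symm.mono inter_subset_left) inter_subset_right).congr ?_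
  rintro y ⟨hy, hy'⟩
  have hs := F.dom_sub hy'
  have h2 := TangentBundle.continuousLinearMapAt_trivializationAt (I := 𝓘(ℂ, D.E)) hs
  have h4 := congrArg (fun L => L (F.e j ((chartAt D.E F.center).symm y))) h2
  refine Eq.trans ?_ (h4.symm.trans ?_)
  · rfl
  · rw [Bundle.Trivialization.continuousLinearMapAt_apply,
      Bundle.Trivialization.coe_linearMapAt_of_mem]
    · rfl
    · simpa using! hs

/-- The frame of the lifted bundle in coordinates. -/
noncomputable def liftFrame (F : FrameChart D.V (r - 1)) : Option (Fin (r - 1)) → D.PE → D.PE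
  | none => fun p => (∑ i, (Option.elim i 1 p.2 : ℂ) • D.hatE F i p.1, 0)
  | some j => fun _ => (0, Pi.single j 1)

theorem sum_liftFrame (F : FrameChart D.V (r - 1)) (p : D.PE) (g : Option (Fin (r - 1)) → ℂ) :
    ∑ i, g i • D.liftFrame F i p =
      (g none • (∑ i, (Option.elim i 1 p.2 : ℂ) • D.hatE F i p.1), fun j => g (some j)) := by
  rw [Fintype.sum_option]
  refine Prod.ext ?_ ?_
  · rw [Prod.fst_add, Prod.fst_sum]
    simp [liftFrame]
  · rw [Prod.snd_add, Prod.snd_sum]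
    funext j
    simp [liftFrame, Finset.sum_apply, Pi.single_apply]

theorem hatE_chart (F : FrameChart D.V (r - 1)) (j : Option (Fin (r - 1))) {x : D.M}
    (hx : x ∈ (chartAt D.E F.center).source) :
    D.hatE F j (chartAt D.E F.center x) =
      mfderiv 𝓘(ℂ, D.E) 𝓘(ℂ, D.E) (chartAt D.E F.center) x (F.e j x) := by
  let g : D.M → D.E := fun x =>
    mfderiv 𝓘(ℂ, D.E) 𝓘(ℂ, D.E) (chartAt D.E F.center) x (F.e j x)
  change g ((chartAt D.E F.center).symm (chartAt D.E F.center x)) = g x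
  rw [(chartAt D.E F.center).left_inv hx]

theorem sum_hatE (F : FrameChart D.V (r - 1)) (a : Fin (r - 1) → ℂ) {x : D.M}
    (hx : x ∈ (chartAt D.E F.center).source) :
    ∑ i, (Option.elim i 1 a : ℂ) • D.hatE F i (chartAt D.E F.center x) =
      mfderiv 𝓘(ℂ, D.E) 𝓘(ℂ, D.E) (chartAt D.E F.center) x (F.vecAt x a) := by
  simp only [D.hatE_chart F _ hx, FrameChart.vecAt]
  exact ((map_sum _ _ _).trans (Finset.sum_congr rfl fun i _ => map_smul _ _ _)).symm

theorem mfderiv_chart_injective (y x : D.M) (hx : x ∈ (chartAt D.E y).source) :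
    Function.Injective (mfderiv 𝓘(ℂ, D.E) 𝓘(ℂ, D.E) (chartAt D.E y) x) :=
  ((mdifferentiable_chart (I := 𝓘(ℂ, D.E)) y).mfderiv hx).injective

theorem liftFrame_frame (F : FrameChart D.V (r - 1)) (p : D.P) :
    IsHolFrameOn (M := D.PE) (E := D.PE)
      (fun q => Submodule.span ℂ (range fun i => (D.liftFrame F i q : TangentSpace 𝓘(ℂ, D.PE) q)))
      (D.liftFrame F) (D.frameChart F p).target where
  isOpen := (D.frameChart F p).open_target
  hol := by
    intro i
    unfold IsHolField
    refine contMDiffOn_vectorSpace_iff_contDiffOn.2 ?_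
    cases i with
    | none =>
      refine ContDiffOn.prodMk (ContDiffOn.sum fun i _ => ContDiffOn.smul ?_ ?_)
        contDiffOn_const
      · cases i with
        | none => exact contDiffOn_const
        | some j => exact ((contDiff_apply ℂ ℂ j).comp contDiff_snd).contDiffOn
      · exact (D.hatE_hol F i).comp contDiff_fst.contDiffOn (fun p hp => hp)
    | some j => exact contDiffOn_const
  linInd := by
    rintro ⟨y, a⟩ ⟨h1, h2⟩
    change (chartAt D.E F.center).symm y ∈ F.dom at h2
    have hw : ∑ i, (Option.elim i 1 a : ℂ) • D.hatE F i y ≠ 0 := by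
      have h3 := D.sum_hatE F a (F.dom_sub h2)
      rw [(chartAt D.E F.center).right_inv h1] at h3
      rw [h3]
      intro h4
      exact F.vecAt_ne h2 a (D.mfderiv_chart_injective _ _ (F.dom_sub h2)
        (h4.trans (map_zero _).symm))
    change LinearIndependent ℂ (fun i => (D.liftFrame F i (y, a) : D.PE))
    rw [Fintype.linearIndependent_iff]
    intro g hg
    rw [D.sum_liftFrame] at hg
    rintro (_ | j)
    · exact (smul_eq_zero.1 (congrArg Prod.fst hg)).resolve_right hw
    · exact congrFun (congrArg Prod.snd hg) j
  span_eq _ _ := rfl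

theorem vecAt_eq {F : FrameChart D.V (r - 1)} {p q : D.P}
    (hq : q ∈ (D.frameChart F p).source) :
    F.vecAt (D.proj q) (D.frameChart F p q).2 =
      (F.co (D.proj q) (ProjBundle.vec q) none)⁻¹ • ProjBundle.vec q := by
  have h1 : D.proj q ∈ F.dom := hq.1
  have h2 : F.co (D.proj q) (ProjBundle.vec q) none ≠ 0 := hq.2
  have hs : ∑ i, F.co (D.proj q) (ProjBundle.vec q) i • F.e i (D.proj q) = ProjBundle.vec q :=
    sum_coef (by rw [F.frame.span_eq _ h1]; exact ProjBundle.vec_mem q)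
  have h3 : (D.frameChart F p q).2 = fun j => F.co (D.proj q) (ProjBundle.vec q) (some j) /
    F.co (D.proj q) (ProjBundle.vec q) none := rfl
  rw [h3]
  set c := F.co (D.proj q) (ProjBundle.vec q) with hc
  refine Eq.trans ?_ (congrArg (fun v => (c none)⁻¹ • v) hs)
  refine Eq.trans ?_ Finset.smul_sum.symm
  rw [FrameChart.vecAt]
  refine Finset.sum_congr rfl fun i _ => ?_
  rw [smul_smul]
  congr 1
  cases i with
  | none => exact (inv_mul_cancel₀ h2).symm
  | some j => exact div_eq_inv_mul _ _

theorem line_eq_vecAt {F : FrameChart D.V (r - 1)} {p q : D.P}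
    (hq : q ∈ (D.frameChart F p).source) :
    D.line q = Submodule.span ℂ {F.vecAt (D.proj q) (D.frameChart F p q).2} := by
  rw [D.vecAt_eq hq, D.line_eq]
  exact (Submodule.span_singleton_smul_eq (IsUnit.mk0 _ (inv_ne_zero hq.2)) _).symm

theorem liftV_eq {F : FrameChart D.V (r - 1)} {p q : D.P}
    (hq : q ∈ (D.frameChart F p).source) :
    D.liftV q = (Submodule.span ℂ (range fun i =>
      (D.liftFrame F i (D.frameChart F p q) : TangentSpace 𝓘(ℂ, D.PE) (D.frameChart F p q)))).comap
      (mfderiv 𝓘(ℂ, D.PE) 𝓘(ℂ, D.PE) (D.frameChart F p) q).toLinearMap := by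
  have hx : D.proj q ∈ (chartAt D.E F.center).source := F.dom_sub hq.1
  have hinj := D.mfderiv_chart_injective F.center _ hx
  ext ξ
  rw [liftV, Submodule.mem_comap, D.line_eq_vecAt hq, Submodule.mem_span_singleton]
  have hd := D.chart_dproj hq ξ
  set a := (D.frameChart F p q).2 with ha
  set Aξ : D.PE := mfderiv 𝓘(ℂ, D.PE) 𝓘(ℂ, D.PE) (D.frameChart F p) q ξ with hA
  have hs : ∑ i, (Option.elim i 1 a : ℂ) • D.hatE F i (D.frameChart F p q).1 = _ :=
    D.sum_hatE F a hx
  have hsum : ∀ g : Option (Fin (r - 1)) → ℂ,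
      ∑ i, g i • (D.liftFrame F i (D.frameChart F p q) : D.PE) =
        (g none • (mfderiv 𝓘(ℂ, D.E) 𝓘(ℂ, D.E) (chartAt D.E F.center) (D.proj q)
          (F.vecAt (D.proj q) a) : D.E), fun j => g (some j)) := by
    intro g
    rw [D.sum_liftFrame]
    exact congrArg (fun v => (g none • v, fun j => g (some j))) hs
  refine Iff.trans ?_ (Submodule.mem_span_range_iff_exists_fun ℂ
    (v := fun i => D.liftFrame F i (D.frameChart F p q)) (x := Aξ)).symm
  constructor
  · rintro ⟨c, hc⟩
    refine ⟨fun i => Option.elim i c Aξ.2, ?_⟩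
    refine (hsum _).trans (Prod.ext ?_ rfl)
    refine Eq.trans ?_ hd
    change c • (mfderiv 𝓘(ℂ, D.E) 𝓘(ℂ, D.E) (chartAt D.E F.center) (D.proj q)
          (F.vecAt (D.proj q) a) : D.E) = _
    refine (map_smul (mfderiv 𝓘(ℂ, D.E) 𝓘(ℂ, D.E) (chartAt D.E F.center) (D.proj q)) c
      (F.vecAt (D.proj q) a)).symm.trans ?_
    rw [hc]
    rfl
  · rintro ⟨g, hg⟩
    refine ⟨g none, hinj ?_⟩
    refine (map_smul _ _ _).trans ?_
    have h1 := congrArg Prod.fst ((hsum g).symm.trans hg)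
    exact h1.trans hd.symm

theorem isHolSubbundle_liftV : IsHolSubbundle D.liftV r := by
  intro q
  obtain ⟨F, hF⟩ := D.exists_chart q
  have hr : Fintype.card (Fin r) = Fintype.card (Option (Fin (r - 1))) := by
    obtain ⟨e, U, hU, he⟩ := D.isHolSubbundle (D.proj q)
    rcases r with _ | r
    · exfalso
      have h := he.span_eq _ hU
      rw [range_eq_empty, Submodule.span_empty] at h
      have h1 : ProjBundle.vec q ∈ D.V (D.proj q) := ProjBundle.vec_mem q
      rw [← h] at h1
      exact ProjBundle.vec_ne q h1
    · simp
  have h1 : IsHolFrameOn D.liftV (fun i => VectorField.mpullback 𝓘(ℂ, D.PE) 𝓘(ℂ, D.PE)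
      (D.frameChart F q)
      (fun p => (D.liftFrame F i p : TangentSpace 𝓘(ℂ, D.PE) p))) (D.frameChart F q).source := by
    refine (D.liftFrame_frame F q).pullback (D.frameChart F q).open_source ?_
      (D.frameChart F q).mapsTo ?_ (fun x hx => D.liftV_eq hx)
    · exact contMDiffOn_of_mem_maximalAtlas
        (IsManifold.subset_maximalAtlas (D.frameChart_mem_atlas F q))
    · intro x hx
      exact ⟨(mdifferentiable_of_mem_atlas (D.frameChart_mem_atlas F q)).mfderiv hx, rfl⟩
  exact ⟨_, _, hF, h1.reindex (Fintype.equivOfCardEq hr)⟩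

/-- The 1-jet functor `(M, V) ↦ (P(V), Ṽ)`: `P(V)` is the bundle of lines in `V`, with the complex
structure given by its standard charts, and `Ṽ = {ξ | π_* ξ ∈ ℂ v}` at `(x, [v])`. -/
noncomputable def jet : DirectedManifold.{u} r where
  E := D.PE
  M := D.P
  V := D.liftV
  isHolSubbundle := D.isHolSubbundle_liftV

end DirectedManifold
/-! ### Directed structures, possibly singular -/

section Analytic

variable {E : Type*} [NormedAddCommGroup E] [NormedSpace ℂ E] {H : Type*} [TopologicalSpace H]
  (I : ModelWithCorners ℂ E H) {N : Type*} [TopologicalSpace N] [ChartedSpace H N]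

/-- `A` is a closed analytic subset of the complex manifold `N`: near every point of `N` it is the
set of common zeros of finitely many holomorphic functions. -/
def IsAnalyticSubset (A : Set N) : Prop :=
  ∀ a : N, ∃ U : Set N, IsOpen U ∧ a ∈ U ∧ ∃ (s : ℕ) (f : Fin s → N → ℂ),
    (∀ i, ContMDiffOn I 𝓘(ℂ) ω (f i) U) ∧ A ∩ U = {y ∈ U | ∀ i, f i y = 0}

/-- `A` is a closed irreducible analytic subset of `N`. -/
structure IsIrreducibleAnalytic (A : Set N) : Prop where
  isAnalytic : IsAnalyticSubset I A
  nonempty : A.Nonempty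
  irreducible : ∀ B C : Set N, IsAnalyticSubset I B → IsAnalyticSubset I C →
    A ⊆ B ∪ C → A ⊆ B ∨ A ⊆ C

end Analytic

/-- A directed structure on the complex manifold `X`: a linear subspace `V` of `T_X`, that is,
a closed irreducible analytic subset of `T_X` all of whose fibers are vector subspaces. -/
structure DirectedStructure (n : ℕ) (X : Type u) [TopologicalSpace X]
    [ChartedSpace (EuclideanSpace ℂ (Fin n)) X]
    [IsManifold 𝓘(ℂ, EuclideanSpace ℂ (Fin n)) ω X] where
  V : ∀ x : X, Submodule ℂ (TangentSpace 𝓘(ℂ, EuclideanSpace ℂ (Fin n)) x)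
  isIrreducibleAnalytic : IsIrreducibleAnalytic 𝓘(ℂ, EuclideanSpace ℂ (Fin n)).tangent
    {v : TangentBundle 𝓘(ℂ, EuclideanSpace ℂ (Fin n)) X | v.2 ∈ V v.1}

section Directed

variable {n : ℕ} {X : Type u} [TopologicalSpace X] [ChartedSpace (EuclideanSpace ℂ (Fin n)) X]
  [IsManifold 𝓘(ℂ, EuclideanSpace ℂ (Fin n)) ω X]

section Absolute

variable (n X)

/-- The absolute case `V = T_X`. -/
noncomputable def absolute : DirectedManifold.{u} n where
  E := EuclideanSpace ℂ (Fin n)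
  M := X
  V := fun _ => ⊤
  isHolSubbundle := by
    intro x
    have h1 : IsHolFrameOn (E := EuclideanSpace ℂ (Fin n)) (M := EuclideanSpace ℂ (Fin n))
        (fun _ => ⊤) (fun i _ => EuclideanSpace.basisFun (Fin n) ℂ i) univ :=
      { isOpen := isOpen_univ
        hol := fun i => contMDiffOn_vectorSpace_iff_contDiffOn.2 contDiffOn_const
        linInd := fun x _ => (EuclideanSpace.basisFun (Fin n) ℂ).toBasis.linearIndependent.comp
          id Function.injective_id
        span_eq := fun x _ => (EuclideanSpace.basisFun (Fin n) ℂ).toBasis.span_eq }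
    refine ⟨_, _, mem_chart_source (EuclideanSpace ℂ (Fin n)) x, h1.pullback
      (f := chartAt (EuclideanSpace ℂ (Fin n)) x) (chartAt (EuclideanSpace ℂ (Fin n)) x).open_source
      contMDiffOn_chart (mapsTo_univ _ _) (fun y hy => ?_) (fun y _ => ?_)⟩
    · exact ⟨(mdifferentiable_chart x).mfderiv hy, rfl⟩
    · exact (Submodule.comap_top _).symm

end Absolute

namespace DirectedStructure

variable (V : DirectedStructure n X)

/-- The (generic, i.e. minimal) rank of `V`. -/
noncomputable def rank : ℕ := sInf (range fun x => Module.finrank ℂ (V.V x))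

/-- The open set `X'` of all points near which `V` is a subbundle of `T_X`. -/
def regular : TopologicalSpace.Opens X where
  carrier := {x | ∃ (e : Fin V.rank → ∀ x : X, TangentSpace 𝓘(ℂ, EuclideanSpace ℂ (Fin n)) x)
    (U : Set X), x ∈ U ∧ IsHolFrameOn V.V e U}
  is_open' := by
    rw [isOpen_iff_mem_nhds]
    rintro x ⟨e, U, hx, he⟩
    exact Filter.mem_of_superset (he.isOpen.mem_nhds hx) fun y hy => ⟨e, U, hy, he⟩

/-- The nonsingular directed manifold `(X', V')`, where `V'` is the restriction of `V` to `X'`. -/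
noncomputable def regularPart : DirectedManifold.{u} V.rank where
  E := EuclideanSpace ℂ (Fin n)
  M := V.regular
  V := fun x => (V.V x.1).comap (mfderiv 𝓘(ℂ, EuclideanSpace ℂ (Fin n))
    𝓘(ℂ, EuclideanSpace ℂ (Fin n)) (Subtype.val : V.regular → X) x).toLinearMap
  isHolSubbundle := by
    rintro ⟨x, e, U, hx, he⟩
    refine ⟨_, Subtype.val ⁻¹' U, hx, he.pullback (f := (Subtype.val : V.regular → X))
      (he.isOpen.preimage continuous_subtype_val) contMDiff_subtype_val.contMDiffOn
      (fun y hy => hy) (fun y hy => ?_) (fun y _ => rfl)⟩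
    have : Nonempty V.regular := ⟨y⟩
    let f := V.regular.openPartialHomeomorphSubtypeCoe this
    have hf : f.MDifferentiable 𝓘(ℂ, EuclideanSpace ℂ (Fin n))
        𝓘(ℂ, EuclideanSpace ℂ (Fin n)) := by
      refine ⟨(contMDiff_subtype_val (n := 1)).contMDiffOn.mdifferentiableOn (by simp), ?_⟩
      rintro z hz
      have hz' : z ∈ V.regular := by simpa [f] using hz
      refine MDifferentiableAt.mdifferentiableWithinAt ?_
      have h2 : ContMDiffAt 𝓘(ℂ, EuclideanSpace ℂ (Fin n)) 𝓘(ℂ, EuclideanSpace ℂ (Fin n)) 1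
          (fun y : V.regular => f.symm y) ⟨z, hz'⟩ := by
        refine contMDiffAt_id.congr_of_eventuallyEq (Filter.Eventually.of_forall fun y => ?_)
        exact f.left_inv (x := y) (by simp [f])
      exact (contMDiffAt_subtype_iff.1 h2).mdifferentiableAt (by simp)
    exact ⟨hf.mfderiv (by simp [f]), rfl⟩

end DirectedStructure

end Directed

/-! ### The Semple tower and its tautological line bundles -/

namespace DirectedManifold

variable {r : ℕ} (D : DirectedManifold.{u} r)

/-- The Semple tower `(X_k, V_k)`: the iterates of the 1-jet functor. -/
noncomputable def tower : ℕ → DirectedManifold.{u} r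
  | 0 => D
  | k + 1 => (tower k).jet

/-- The projection `π_{k,0} : X_k → X_0`. -/
noncomputable def toBase : ∀ k, (D.tower k).M → D.M
  | 0, w => w
  | k + 1, w => toBase k ((D.tower k).proj w)

/-- The fiber over `w` of the bundle of tuples `(v_1, …, v_k)` of nonzero vectors
`v_j ∈ O_{X_j}(-1)_{π_{k,j}(w)}`, where the fiber of `O_{X_j}(-1)` at `(x, [v])` is the line
`ℂ v ⊆ V_{j-1,x}`. -/
def Cone : ∀ k, (D.tower k).M → Type
  | 0, _ => PUnit
  | k + 1, w => Cone k ((D.tower k).proj w) ×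
      {v : TangentSpace 𝓘(ℂ, (D.tower k).E) ((D.tower k).proj w) //
        v ∈ (D.tower k).line w ∧ v ≠ 0}

/-- `f` is homogeneous of degree `m` in each of the variables `v_1, …, v_k`. -/
def IsHomogeneous {A : Type} [AddCommGroup A] [Module ℂ A] (m : ℤ) :
    ∀ (k : ℕ) (w : (D.tower k).M), (D.Cone k w → A) → Prop
  | 0, _, _ => True
  | k + 1, w, f =>
    (∀ v, IsHomogeneous m k ((D.tower k).proj w) (fun c => f (c, v))) ∧
    ∀ c v v' (t : ℂ), v'.1 = t • v.1 → f (c, v') = t ^ m • f (c, v)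

/-- The fiber at `x` of `Λ^p V^*`. -/
abbrev Form (p : ℕ) (x : D.M) : Type := (D.V x) [⋀^Fin p]→ₗ[ℂ] ℂ

theorem isHomogeneous_zero {A : Type} [AddCommGroup A] [Module ℂ A] (m : ℤ) :
    ∀ (k : ℕ) (w : (D.tower k).M), D.IsHomogeneous m k w (0 : D.Cone k w → A)
  | 0, _ => trivial
  | k + 1, w => ⟨fun _ => isHomogeneous_zero m k _, fun _ _ _ _ _ => (smul_zero _).symm⟩

theorem isHomogeneous_add {A : Type} [AddCommGroup A] [Module ℂ A] (m : ℤ) :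
    ∀ (k : ℕ) (w : (D.tower k).M) (f g : D.Cone k w → A), D.IsHomogeneous m k w f →
      D.IsHomogeneous m k w g → D.IsHomogeneous m k w (f + g)
  | 0, _, _, _, _, _ => trivial
  | k + 1, w, f, g, hf, hg =>
    ⟨fun v => isHomogeneous_add m k _ _ _ (hf.1 v) (hg.1 v), fun c v v' t h => by
      change f (c, v') + g (c, v') = t ^ m • (f (c, v) + g (c, v))
      rw [hf.2 c v v' t h, hg.2 c v v' t h, smul_add]⟩

theorem isHomogeneous_smul {A : Type} [AddCommGroup A] [Module ℂ A] (m : ℤ) (a : ℂ) :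
    ∀ (k : ℕ) (w : (D.tower k).M) (f : D.Cone k w → A), D.IsHomogeneous m k w f →
      D.IsHomogeneous m k w (a • f)
  | 0, _, _, _ => trivial
  | k + 1, w, f, hf =>
    ⟨fun v => isHomogeneous_smul m a k _ _ (hf.1 v), fun c v v' t h => by
      change a • f (c, v') = t ^ m • (a • f (c, v))
      rw [hf.2 c v v' t h, smul_comm]⟩

/-- The fiber at `w ∈ X_k` of `π_{k,0}^* Λ^p V^* ⊗ O_{X_k}(m·1)`, where
`O_{X_k}(m·1) = π_{k,1}^* O_{X_1}(m) ⊗ ⋯ ⊗ O_{X_k}(m)`. As usual, the elements of the `m`-th power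
of the dual of a line are the functions on its nonzero vectors that are homogeneous of degree
`m`. -/
def twisted (p : ℕ) (m : ℤ) (k : ℕ) (w : (D.tower k).M) :
    Submodule ℂ (D.Cone k w → D.Form p (D.toBase k w)) where
  carrier := {f | D.IsHomogeneous m k w f}
  add_mem' hf hg := D.isHomogeneous_add m k w _ _ hf hg
  zero_mem' := D.isHomogeneous_zero m k w
  smul_mem' a f hf := D.isHomogeneous_smul m a k w f hf

/-- Evaluation of an element of the fiber of `π_{k+1,0}^* Λ^p V^* ⊗ O_{X_{k+1}}(m·1)` in the last
variable `v_{k+1}`. -/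
def evalLast {p : ℕ} {m : ℤ} {k : ℕ} {w : (D.tower (k + 1)).M} (σ : D.twisted p m (k + 1) w)
    (v : {v : TangentSpace 𝓘(ℂ, (D.tower k).E) ((D.tower k).proj w) //
      v ∈ (D.tower k).line w ∧ v ≠ 0}) :
    D.twisted p m k ((D.tower k).proj w) :=
  ⟨fun c => σ.1 (c, v), σ.2.1 v⟩

/-! ### Holomorphic sections -/

/-- The family `β` of forms is a holomorphic section of `Λ^p V^*` on `U`: its values on local
holomorphic sections of `V` are holomorphic. -/
def IsHolForm {p : ℕ} (β : ∀ x : D.M, D.Form p x) (U : Set D.M) : Prop :=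
  ∀ (U' : Set D.M) (ξ : Fin p → ∀ x : D.M, D.V x), IsOpen U' → U' ⊆ U →
    (∀ i, IsHolField (fun x => (ξ i x : TangentSpace 𝓘(ℂ, D.E) x)) U') →
    ContMDiffOn 𝓘(ℂ, D.E) 𝓘(ℂ) ω (fun x => β x (fun i => ξ i x)) U'

/-- The vectors `v_1(y), …, v_k(y)` of `c y` depend holomorphically on `y ∈ U`, where `c y` lies
over the point `g y` of `X_k`. -/
def IsHolCone {F : Type} [NormedAddCommGroup F] [NormedSpace ℂ F] {N : Type u}
    [TopologicalSpace N] [ChartedSpace F N] :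
    ∀ (k : ℕ) (g : N → (D.tower k).M) (_ : ∀ y, D.Cone k (g y)) (_ : Set N), Prop
  | 0, _, _, _ => True
  | k + 1, g, c, U =>
    IsHolCone (F := F) k (fun y => (D.tower k).proj (g y)) (fun y => (c y).1) U ∧
    ContMDiffOn 𝓘(ℂ, F) 𝓘(ℂ, (D.tower k).E).tangent ω
      (fun y => (⟨(D.tower k).proj (g y), (c y).2.1⟩ :
        TangentBundle 𝓘(ℂ, (D.tower k).E) (D.tower k).M)) U

/-- The family `σ` is a holomorphic section of `π_{k,0}^* Λ^p V^* ⊗ O_{X_k}(m·1)` on `U`: its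
values on local nonvanishing holomorphic sections `v_j` of the line bundles
`π_{k,j}^* O_{X_j}(-1)` and local holomorphic sections `ξ_i` of `π_{k,0}^* V` are holomorphic. -/
def IsHolTwisted {p : ℕ} {m : ℤ} {k : ℕ} (σ : ∀ w : (D.tower k).M, D.twisted p m k w)
    (U : Set (D.tower k).M) : Prop :=
  ∀ (U' : Set (D.tower k).M) (c : ∀ w : (D.tower k).M, D.Cone k w)
    (ξ : Fin p → ∀ w : (D.tower k).M, D.V (D.toBase k w)), IsOpen U' → U' ⊆ U →
    D.IsHolCone (F := (D.tower k).E) k (fun w => w) c U' →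
    (∀ i, ContMDiffOn 𝓘(ℂ, (D.tower k).E) 𝓘(ℂ, D.E).tangent ω
      (fun w => (⟨D.toBase k w, (ξ i w : TangentSpace 𝓘(ℂ, D.E) (D.toBase k w))⟩ :
        TangentBundle 𝓘(ℂ, D.E) D.M)) U') →
    ContMDiffOn 𝓘(ℂ, (D.tower k).E) 𝓘(ℂ) ω (fun w => (σ w).1 (c w) (fun i => ξ i w)) U'

/-! ### The tautological morphisms -/

theorem line_le (q : D.P) : D.line q ≤ D.V (D.proj q) :=
  Submodule.map_subtype_le _ _

open Classical in
/-- The curve `t ↦ (x, [v + t u])` in the fiber of `P(V)` over `x = π(q)`, for `t` near `0`. -/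
noncomputable def eulerCurve (q : D.P) (v u : D.V (D.proj q)) (t : ℂ) : D.P :=
  if h : ((v + t • u : D.V (D.proj q)) : TangentSpace 𝓘(ℂ, D.E) (D.proj q)) ≠ 0 then
    ProjBundle.mkVec (D.proj q) (v + t • u : D.V (D.proj q)) (v + t • u : D.V (D.proj q)).2 h
  else q

/-- The Euler morphism: for `q = (x, [v])`, the image in `T_{P(V)/M,q}` of the element
`u ⊗ v^*` of the fiber of `π^* V ⊗ O_{P(V)}(1)` at `q`, i.e. the velocity at `t = 0` of
`t ↦ (x, [v + t u])`. (The curve is at `q` for `t = 0`.) -/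
noncomputable def eulerVec (q : D.P) (v u : D.V (D.proj q)) : TangentSpace 𝓘(ℂ, D.PE) q :=
  (mfderiv 𝓘(ℂ) 𝓘(ℂ, D.PE) (D.eulerCurve q v u) (0 : ℂ) : ℂ →L[ℂ] D.PE) (1 : ℂ)

/-- `γ ∈ Λ^m Ṽ^*` restricts on `T_{P(V)/M}` to the contraction of
`α ⊗ v^{m+1} ∈ Λ^{m+1} (π^* V ⊗ O(1))^*` with the Euler vector field `v ⊗ v^*`. -/
def IsEulerContraction {m : ℕ} (q : D.P) (v : D.V (D.proj q)) (α : D.Form (m + 1) (D.proj q))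
    (γ : D.jet.Form m q) : Prop :=
  ∀ (u : Fin m → D.V (D.proj q)) (η : Fin m → D.liftV q),
    (∀ i, (η i : TangentSpace 𝓘(ℂ, D.PE) q) = D.eulerVec q v (u i)) →
    γ η = α (Fin.cons v u)

/-- `lam` is the image of `v^* ∈ O_{P(V)}(1)` under the dual `O_{P(V)}(1) → Ṽ^*` of
`dπ : Ṽ → O_{P(V)}(-1)`. -/
def IsDualVec (q : D.P) (v : D.V (D.proj q)) (lam : D.liftV q →ₗ[ℂ] ℂ) : Prop :=
  ∀ ξ : D.liftV q, D.dproj q ξ = lam ξ • (v : TangentSpace 𝓘(ℂ, D.E) (D.proj q))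

/-- `β = lam ∧ γ`. -/
def IsWedge {m : ℕ} (q : D.P) (lam : D.liftV q →ₗ[ℂ] ℂ) (γ : D.jet.Form m q)
    (β : D.jet.Form (m + 1) q) : Prop :=
  ∀ ξ : Fin (m + 1) → D.liftV q,
    β ξ = ∑ i : Fin (m + 1), (-1 : ℂ) ^ (i : ℕ) * lam (ξ i) * γ (fun j => ξ (i.succAbove j))

/-- `β ∈ Λ^{m+1} Ṽ^*` is the image of `α ⊗ v^m` under the composite
`π^* Λ^{m+1} V^* ⊗ O(-m) → Λ^m T^*_{P(V)/M} ⊗ O(1) → Λ^{m+1} Ṽ^*` of the contraction by the Euler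
vector field of the Euler sequence `0 → O → π^* V ⊗ O(1) → T_{P(V)/M} → 0` and the wedge
multiplication coming from `0 → T_{P(V)/M} → Ṽ → O(-1) → 0`. -/
def IsTautStep {m : ℕ} (q : D.P) (v : D.V (D.proj q)) (α : D.Form (m + 1) (D.proj q))
    (β : D.jet.Form (m + 1) q) : Prop :=
  ∃ (γ : D.jet.Form m q) (lam : D.liftV q →ₗ[ℂ] ℂ),
    D.IsEulerContraction q v α γ ∧ D.IsDualVec q v lam ∧ D.IsWedge q lam γ β

/-- Families of fiberwise linear maps
`π_{k,0}^* Λ^{m+1} V^* ⊗ O_{X_k}(-m·1) → Λ^{m+1} V_k^*`, `k = 0, 1, 2, …`. -/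
abbrev FiberMaps (m : ℕ) : Type u :=
  ∀ (k : ℕ) (w : (D.tower k).M), D.twisted (m + 1) (-m) k w →ₗ[ℂ] (D.tower k).Form (m + 1) w

/-- `Φ k` is obtained by iterating the one-stage tautological morphisms
`π_j^* Λ^{m+1} V_{j-1}^* ⊗ O_{X_j}(-m) → Λ^{m+1} V_j^*`, `1 ≤ j ≤ k`. -/
structure IsTautological {m : ℕ} (Φ : D.FiberMaps m) : Prop where
  zero : ∀ (w : D.M) (σ : D.twisted (m + 1) (-m) 0 w), Φ 0 w σ = σ.1 PUnit.unit
  succ : ∀ (k : ℕ) (w : (D.tower (k + 1)).M) (σ : D.twisted (m + 1) (-m) (k + 1) w)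
    (v : {v : TangentSpace 𝓘(ℂ, (D.tower k).E) ((D.tower k).proj w) //
      v ∈ (D.tower k).line w ∧ v ≠ 0}),
    (D.tower k).IsTautStep w ⟨v.1, (D.tower k).line_le w v.2.1⟩
      (Φ k ((D.tower k).proj w) (D.evalLast σ v)) (Φ (k + 1) w σ)

/-- `Φ k` is a holomorphic bundle morphism for all `k`: it maps holomorphic sections over open
sets to holomorphic sections. -/
def IsHolMorphism {m : ℕ} (Φ : D.FiberMaps m) : Prop :=
  ∀ (k : ℕ) (U : Set (D.tower k).M) (σ : ∀ w, D.twisted (m + 1) (-m) k w), IsOpen U →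
    D.IsHolTwisted σ U → (D.tower k).IsHolForm (fun w => Φ k w (σ w)) U

end DirectedManifold

/-! ### The singular case: closure in the absolute tower -/

/-- The `k`-th stage `(X^a_k, V^a_k)` of the absolute Semple tower of `X`. -/
noncomputable abbrev absTower (n : ℕ) (X : Type u) [TopologicalSpace X]
    [ChartedSpace (EuclideanSpace ℂ (Fin n)) X]
    [IsManifold 𝓘(ℂ, EuclideanSpace ℂ (Fin n)) ω X] (k : ℕ) : DirectedManifold.{u} n :=
  (absolute n X).tower k

namespace DirectedStructure

variable {n : ℕ} {X : Type u} [TopologicalSpace X] [ChartedSpace (EuclideanSpace ℂ (Fin n)) X]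
  [IsManifold 𝓘(ℂ, EuclideanSpace ℂ (Fin n)) ω X] (V : DirectedStructure n X)

/-- The `k`-th stage `(X'_k, V'_k)` of the Semple tower of the regular part of `(X, V)`. -/
noncomputable abbrev reg (k : ℕ) : DirectedManifold.{u} V.rank := V.regularPart.tower k

/-- The differential of `ι k`, as a map of total spaces of tangent bundles. -/
noncomputable abbrev tmap (ι : ∀ k, (V.reg k).M → (absTower n X k).M) (k : ℕ) :
    TangentBundle 𝓘(ℂ, (V.reg k).E) (V.reg k).M → TangentBundle 𝓘(ℂ, (absTower n X k).E) (absTower n X k).M :=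
  tangentMap 𝓘(ℂ, (V.reg k).E) 𝓘(ℂ, (absTower n X k).E) (ι k)

/-- `ι k : (X'_k, V'_k) → (X^a_k, V^a_k)` are the injections obtained by functoriality from the
inclusion `X' ⊆ X`. -/
structure IsInclusion (ι : ∀ k, (V.reg k).M → (absTower n X k).M) : Prop where
  zero : ∀ w : V.regular, ι 0 w = w.1
  succ : ∀ (k : ℕ) (q : (V.reg k).P) (v : TangentSpace 𝓘(ℂ, (V.reg k).E) ((V.reg k).proj q)),
    v ∈ (V.reg k).line q → v ≠ 0 →
    ∃ h h0, ι (k + 1) q = ProjBundle.mkVec (ι k ((V.reg k).proj q))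
      (mfderiv 𝓘(ℂ, (V.reg k).E) 𝓘(ℂ, (absTower n X k).E) (ι k) ((V.reg k).proj q) v) h h0
  contMDiff : ∀ k, ContMDiff 𝓘(ℂ, (V.reg k).E) 𝓘(ℂ, (absTower n X k).E) ω (ι k)
  injective : ∀ k, Function.Injective (ι k)
  injective_mfderiv : ∀ k w, Function.Injective
    (mfderiv 𝓘(ℂ, (V.reg k).E) 𝓘(ℂ, (absTower n X k).E) (ι k) w)
  mapsTo : ∀ k w, ∀ ξ ∈ (V.reg k).V w,
    mfderiv 𝓘(ℂ, (V.reg k).E) 𝓘(ℂ, (absTower n X k).E) (ι k) w ξ ∈ (absTower n X k).V (ι k w)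

/-- `c'` is the image of `c` under the differentials of the `ι j`. -/
def ConeRel (ι : ∀ k, (V.reg k).M → (absTower n X k).M) :
    ∀ (k : ℕ) (w : (V.reg k).M) (_ : V.regularPart.Cone k w) (z : (absTower n X k).M)
      (_ : (absolute n X).Cone k z), Prop
  | 0, _, _, _, _ => True
  | k + 1, w, c, z, c' => ConeRel ι k ((V.reg k).proj w) c.1 ((absTower n X k).proj z) c'.1 ∧
      V.tmap ι k ⟨(V.reg k).proj w, c.2.1⟩ = ⟨(absTower n X k).proj z, c'.2.1⟩

/-- `σ'` is the restriction to `V'` at `w ∈ X'_k` of the element `σ` of the fiber of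
`π_{k,0}^* Λ^p T_X^* ⊗ O_{X^a_k}(m·1)` at `ι k w`. -/
def IsRestrTwisted (ι : ∀ k, (V.reg k).M → (absTower n X k).M) {p : ℕ} {m : ℤ} {k : ℕ}
    {w : (V.reg k).M} (σ : (absolute n X).twisted p m k (ι k w))
    (σ' : V.regularPart.twisted p m k w) : Prop :=
  ∀ c c', V.ConeRel ι k w c (ι k w) c' →
    ∀ (ξ : Fin p → V.regularPart.V (V.regularPart.toBase k w))
      (ζ : Fin p → (absolute n X).V ((absolute n X).toBase k (ι k w))),
      (∀ i, V.tmap ι 0 ⟨V.regularPart.toBase k w, (ξ i).1⟩ =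
        ⟨(absolute n X).toBase k (ι k w), (ζ i).1⟩) →
      σ'.1 c ξ = σ.1 c' ζ

/-- `β'` is the restriction to `V'_k` at `w ∈ X'_k` of the form `β` on `V^a_k` at `ι k w`. -/
def IsRestrForm (ι : ∀ k, (V.reg k).M → (absTower n X k).M) {p : ℕ} {k : ℕ}
    {w : (V.reg k).M} (β : (absTower n X k).Form p (ι k w)) (β' : (V.reg k).Form p w) : Prop :=
  ∀ (ξ : Fin p → (V.reg k).V w) (ζ : Fin p → (absTower n X k).V (ι k w)),
    (∀ i, (ζ i).1 = mfderiv 𝓘(ℂ, (V.reg k).E) 𝓘(ℂ, (absTower n X k).E) (ι k) w (ξ i).1) →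
    β' ξ = β ζ

/-- The space `X_k`: the closure of `X'_k` in `X^a_k`. -/
def closedStage (ι : ∀ k, (V.reg k).M → (absTower n X k).M) (k : ℕ) : Set (absTower n X k).M :=
  closure (range (ι k))

/-- The closure in the `p`-fold power of the total space of `T_{X^a_k}` of the set of all `p`-tuples
of vectors of `V'_k` with a common base point. For `p = 1` this is `V_k`, the closure of `V'_k`. -/
def closedV (ι : ∀ k, (V.reg k).M → (absTower n X k).M) (p k : ℕ) :
    Set (Fin p → TangentBundle 𝓘(ℂ, (absTower n X k).E) (absTower n X k).M) :=
  closure {Z | ∃ (w : (V.reg k).M) (ξ : Fin p → (V.reg k).V w),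
    ∀ i, Z i = V.tmap ι k ⟨w, (ξ i).1⟩}

/-- `σ'` is a section over `U ∩ X_k` of the sheaf `π_{k,0}^* Λ^p V^* ⊗ O_{X_k}(m·1)` on `X_k`:
a section over `U ∩ X'_k` that locally near every point of `U ∩ X_k` is the restriction
of a holomorphic section of `π_{k,0}^* Λ^p T_X^* ⊗ O_{X^a_k}(m·1)`. -/
def IsTwistedSection (ι : ∀ k, (V.reg k).M → (absTower n X k).M) {p : ℕ} {m : ℤ} {k : ℕ}
    (σ' : ∀ w : (V.reg k).M, V.regularPart.twisted p m k w) (U : Set (absTower n X k).M) : Prop :=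
  ∀ z ∈ U ∩ V.closedStage ι k, ∃ (O : Set (absTower n X k).M)
    (σ : ∀ y : (absTower n X k).M, (absolute n X).twisted p m k y),
    IsOpen O ∧ z ∈ O ∧ (absolute n X).IsHolTwisted σ O ∧
      ∀ w, ι k w ∈ O → V.IsRestrTwisted ι (σ (ι k w)) (σ' w)

/-- `β'` is a section over `U ∩ X_k` of the sheaf `Λ^p V_k^*` on `X_k`: a section over `U ∩ X'_k`
of `Λ^p V'_k^*` that locally near every point of `U ∩ X_k` is the restriction of a holomorphic
section of `Λ^p (V^a_k)^*`. -/
def IsFormSection (ι : ∀ k, (V.reg k).M → (absTower n X k).M) {p : ℕ} {k : ℕ}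
    (β' : ∀ w : (V.reg k).M, (V.reg k).Form p w) (U : Set (absTower n X k).M) : Prop :=
  ∀ z ∈ U ∩ V.closedStage ι k, ∃ (O : Set (absTower n X k).M)
    (β : ∀ y : (absTower n X k).M, (absTower n X k).Form p y),
    IsOpen O ∧ z ∈ O ∧ (absTower n X k).IsHolForm β O ∧
      ∀ w, ι k w ∈ O → V.IsRestrForm ι (β (ι k w)) (β' w)

end DirectedStructure

end Semple

/-!
The one-stage morphism `Λ^p V^* ⊗ O(-(p-1)) → Λ^p Ṽ^*` on `P(V)` is determined pointwise by its
defining property. In a standard chart, with frame `e₀, …, e_{r-1}` of `V` and fiber coordinates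
`aⱼ`, the line is spanned by `v = e₀ + ∑ aⱼ eⱼ`, the Euler morphism at this `v` maps `u` to
`∑ (uⱼ - aⱼ u₀) ∂/∂aⱼ` (`mfderiv_frameChart_eulerVec`), and the image of `α` is `lam ∧ α(v, θ ·, …)`
with `lam` the `e₀`-coordinate of `dπ` and `θ` the map `∂/∂aⱼ ↦ eⱼ` (`isTautStep_frame`). It is
unique since the Euler morphism is onto the vertical vectors, which form the kernel of `lam`, and a
product `lam ∧ γ` only sees `γ` on that kernel (`wedge_eq_of_eqOn_ker`). Rescaling `v` is absorbed
by the twist (`IsTautStep.smul`), so the morphisms can be iterated along the tower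
(`tautMap`, `IsTautological.unique`).

Holomorphy is an induction on the stage (`IsTautological.contMDiffAt`). The local formula has
holomorphic coefficients, but evaluating a section over `X_{k+1}` on its last line variable gives a
section along the projection to `X_k`, not one over `X_k`; the induction therefore runs over
families along arbitrary holomorphic maps `N → X_k`.

An injective immersion `f` with `df(V) ⊆ V'` induces such an immersion `P(V) → P(V')`
(`DirectedImmersion.jet`): its differential carries Euler vectors to Euler vectors, and on the
quotient by the vertical vectors it is `df`. By this naturality and the uniqueness of the one-stage
morphism, restriction of forms commutes with the tautological morphisms
(`DirectedImmersion.tautological_restrict`). This gives the comparison with the absolute tower, and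
with the holomorphy of the absolute morphisms the statement on sections of the two sheaves. For the
vanishing on the closure, a holomorphic form is, in a local frame, a continuous function of the
tuples of tangent vectors (`IsHolForm.eq_zero_of_mem_closure`).
-/

namespace Semple

/-! ### Holomorphic vector fields along maps -/

section Along

variable {E : Type} [NormedAddCommGroup E] [NormedSpace ℂ E]
  {M : Type*} [TopologicalSpace M] [ChartedSpace E M] [IsManifold 𝓘(ℂ, E) ω M]
  {E' : Type} [NormedAddCommGroup E'] [NormedSpace ℂ E']
  {M' : Type*} [TopologicalSpace M'] [ChartedSpace E' M'] [IsManifold 𝓘(ℂ, E') ω M']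
  {F : Type*} [NormedAddCommGroup F] [NormedSpace ℂ F]
  {N : Type*} [TopologicalSpace N] [ChartedSpace F N]

/-- `s` is a vector field along `g : N → M` that is holomorphic at `y₀`, as a map from `N` to the
total space of the tangent bundle of `M`. -/
def HolAlongAt (F : Type*) [NormedAddCommGroup F] [NormedSpace ℂ F] {N : Type*} [TopologicalSpace N]
    [ChartedSpace F N] (g : N → M) (s : ∀ y, TangentSpace 𝓘(ℂ, E) (g y)) (y₀ : N) : Prop :=
  ContMDiffAt 𝓘(ℂ, F) 𝓘(ℂ, E).tangent ω
    (fun y => (⟨g y, s y⟩ : TangentBundle 𝓘(ℂ, E) M)) y₀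

theorem holAlongAt_iff {g : N → M} {s : ∀ y, TangentSpace 𝓘(ℂ, E) (g y)} {y₀ : N} :
    HolAlongAt F g s y₀ ↔ ContMDiffAt 𝓘(ℂ, F) 𝓘(ℂ, E) ω g y₀ ∧
      ContMDiffAt 𝓘(ℂ, F) 𝓘(ℂ, E) ω (fun y => (trivializationAt E
        (TangentSpace 𝓘(ℂ, E) : M → Type _) (g y₀) ⟨g y, s y⟩).2) y₀ :=
  Bundle.contMDiffAt_totalSpace

theorem HolAlongAt.base {g : N → M} {s : ∀ y, TangentSpace 𝓘(ℂ, E) (g y)} {y₀ : N}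
    (h : HolAlongAt F g s y₀) : ContMDiffAt 𝓘(ℂ, F) 𝓘(ℂ, E) ω g y₀ :=
  (holAlongAt_iff.1 h).1

theorem HolAlongAt.congr {g : N → M} {s s' : ∀ y, TangentSpace 𝓘(ℂ, E) (g y)} {y₀ : N}
    (h : HolAlongAt F g s y₀) (hs : ∀ᶠ y in 𝓝 y₀, s' y = s y) : HolAlongAt F g s' y₀ :=
  ContMDiffAt.congr_of_eventuallyEq h (hs.mono fun y hy => by simp only [hy])

theorem HolAlongAt.sum_smul {ι : Type*} [Fintype ι] {g : N → M}
    {s : ι → ∀ y, TangentSpace 𝓘(ℂ, E) (g y)} {a : ι → N → ℂ} {y₀ : N}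
    (hg : ContMDiffAt 𝓘(ℂ, F) 𝓘(ℂ, E) ω g y₀) (hs : ∀ i, HolAlongAt F g (s i) y₀)
    (ha : ∀ i, ContMDiffAt 𝓘(ℂ, F) 𝓘(ℂ) ω (a i) y₀) :
    HolAlongAt F g (fun y => ∑ i, a i y • s i y) y₀ := by
  refine holAlongAt_iff.2 ⟨hg, ?_⟩
  set T := trivializationAt E (TangentSpace 𝓘(ℂ, E) : M → Type _) (g y₀) with hT
  have h1 : ContMDiffAt 𝓘(ℂ, F) 𝓘(ℂ, E) ω
      (fun y => ∑ i, a i y • (T ⟨g y, s i y⟩).2) y₀ :=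
    contMDiffAt_finsetSum (t := Finset.univ) fun i _ => (ha i).smul (holAlongAt_iff.1 (hs i)).2
  refine h1.congr_of_eventuallyEq ?_
  have hb : T.baseSet ∈ 𝓝 (g y₀) :=
    T.open_baseSet.mem_nhds (FiberBundle.mem_baseSet_trivializationAt' (g y₀))
  filter_upwards [hg.continuousAt.eventually_mem hb] with y hy
  have h2 : ∀ v : TangentSpace 𝓘(ℂ, E) (g y), (T ⟨g y, v⟩).2 = T.linearMapAt ℂ (g y) v :=
    fun v => by rw [T.coe_linearMapAt_of_mem hy]
  simp only [h2, map_sum, map_smul]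

theorem IsHolField.holAlongAt {e : ∀ x : M, TangentSpace 𝓘(ℂ, E) x} {U : Set M} {g : N → M}
    {y₀ : N} (he : IsHolField e U) (hU : U ∈ 𝓝 (g y₀))
    (hg : ContMDiffAt 𝓘(ℂ, F) 𝓘(ℂ, E) ω g y₀) : HolAlongAt F g (fun y => e (g y)) y₀ :=
  ContMDiffAt.comp (I' := 𝓘(ℂ, E)) y₀ (he.contMDiffAt hU) hg

theorem HolAlongAt.mfderiv {g : N → M} {s : ∀ y, TangentSpace 𝓘(ℂ, E) (g y)} {y₀ : N}
    (h : HolAlongAt F g s y₀) {f : M → M'} {U : Set M} (hf : ContMDiffOn 𝓘(ℂ, E) 𝓘(ℂ, E') ω f U)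
    (hU : IsOpen U) (hy₀ : g y₀ ∈ U) :
    HolAlongAt F (fun y => f (g y)) (fun y => mfderiv 𝓘(ℂ, E) 𝓘(ℂ, E') f (g y) (s y)) y₀ := by
  have h1 := hf.contMDiffOn_tangentMapWithin (m := ω) (by simp) hU.uniqueMDiffOn
  have h2 : ContMDiffAt 𝓘(ℂ, E).tangent 𝓘(ℂ, E').tangent ω (tangentMapWithin 𝓘(ℂ, E) 𝓘(ℂ, E') f U)
      (⟨g y₀, s y₀⟩ : TangentBundle 𝓘(ℂ, E) M) := by
    refine h1.contMDiffAt (IsOpen.mem_nhds (hU.preimage ?_) hy₀)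
    exact FiberBundle.continuous_proj E _
  refine (ContMDiffAt.comp (I' := 𝓘(ℂ, E).tangent) y₀ h2 h).congr_of_eventuallyEq ?_
  filter_upwards [h.base.continuousAt.eventually_mem (hU.mem_nhds hy₀)] with y hy
  exact (tangentMapWithin_eq_tangentMap (p := (⟨g y, s y⟩ : TangentBundle 𝓘(ℂ, E) M))
    (hU.uniqueMDiffOn _ hy) ((hf.contMDiffAt (hU.mem_nhds hy)).mdifferentiableAt (by simp))).symm

theorem HolAlongAt.vectorSpace {g : N → E} {s : ∀ y, TangentSpace 𝓘(ℂ, E) (g y)} {y₀ : N}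
    (h : HolAlongAt F g s y₀) : ContMDiffAt 𝓘(ℂ, F) 𝓘(ℂ, E) ω (fun y => (s y : E)) y₀ :=
  ContMDiffAt.comp y₀ (I' := 𝓘(ℂ, E).tangent)
    (f := fun y => (⟨g y, s y⟩ : TangentBundle 𝓘(ℂ, E) E)) (g := fun p => p.2)
    ((contMDiff_snd_tangentBundle_modelSpace E 𝓘(ℂ, E) (n := ω)).contMDiffAt
      (x := (⟨g y₀, s y₀⟩ : TangentBundle 𝓘(ℂ, E) E))) h

/-- The coordinates of the vectors of `V` in a local frame are the values of a holomorphic family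
of linear maps, defined on all tangent vectors. -/
theorem IsHolFrameOn.exists_coef_eq [FiniteDimensional ℂ E] {ι : Type*} [Fintype ι]
    {V : ∀ x : M, Submodule ℂ (TangentSpace 𝓘(ℂ, E) x)}
    {e : ι → ∀ x : M, TangentSpace 𝓘(ℂ, E) x} {U : Set M} (he : IsHolFrameOn V e U)
    {x₀ : M} (hx : x₀ ∈ U) :
    ∃ A : M → (E →L[ℂ] (ι → ℂ)), ContMDiffAt 𝓘(ℂ, E) 𝓘(ℂ, E →L[ℂ] (ι → ℂ)) ω A x₀ ∧
      ∀ᶠ x in 𝓝 x₀, ∀ v ∈ V x, coef (fun i => e i x) v =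
        A x (trivializationAt E (TangentSpace 𝓘(ℂ, E) : M → Type _) x₀ ⟨x, v⟩).2 := by
  classical
  have : CompleteSpace E := FiniteDimensional.complete ℂ E
  set T := trivializationAt E (TangentSpace 𝓘(ℂ, E) : M → Type _) x₀ with hT
  have hem : ∀ j, ContMDiffAt 𝓘(ℂ, E) 𝓘(ℂ, E) ω (fun x => (T ⟨x, e j x⟩).2) x₀ := fun j =>
    (Bundle.contMDiffAt_section x₀).1
      ((he.hol j x₀ hx).contMDiffAt (he.isOpen.mem_nhds hx))
  -- `A x` sends coordinates to vectors. With a left inverse `L` of `A x₀`, the operator `L ∘ A x`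
  -- is invertible near `x₀`, so `(L ∘ A x)⁻¹ ∘ L` is a left inverse of `A x`, holomorphic in `x`.
  let A : M → ((ι → ℂ) →L[ℂ] E) := fun x =>
    ∑ j, (ContinuousLinearMap.proj (R := ℂ) (φ := fun _ : ι => ℂ) j).smulRight ((T ⟨x, e j x⟩).2)
  have hA : ContMDiffAt 𝓘(ℂ, E) 𝓘(ℂ, (ι → ℂ) →L[ℂ] E) ω A x₀ :=
    contMDiffAt_finsetSum (t := Finset.univ) fun j _ =>
      ((ContinuousLinearMap.smulRightL ℂ (ι → ℂ) E
        (ContinuousLinearMap.proj (R := ℂ) (φ := fun _ : ι => ℂ) j)).contMDiff).contMDiffAt.comp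
          x₀ (hem j)
  have hAapp : ∀ x ∈ T.baseSet, ∀ c : ι → ℂ,
      A x c = T.linearMapAt ℂ x (∑ j, c j • e j x) := by
    intro x hx c
    simp only [A, map_sum, map_smul, T.coe_linearMapAt_of_mem hx]
    simp
  have hb : x₀ ∈ T.baseSet := FiberBundle.mem_baseSet_trivializationAt' x₀
  have hinj : Function.Injective (A x₀) := by
    intro c c' h
    rw [hAapp _ hb, hAapp _ hb] at h
    have h2 : ∑ j, c j • e j x₀ = ∑ j, c' j • e j x₀ := by
      have := congrArg (T.symmₗ ℂ x₀) h
      rwa [T.symmₗ_linearMapAt hb, T.symmₗ_linearMapAt hb] at this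
    rw [← coef_sum (he.linInd _ hx) c, ← coef_sum (he.linInd _ hx) c', h2]
  obtain ⟨L₀, hL₀⟩ := (A x₀).toLinearMap.exists_leftInverse_of_injective
    (LinearMap.ker_eq_bot.2 hinj)
  let L : E →L[ℂ] (ι → ℂ) := L₀.toContinuousLinearMap
  have hL : L ∘L A x₀ = ContinuousLinearMap.id ℂ (ι → ℂ) := by
    ext1 c
    exact LinearMap.congr_fun hL₀ c
  have hLA : ContMDiffAt 𝓘(ℂ, E) 𝓘(ℂ, (ι → ℂ) →L[ℂ] (ι → ℂ)) ω (fun x => L ∘L A x) x₀ :=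
    contMDiffAt_const.clm_comp hA
  have hinv : ContMDiffAt 𝓘(ℂ, E) 𝓘(ℂ, (ι → ℂ) →L[ℂ] (ι → ℂ)) ω
      (fun x => ContinuousLinearMap.inverse (L ∘L A x)) x₀ := by
    have h1 : ContDiffAt ℂ ω (ContinuousLinearMap.inverse :
        ((ι → ℂ) →L[ℂ] (ι → ℂ)) → ((ι → ℂ) →L[ℂ] (ι → ℂ))) (L ∘L A x₀) := by
      rw [hL]
      exact contDiffAt_map_inverse (ContinuousLinearEquiv.refl ℂ (ι → ℂ))
    exact ContMDiffAt.comp x₀ h1.contMDiffAt hLA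
  refine ⟨fun x => ContinuousLinearMap.inverse (L ∘L A x) ∘L L,
    hinv.clm_comp contMDiffAt_const, ?_⟩
  have hunit : ∀ᶠ x in 𝓝 x₀, IsUnit (L ∘L A x) := by
    have : IsUnit (L ∘L A x₀) := by rw [hL]; exact isUnit_one
    exact hLA.continuousAt.eventually_mem (Units.isOpen.mem_nhds this)
  filter_upwards [hunit, T.open_baseSet.mem_nhds hb, he.isOpen.mem_nhds hx] with x h1 h2 h3 v hv
  have h5 : (T ⟨x, v⟩).2 = A x (coef (fun j => e j x) v) := by
    rw [hAapp x h2, sum_coef, T.coe_linearMapAt_of_mem h2]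
    rwa [he.span_eq x h3]
  obtain ⟨w, hw⟩ := h1
  have h7 : ContinuousLinearMap.inverse (L ∘L A x) ∘L (L ∘L A x) =
      ContinuousLinearMap.id ℂ (ι → ℂ) := by
    rw [← hw, ← ContinuousLinearMap.ringInverse_eq_inverse, Ring.inverse_unit]
    exact w.inv_mul
  rw [h5]
  exact (DFunLike.congr_fun h7 _).symm

/-- The coordinates in a holomorphic frame of `V` of a vector field along `g` with values in `V`
are holomorphic. -/
theorem HolAlongAt.coef [FiniteDimensional ℂ E] {ι : Type*} [Fintype ι]
    {V : ∀ x : M, Submodule ℂ (TangentSpace 𝓘(ℂ, E) x)}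
    {e : ι → ∀ x : M, TangentSpace 𝓘(ℂ, E) x} {U : Set M} (he : IsHolFrameOn V e U)
    {g : N → M} {s : ∀ y, TangentSpace 𝓘(ℂ, E) (g y)} {y₀ : N} (hs : HolAlongAt F g s y₀)
    (hU : g y₀ ∈ U) (hsV : ∀ᶠ y in 𝓝 y₀, s y ∈ V (g y)) (i : ι) :
    ContMDiffAt 𝓘(ℂ, F) 𝓘(ℂ) ω (fun y => coef (fun j => e j (g y)) (s y) i) y₀ := by
  obtain ⟨A, hA, hc⟩ := he.exists_coef_eq hU
  have h1 := holAlongAt_iff.1 hs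
  have h2 : ContMDiffAt 𝓘(ℂ, F) 𝓘(ℂ, ι → ℂ) ω (fun y => A (g y) (trivializationAt E
      (TangentSpace 𝓘(ℂ, E) : M → Type _) (g y₀) ⟨g y, s y⟩).2) y₀ :=
    (hA.comp y₀ h1.1).clm_apply h1.2
  have h3 : ContMDiffAt 𝓘(ℂ, F) 𝓘(ℂ) ω (fun y => A (g y) (trivializationAt E
      (TangentSpace 𝓘(ℂ, E) : M → Type _) (g y₀) ⟨g y, s y⟩).2 i) y₀ :=
    ((ContinuousLinearMap.proj (R := ℂ) (φ := fun _ : ι => ℂ) i).contMDiff).contMDiffAt.comp y₀ h2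
  refine h3.congr_of_eventuallyEq ?_
  filter_upwards [h1.1.continuousAt.eventually hc, hsV] with y h4 h5
  rw [h4 _ h5]

end Along

/-! ### Alternating maps -/

section Alternating

variable {W : Type*} [AddCommGroup W] [Module ℂ W]

/-- Adding multiples of one argument to the others does not change an alternating map. -/
theorem map_add_smul_apply {ι : Type*} [Fintype ι] [DecidableEq ι] (f : W [⋀^ι]→ₗ[ℂ] ℂ)
    (ξ : ι → W) (i₀ : ι) (c : ι → ℂ) (hc : c i₀ = 0) :
    f (fun j => ξ j + c j • ξ i₀) = f ξ := by
  have key : ∀ s : Finset ι, i₀ ∉ s →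
      f (s.piecewise (fun j => ξ j + c j • ξ i₀) ξ) = f ξ := by
    intro s
    induction s using Finset.induction_on with
    | empty => simp
    | insert i s hi ih =>
      intro h
      rw [Finset.mem_insert, not_or] at h
      rw [Finset.piecewise_insert, f.map_update_add, f.map_update_smul]
      have h1 : Function.update (s.piecewise (fun j => ξ j + c j • ξ i₀) ξ) i (ξ i) =
          s.piecewise (fun j => ξ j + c j • ξ i₀) ξ := by
        rw [Function.update_eq_self_iff, Finset.piecewise_eq_of_notMem _ _ _ hi]
      have h2 : f (Function.update (s.piecewise (fun j => ξ j + c j • ξ i₀) ξ) i (ξ i₀)) = 0 := by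
        refine f.map_eq_zero_of_eq _ (i := i) (j := i₀) ?_ (Ne.symm h.1)
        rw [Function.update_self, Function.update_of_ne h.1,
          Finset.piecewise_eq_of_notMem _ _ _ h.2]
      rw [h1, h2, ih h.2, smul_zero, add_zero]
  rw [← key (Finset.univ.erase i₀) (by simp)]
  congr 1
  funext j
  by_cases hj : j = i₀
  · subst hj
    simp [hc]
  · rw [Finset.piecewise_eq_of_mem _ _ _ (by simp [hj])]

/-- The wedge product `lam ∧ γ`. -/
noncomputable def wedge {m : ℕ} (lam : W →ₗ[ℂ] ℂ) (γ : W [⋀^Fin m]→ₗ[ℂ] ℂ) :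
    W [⋀^Fin (m + 1)]→ₗ[ℂ] ℂ :=
  AlternatingMap.alternatizeUncurryFin (lam.smulRight γ)

theorem wedge_apply {m : ℕ} (lam : W →ₗ[ℂ] ℂ) (γ : W [⋀^Fin m]→ₗ[ℂ] ℂ) (ξ : Fin (m + 1) → W) :
    wedge lam γ ξ =
      ∑ i : Fin (m + 1), (-1 : ℂ) ^ (i : ℕ) * lam (ξ i) * γ (fun j => ξ (i.succAbove j)) := by
  rw [wedge, AlternatingMap.alternatizeUncurryFin_apply]
  refine Finset.sum_congr rfl fun i _ => ?_
  rw [LinearMap.smulRight_apply, AlternatingMap.smul_apply, smul_eq_mul, zsmul_eq_mul, mul_assoc]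
  push_cast
  rfl

/-- The product `lam ∧ γ` depends on the restriction of `γ` to the kernel of `lam` only: subtracting
multiples of a vector outside the kernel from the other vectors moves all of them into it. -/
theorem wedge_eq_of_eqOn_ker {m : ℕ} {lam : W →ₗ[ℂ] ℂ} {γ γ' : W [⋀^Fin m]→ₗ[ℂ] ℂ}
    (h : ∀ ξ : Fin m → W, (∀ i, lam (ξ i) = 0) → γ ξ = γ' ξ) : wedge lam γ = wedge lam γ' := by
  ext ξ
  by_cases h0 : ∀ i, lam (ξ i) = 0
  · simp [wedge_apply, h0]
  push Not at h0
  obtain ⟨i₀, hi₀⟩ := h0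
  -- After the change `ξⱼ ↦ ξⱼ + cⱼ ξ_{i₀}` only the term of index `i₀` survives.
  let c : Fin (m + 1) → ℂ := Function.update (fun j => -(lam (ξ j) / lam (ξ i₀))) i₀ 0
  have hc : c i₀ = 0 := Function.update_self ..
  have hlam : ∀ j, j ≠ i₀ → lam (ξ j + c j • ξ i₀) = 0 := by
    intro j hj
    simp only [c, Function.update_of_ne hj, map_add, map_smul, smul_eq_mul]
    field_simp
    ring
  rw [← map_add_smul_apply (wedge lam γ) ξ i₀ c hc, ← map_add_smul_apply (wedge lam γ') ξ i₀ c hc,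
    wedge_apply, wedge_apply]
  refine Finset.sum_congr rfl fun i _ => ?_
  by_cases hi : i = i₀
  · rw [h]
    subst hi
    exact fun j => hlam _ (Fin.succAbove_ne i j)
  · rw [hlam i hi]
    simp

theorem map_cons_add_smul {m : ℕ} (α : W [⋀^Fin (m + 1)]→ₗ[ℂ] ℂ) (v : W) (u : Fin m → W)
    (c : Fin m → ℂ) : α (Fin.cons v fun i => u i + c i • v) = α (Fin.cons v u) := by
  rw [← map_add_smul_apply α (Fin.cons v u) 0 (Fin.cons 0 c) rfl]
  congr 1
  funext j
  refine Fin.cases ?_ (fun i => ?_) j <;> simp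

end Alternating

namespace DirectedManifold

variable {r : ℕ} (D : DirectedManifold.{u} r)

/-! ### Coordinates on the bundle of lines -/

/-- A nonzero vector on the line `q`, as a tangent vector at `π(q)`. -/
noncomputable def vec (q : D.P) : TangentSpace 𝓘(ℂ, D.E) (D.proj q) := ProjBundle.vec q

theorem line_eq_span_vec (q : D.P) : D.line q = Submodule.span ℂ {D.vec q} := D.line_eq q

theorem vec_mem (q : D.P) : D.vec q ∈ D.V (D.proj q) := ProjBundle.vec_mem q

theorem vec_ne (q : D.P) : D.vec q ≠ 0 := ProjBundle.vec_ne q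

theorem vec_mem_line (q : D.P) : D.vec q ∈ D.line q := by
  rw [D.line_eq_span_vec]
  exact Submodule.mem_span_singleton_self _

theorem exists_eq_smul_vec {q : D.P} {v : TangentSpace 𝓘(ℂ, D.E) (D.proj q)}
    (hv : v ∈ D.line q) (h0 : v ≠ 0) : ∃ c : ℂ, c ≠ 0 ∧ v = c • D.vec q := by
  rw [D.line_eq_span_vec, Submodule.mem_span_singleton] at hv
  obtain ⟨c, rfl⟩ := hv
  exact ⟨c, fun h => h0 (by rw [h, zero_smul]), rfl⟩

theorem line_eq_span {q : D.P} {v : TangentSpace 𝓘(ℂ, D.E) (D.proj q)}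
    (hv : v ∈ D.line q) (h0 : v ≠ 0) : D.line q = Submodule.span ℂ {v} := by
  obtain ⟨c, hc, rfl⟩ := D.exists_eq_smul_vec hv h0
  rw [D.line_eq_span_vec]
  exact (Submodule.span_singleton_smul_eq (IsUnit.mk0 c hc) _).symm

theorem mem_line_iff {q : D.P} {v v' : TangentSpace 𝓘(ℂ, D.E) (D.proj q)}
    (hv : v ∈ D.line q) (h0 : v ≠ 0) : v' ∈ D.line q ↔ ∃ c : ℂ, c • v = v' := by
  rw [D.line_eq_span hv h0, Submodule.mem_span_singleton]

theorem mkVec_eq_of_mem_line {q : D.P} {v : TangentSpace 𝓘(ℂ, D.E) (D.proj q)}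
    (hv : v ∈ D.line q) (h0 : v ≠ 0) : ProjBundle.mkVec (D.proj q) v (D.line_le q hv) h0 = q := by
  obtain ⟨c, hc, rfl⟩ := D.exists_eq_smul_vec hv h0
  refine Eq.trans ?_ (ProjBundle.mkVec_vec q)
  exact ProjBundle.mkVec_eq c rfl

theorem mem_line_mkVec {x : D.M} {v : TangentSpace 𝓘(ℂ, D.E) x} (hv : v ∈ D.V x) (h0 : v ≠ 0) :
    v ∈ D.line (ProjBundle.mkVec x v hv h0) := by
  obtain ⟨c, hc, h⟩ := ProjBundle.exists_vec_mkVec hv h0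
  have h1 : v = c⁻¹ • (ProjBundle.mkVec x v hv h0).vec := by
    rw [h]
    exact (inv_smul_smul₀ hc v).symm
  have h2 := Submodule.smul_mem _ c⁻¹ (D.vec_mem_line (ProjBundle.mkVec x v hv h0))
  exact (congrArg (· ∈ D.line (ProjBundle.mkVec x v hv h0)) h1).mpr h2

theorem mem_frameChart_source_iff {F : FrameChart D.V (r - 1)} {p q : D.P}
    (hq : D.proj q ∈ F.dom) {v : TangentSpace 𝓘(ℂ, D.E) (D.proj q)} (hv : v ∈ D.line q)
    (h0 : v ≠ 0) : q ∈ (D.frameChart F p).source ↔ F.co (D.proj q) v none ≠ 0 := by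
  obtain ⟨c, hc, rfl⟩ := D.exists_eq_smul_vec hv h0
  rw [F.co_smul hq (D.vec_mem q)]
  have h1 : q ∈ (D.frameChart F p).source ↔
    D.proj q ∈ F.dom ∧ F.co (D.proj q) (D.vec q) none ≠ 0 := Iff.rfl
  rw [h1, Pi.smul_apply, smul_eq_mul, mul_ne_zero_iff]
  exact ⟨fun h => ⟨hc, h.2⟩, fun h => ⟨hq, h.2⟩⟩

theorem frameChart_snd {F : FrameChart D.V (r - 1)} {p q : D.P}
    (hq : q ∈ (D.frameChart F p).source) {v : TangentSpace 𝓘(ℂ, D.E) (D.proj q)}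
    (hv : v ∈ D.line q) (h0 : v ≠ 0) (j : Fin (r - 1)) :
    (D.frameChart F p q).2 j = F.co (D.proj q) v (some j) / F.co (D.proj q) v none := by
  obtain ⟨c, hc, rfl⟩ := D.exists_eq_smul_vec hv h0
  rw [F.co_smul (show D.proj q ∈ F.dom from hq.1) (D.vec_mem q)]
  exact (mul_div_mul_left _ _ hc).symm

theorem contMDiffAt_frameChart {F : FrameChart D.V (r - 1)} {p q : D.P}
    (hq : q ∈ (D.frameChart F p).source) :
    ContMDiffAt 𝓘(ℂ, D.PE) 𝓘(ℂ, D.PE) ω (D.frameChart F p) q :=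
  contMDiffAt_of_mem_maximalAtlas
    (IsManifold.subset_maximalAtlas (D.frameChart_mem_atlas F p)) hq

theorem mfderiv_frameChart_injective {F : FrameChart D.V (r - 1)} {p q : D.P}
    (hq : q ∈ (D.frameChart F p).source) :
    Function.Injective (mfderiv 𝓘(ℂ, D.PE) 𝓘(ℂ, D.PE) (D.frameChart F p) q) :=
  ((mdifferentiable_of_mem_atlas (D.frameChart_mem_atlas F p)).mfderiv hq).injective

theorem vecAt_mem_line {F : FrameChart D.V (r - 1)} {p q : D.P}
    (hq : q ∈ (D.frameChart F p).source) :
    F.vecAt (D.proj q) (D.frameChart F p q).2 ∈ D.line q := by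
  rw [D.line_eq_vecAt hq]
  exact Submodule.mem_span_singleton_self _

section Maps

variable {G : Type*} [NormedAddCommGroup G] [NormedSpace ℂ G]
  {N : Type*} [TopologicalSpace N] [ChartedSpace G N]

/-- A map to `P(V)` is holomorphic if the lines that are its values are spanned by a holomorphic
family of vectors. -/
theorem contMDiffAt_of_holAlongAt {h : N → D.P} {s : ∀ y, TangentSpace 𝓘(ℂ, D.E) (D.proj (h y))}
    {y₀ : N} (hs : HolAlongAt G (fun y => D.proj (h y)) s y₀)
    (hl : ∀ᶠ y in 𝓝 y₀, s y ∈ D.line (h y) ∧ s y ≠ 0) :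
    ContMDiffAt 𝓘(ℂ, G) 𝓘(ℂ, D.PE) ω h y₀ := by
  obtain ⟨F, hF⟩ := D.exists_chart (h y₀)
  have hF' : h y₀ ∈ (D.frameChart F (h y₀)).source := hF
  have hco : ∀ i, ContMDiffAt 𝓘(ℂ, G) 𝓘(ℂ) ω
      (fun y => F.co (D.proj (h y)) (s y) i) y₀ := fun i =>
    hs.coef F.frame hF.1 (hl.mono fun y hy => D.line_le _ hy.1) i
  have h0 : F.co (D.proj (h y₀)) (s y₀) none ≠ 0 :=
    (D.mem_frameChart_source_iff hF.1 hl.self_of_nhds.1 hl.self_of_nhds.2).1 hF'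
  have hdom : ∀ᶠ y in 𝓝 y₀, D.proj (h y) ∈ F.dom :=
    hs.base.continuousAt.eventually_mem (F.frame.isOpen.mem_nhds hF.1)
  have hsource : ∀ᶠ y in 𝓝 y₀, h y ∈ (D.frameChart F (h y₀)).source := by
    filter_upwards [hl, hdom, (hco none).continuousAt.eventually_ne h0] with y h1 h2 h3
    exact (D.mem_frameChart_source_iff h2 h1.1 h1.2).2 h3
  have h1 : ContMDiffAt 𝓘(ℂ, G) 𝓘(ℂ, D.PE) ω (fun y => D.frameChart F (h y₀) (h y)) y₀ := by
    have h2 : ContMDiffAt 𝓘(ℂ, G) 𝓘(ℂ, D.E) ω (fun y => chartAt D.E F.center (D.proj (h y))) y₀ :=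
      ((contMDiffOn_chart (I := 𝓘(ℂ, D.E)) (n := ω) (x := F.center)).contMDiffAt
        ((chartAt D.E F.center).open_source.mem_nhds (F.dom_sub hF.1))).comp y₀ hs.base
    have h3 : ContMDiffAt 𝓘(ℂ, G) 𝓘(ℂ, Fin (r - 1) → ℂ) ω (fun y j =>
        F.co (D.proj (h y)) (s y) (some j) / F.co (D.proj (h y)) (s y) none) y₀ :=
      contMDiffAt_pi_space.2 fun j => (hco (some j)).div₀ (hco none) h0
    refine (h2.prodMk_space h3).congr_of_eventuallyEq ?_
    filter_upwards [hl, hsource] with y h4 h5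
    refine Prod.ext rfl (funext fun j => ?_)
    exact D.frameChart_snd h5 h4.1 h4.2 j
  have h2 : ContMDiffAt 𝓘(ℂ, D.PE) 𝓘(ℂ, D.PE) ω (D.frameChart F (h y₀)).symm
      (D.frameChart F (h y₀) (h y₀)) :=
    contMDiffAt_symm_of_mem_maximalAtlas
      (IsManifold.subset_maximalAtlas (D.frameChart_mem_atlas F _))
      ((D.frameChart F (h y₀)).map_source hF')
  refine (h2.comp y₀ h1).congr_of_eventuallyEq ?_
  filter_upwards [hsource] with y hy
  exact ((D.frameChart F (h y₀)).left_inv hy).symm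

theorem holAlongAt_vecAt {F : FrameChart D.V (r - 1)} {p : D.P} {g : N → D.P} {y₀ : N}
    (hg : ContMDiffAt 𝓘(ℂ, G) 𝓘(ℂ, D.PE) ω g y₀) (hq : g y₀ ∈ (D.frameChart F p).source) :
    HolAlongAt G (fun y => D.proj (g y))
      (fun y => F.vecAt (D.proj (g y)) (D.frameChart F p (g y)).2) y₀ := by
  have hp : ContMDiffAt 𝓘(ℂ, G) 𝓘(ℂ, D.E) ω (fun y => D.proj (g y)) y₀ :=
    (D.contMDiff_proj _).comp y₀ hg
  refine HolAlongAt.sum_smul hp (fun i => (F.frame.hol i).holAlongAt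
    (F.frame.isOpen.mem_nhds hq.1) hp) fun i => ?_
  have h1 : ContMDiffAt 𝓘(ℂ, G) 𝓘(ℂ, D.PE) ω (fun y => D.frameChart F p (g y)) y₀ :=
    (D.contMDiffAt_frameChart hq).comp y₀ hg
  cases i with
  | none => exact contMDiffAt_const
  | some j =>
    have h2 : ContDiff ℂ ω (fun z : D.PE => z.2 j) := (contDiff_apply ℂ ℂ j).comp contDiff_snd
    exact h2.contMDiff.contMDiffAt.comp y₀ h1

end Maps

/-! ### The Euler sequence -/

theorem mfderiv_comp_curve_apply {E E' : Type*} [NormedAddCommGroup E] [NormedSpace ℂ E]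
    [NormedAddCommGroup E'] [NormedSpace ℂ E'] {M M' : Type*} [TopologicalSpace M]
    [ChartedSpace E M] [TopologicalSpace M'] [ChartedSpace E' M'] {f : M → M'} {c : ℂ → M} {x : M}
    (hf : MDifferentiableAt 𝓘(ℂ, E) 𝓘(ℂ, E') f x) (hc : MDifferentiableAt 𝓘(ℂ) 𝓘(ℂ, E) c 0)
    (hx : c 0 = x) :
    (mfderiv 𝓘(ℂ) 𝓘(ℂ, E') (f ∘ c) (0 : ℂ) : ℂ →L[ℂ] E') (1 : ℂ) =
      mfderiv 𝓘(ℂ, E) 𝓘(ℂ, E') f x ((mfderiv 𝓘(ℂ) 𝓘(ℂ, E) c (0 : ℂ) : ℂ →L[ℂ] E) (1 : ℂ)) := by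
  subst hx
  rw [mfderiv_comp (0 : ℂ) hf hc]
  rfl

theorem eulerCurve_of_ne {q : D.P} {v u : D.V (D.proj q)} {t : ℂ}
    (h : (v : TangentSpace 𝓘(ℂ, D.E) (D.proj q)) +
      t • (u : TangentSpace 𝓘(ℂ, D.E) (D.proj q)) ≠ 0) :
    D.eulerCurve q v u t = ProjBundle.mkVec (D.proj q) _ (v + t • u).2 h :=
  dif_pos h

theorem eulerCurve_of_eq {q : D.P} {v u : D.V (D.proj q)} {t : ℂ}
    (h : (v : TangentSpace 𝓘(ℂ, D.E) (D.proj q)) +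
      t • (u : TangentSpace 𝓘(ℂ, D.E) (D.proj q)) = 0) :
    D.eulerCurve q v u t = q :=
  dif_neg (not_not.2 h)

theorem eulerCurve_zero {q : D.P} {v : D.V (D.proj q)}
    (hv : (v : TangentSpace 𝓘(ℂ, D.E) (D.proj q)) ∈ D.line q)
    (h0 : (v : TangentSpace 𝓘(ℂ, D.E) (D.proj q)) ≠ 0) (u : D.V (D.proj q)) :
    D.eulerCurve q v u 0 = q := by
  have h1 : (v : TangentSpace 𝓘(ℂ, D.E) (D.proj q)) +
      (0 : ℂ) • (u : TangentSpace 𝓘(ℂ, D.E) (D.proj q)) = v := by rw [zero_smul, add_zero]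
  rw [D.eulerCurve_of_ne (h1.symm ▸ h0)]
  exact (ProjBundle.mkVec_eq 1 ((one_smul ℂ _).trans h1.symm)).trans (D.mkVec_eq_of_mem_line hv h0)

theorem proj_eulerCurve (q : D.P) (v u : D.V (D.proj q)) (t : ℂ) :
    D.proj (D.eulerCurve q v u t) = D.proj q := by
  rw [eulerCurve]
  split_ifs <;> rfl

/-- The vector `v + t u` as a tangent vector at the projection of any point `q'`, by means of the
common model of all tangent spaces. It is of use for points `q'` over `π(q)`. -/
noncomputable def shift {q : D.P} (v u : D.V (D.proj q)) (t : ℂ) (q' : D.P) :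
    TangentSpace 𝓘(ℂ, D.E) (D.proj q') :=
  (v : TangentSpace 𝓘(ℂ, D.E) (D.proj q)) + t • (u : TangentSpace 𝓘(ℂ, D.E) (D.proj q))

theorem shift_mem_line_eulerCurve {q : D.P} {v u : D.V (D.proj q)} {t : ℂ}
    (h : (v : TangentSpace 𝓘(ℂ, D.E) (D.proj q)) +
      t • (u : TangentSpace 𝓘(ℂ, D.E) (D.proj q)) ≠ 0) :
    D.shift v u t (D.eulerCurve q v u t) ∈ D.line (D.eulerCurve q v u t) := by
  have key : ∀ q', q' = ProjBundle.mkVec (D.proj q) _ (v + t • u).2 h →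
      D.shift v u t q' ∈ D.line q' := by
    rintro _ rfl
    exact D.mem_line_mkVec (v + t • u).2 h
  exact key _ (D.eulerCurve_of_ne h)

theorem eventually_add_smul_ne {q : D.P} {v : D.V (D.proj q)}
    (h0 : (v : TangentSpace 𝓘(ℂ, D.E) (D.proj q)) ≠ 0) (u : D.V (D.proj q)) :
    ∀ᶠ t : ℂ in 𝓝 0, (v : TangentSpace 𝓘(ℂ, D.E) (D.proj q)) +
      t • (u : TangentSpace 𝓘(ℂ, D.E) (D.proj q)) ≠ 0 := by
  have key : ∀ a b : D.E, a ≠ 0 → ∀ᶠ t : ℂ in 𝓝 0, a + t • b ≠ 0 := by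
    intro a b ha
    have h1 : ContinuousAt (fun t : ℂ => a + t • b) 0 := by fun_prop
    exact h1.eventually_ne (by simpa using ha)
  exact key _ _ h0

theorem contMDiffAt_eulerCurve {q : D.P} {v : D.V (D.proj q)}
    (h0 : (v : TangentSpace 𝓘(ℂ, D.E) (D.proj q)) ≠ 0) (u : D.V (D.proj q)) :
    ContMDiffAt 𝓘(ℂ) 𝓘(ℂ, D.PE) ω (D.eulerCurve q v u) 0 := by
  have h1 : HolAlongAt ℂ (fun _ : ℂ => D.proj q) (fun t =>
      ∑ i : Fin 2, (![1, t] i : ℂ) • (![v, u] i : TangentSpace 𝓘(ℂ, D.E) (D.proj q))) 0 := by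
    refine HolAlongAt.sum_smul (s := fun i _ => (![v, u] i : TangentSpace 𝓘(ℂ, D.E) (D.proj q)))
      contMDiffAt_const (fun i => contMDiffAt_const) fun i => ?_
    fin_cases i
    · exact contMDiffAt_const
    · exact contMDiffAt_id
  have h2 : HolAlongAt ℂ (fun t : ℂ => D.proj (D.eulerCurve q v u t))
      (fun t => D.shift v u t (D.eulerCurve q v u t)) 0 := by
    refine ContMDiffAt.congr_of_eventuallyEq h1 (Filter.Eventually.of_forall fun t => ?_)
    have key : ∀ x, x = D.proj q → ∀ a b : D.E, a = b →
        (⟨x, a⟩ : TangentBundle 𝓘(ℂ, D.E) D.M) = ⟨D.proj q, b⟩ := by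
      rintro _ rfl _ _ rfl
      rfl
    refine key _ (D.proj_eulerCurve q v u t) _ _ ?_
    refine Eq.trans ?_ (Fin.sum_univ_two _).symm
    change _ = (1 : ℂ) • (v : TangentSpace 𝓘(ℂ, D.E) (D.proj q)) + t • _
    rw [one_smul]
    rfl
  refine D.contMDiffAt_of_holAlongAt h2 ?_
  filter_upwards [D.eventually_add_smul_ne h0 u] with t ht
  exact ⟨D.shift_mem_line_eulerCurve ht, ht⟩

theorem co_add_smul {F : FrameChart D.V (r - 1)} {x : D.M} (hx : x ∈ F.dom)
    {v u : TangentSpace 𝓘(ℂ, D.E) x} (hv : v ∈ D.V x) (hu : u ∈ D.V x) (t : ℂ)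
    (i : Option (Fin (r - 1))) : F.co x (v + t • u) i = F.co x v i + t * F.co x u i := by
  have h1 := coef_sum' (F.frame.linInd x hx) (u := ![v, u]) (fun k => by
    rw [F.frame.span_eq x hx]
    fin_cases k
    · exact hv
    · exact hu) ![1, t] i
  rw [Fin.sum_univ_two, Fin.sum_univ_two] at h1
  change coef _ ((1 : ℂ) • v + t • u) i = 1 * coef _ v i + t * coef _ u i at h1
  rwa [one_smul, one_mul] at h1

/-- In a standard chart the vector `eulerVec q v u` is vertical, with coordinates the derivatives
at `t = 0` of the quotients `(vⱼ + t uⱼ) / (v₀ + t u₀)`. -/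
theorem mfderiv_frameChart_eulerVec {F : FrameChart D.V (r - 1)} {p q : D.P}
    (hq : q ∈ (D.frameChart F p).source) {v : D.V (D.proj q)}
    (hv : (v : TangentSpace 𝓘(ℂ, D.E) (D.proj q)) ∈ D.line q)
    (h0 : (v : TangentSpace 𝓘(ℂ, D.E) (D.proj q)) ≠ 0) (u : D.V (D.proj q)) :
    (mfderiv 𝓘(ℂ, D.PE) 𝓘(ℂ, D.PE) (D.frameChart F p) q (D.eulerVec q v u) : D.PE) =
      (0, fun j => (F.co (D.proj q) u (some j) -
        (D.frameChart F p q).2 j * F.co (D.proj q) u none) / F.co (D.proj q) v none) := by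
  have hx : D.proj q ∈ F.dom := hq.1
  have hv0 : F.co (D.proj q) v none ≠ 0 := (D.mem_frameChart_source_iff hx hv h0).1 hq
  have hz := D.eulerCurve_zero hv h0 u
  have hd : MDifferentiableAt 𝓘(ℂ) 𝓘(ℂ, D.PE) (D.eulerCurve q v u) 0 :=
    (D.contMDiffAt_eulerCurve h0 u).mdifferentiableAt (by simp)
  have h1 : (mfderiv 𝓘(ℂ, D.PE) 𝓘(ℂ, D.PE) (D.frameChart F p) q (D.eulerVec q v u) : D.PE) =
      deriv (fun t => D.frameChart F p (D.eulerCurve q v u t)) 0 := by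
    rw [eulerVec, ← mfderiv_comp_curve_apply
      ((D.contMDiffAt_frameChart hq).mdifferentiableAt (by simp)) hd hz, mfderiv_eq_fderiv]
    rfl
  rw [h1]
  have h2 : (fun t => D.frameChart F p (D.eulerCurve q v u t)) =ᶠ[𝓝 0] fun t =>
      (chartAt D.E F.center (D.proj q), fun j =>
        (F.co (D.proj q) v (some j) + t * F.co (D.proj q) u (some j)) /
          (F.co (D.proj q) v none + t * F.co (D.proj q) u none)) := by
    have hs : ∀ᶠ t in 𝓝 (0 : ℂ), D.eulerCurve q v u t ∈ (D.frameChart F p).source :=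
      hd.continuousAt.eventually_mem ((D.frameChart F p).open_source.mem_nhds (hz.symm ▸ hq))
    filter_upwards [hs, D.eventually_add_smul_ne h0 u] with t ht hne
    refine Prod.ext (congrArg (chartAt D.E F.center) (D.proj_eulerCurve q v u t))
      (funext fun j => ?_)
    refine (D.frameChart_snd ht (D.shift_mem_line_eulerCurve hne) hne j).trans ?_
    rw [D.proj_eulerCurve q v u t]
    have h3 := D.co_add_smul hx v.2 u.2 t
    exact congrArg₂ (· / ·) (h3 _) (h3 _)
  rw [h2.deriv_eq]
  refine HasDerivAt.deriv (F := D.PE) (HasDerivAt.prodMk (hasDerivAt_const _ _)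
    (hasDerivAt_pi.2 fun j => ?_))
  have h4 : ∀ a b : ℂ, HasDerivAt (fun t : ℂ => a + t * b) b 0 := fun a b => by
    simpa using ((hasDerivAt_id (0 : ℂ)).mul_const b).const_add a
  refine ((h4 (F.co (D.proj q) v (some j)) (F.co (D.proj q) u (some j))).div
    (h4 (F.co (D.proj q) v none) (F.co (D.proj q) u none)) (by simpa using hv0)).congr_deriv ?_
  rw [D.frameChart_snd hq hv h0 j]
  simp only [zero_mul, add_zero]
  field_simp

theorem dproj_eulerVec {q : D.P} {v : D.V (D.proj q)}
    (hv : (v : TangentSpace 𝓘(ℂ, D.E) (D.proj q)) ∈ D.line q)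
    (h0 : (v : TangentSpace 𝓘(ℂ, D.E) (D.proj q)) ≠ 0) (u : D.V (D.proj q)) :
    D.dproj q (D.eulerVec q v u) = 0 := by
  obtain ⟨F, hF⟩ := D.exists_chart q
  have hF' : q ∈ (D.frameChart F q).source := hF
  have h1 := D.chart_dproj hF' (D.eulerVec q v u)
  refine D.mfderiv_chart_injective F.center _ (F.dom_sub hF.1) ?_
  refine h1.trans (Eq.trans ?_ (map_zero _).symm)
  exact congrArg Prod.fst (D.mfderiv_frameChart_eulerVec hF' hv h0 u)

theorem sum_co {F : FrameChart D.V (r - 1)} {x : D.M} (hx : x ∈ F.dom)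
    {v : TangentSpace 𝓘(ℂ, D.E) x} (hv : v ∈ D.V x) : ∑ i, F.co x v i • F.e i x = v :=
  sum_coef (by rwa [F.frame.span_eq x hx])

/-- The kernel of `u ↦ eulerVec q v u` is the line of `q`. -/
theorem eulerVec_eq_zero_iff {q : D.P} {v : D.V (D.proj q)}
    (hv : (v : TangentSpace 𝓘(ℂ, D.E) (D.proj q)) ∈ D.line q)
    (h0 : (v : TangentSpace 𝓘(ℂ, D.E) (D.proj q)) ≠ 0) (u : D.V (D.proj q)) :
    D.eulerVec q v u = 0 ↔ (u : TangentSpace 𝓘(ℂ, D.E) (D.proj q)) ∈ D.line q := by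
  obtain ⟨F, hF⟩ := D.exists_chart q
  have hF' : q ∈ (D.frameChart F q).source := hF
  have hx : D.proj q ∈ F.dom := hF.1
  have hv0 : F.co (D.proj q) v none ≠ 0 := (D.mem_frameChart_source_iff hx hv h0).1 hF
  have h1 := D.mfderiv_frameChart_eulerVec hF' hv h0 u
  constructor
  · intro h
    rw [h] at h1
    have h2 := congrArg Prod.snd ((map_zero _).symm.trans h1)
    have h3 : ∀ j, F.co (D.proj q) u (some j) =
        F.co (D.proj q) u none * (D.frameChart F q q).2 j := by
      intro j
      have h4 := (congrFun h2 j).symm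
      change (_ - _) / _ = (0 : ℂ) at h4
      rw [div_eq_zero_iff, or_iff_left hv0, sub_eq_zero] at h4
      rw [h4, mul_comm]
    rw [D.line_eq_vecAt hF', Submodule.mem_span_singleton]
    refine ⟨F.co (D.proj q) u none, Eq.trans ?_ (D.sum_co hx u.2)⟩
    rw [FrameChart.vecAt, Finset.smul_sum]
    refine Finset.sum_congr rfl fun i _ => ?_
    rw [smul_smul]
    congr 1
    cases i with
    | none => exact mul_one _
    | some j => exact (h3 j).symm
  · intro h
    rw [D.line_eq_span hv h0, Submodule.mem_span_singleton] at h
    obtain ⟨c, hc⟩ := h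
    refine D.mfderiv_frameChart_injective hF' (h1.trans (Eq.trans ?_ (map_zero _).symm))
    refine Prod.ext rfl (funext fun j => ?_)
    change (_ - _) / _ = (0 : ℂ)
    rw [← hc, F.co_smul hx v.2, D.frameChart_snd hF' hv h0 j, Pi.smul_apply, Pi.smul_apply,
      smul_eq_mul, smul_eq_mul]
    field_simp
    simp

/-- Every vertical vector is of the form `eulerVec q v u`. -/
theorem exists_eulerVec_eq {q : D.P} {v : D.V (D.proj q)}
    (hv : (v : TangentSpace 𝓘(ℂ, D.E) (D.proj q)) ∈ D.line q)
    (h0 : (v : TangentSpace 𝓘(ℂ, D.E) (D.proj q)) ≠ 0) {ξ : TangentSpace 𝓘(ℂ, D.PE) q}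
    (hξ : D.dproj q ξ = 0) : ∃ u, ξ = D.eulerVec q v u := by
  obtain ⟨F, hF⟩ := D.exists_chart q
  have hF' : q ∈ (D.frameChart F q).source := hF
  have hx : D.proj q ∈ F.dom := hF.1
  have hv0 : F.co (D.proj q) v none ≠ 0 := (D.mem_frameChart_source_iff hx hv h0).1 hF
  set b : D.PE := mfderiv 𝓘(ℂ, D.PE) 𝓘(ℂ, D.PE) (D.frameChart F q) q ξ with hb
  let c : Option (Fin (r - 1)) → ℂ := fun i => Option.elim i 0 fun j =>
    F.co (D.proj q) v none * b.2 j
  have hu : ∑ i, c i • F.e i (D.proj q) ∈ D.V (D.proj q) := by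
    rw [← F.frame.span_eq _ hx]
    exact Submodule.sum_mem _ fun i _ => Submodule.smul_mem _ _ (Submodule.subset_span ⟨i, rfl⟩)
  have hco : F.co (D.proj q) (∑ i, c i • F.e i (D.proj q)) = c := coef_sum (F.frame.linInd _ hx) c
  refine ⟨⟨_, hu⟩, D.mfderiv_frameChart_injective hF' (Eq.trans ?_
    (D.mfderiv_frameChart_eulerVec hF' hv h0 ⟨_, hu⟩).symm)⟩
  simp only [hco]
  refine Prod.ext ?_ (funext fun j => ?_)
  · refine (D.chart_dproj hF' ξ).symm.trans ?_
    rw [hξ]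
    exact map_zero _
  · change b.2 j = (F.co (D.proj q) v none * b.2 j - _ * 0) / _
    field_simp
    simp

theorem eulerVec_smul_left {q : D.P} {v : D.V (D.proj q)}
    (hv : (v : TangentSpace 𝓘(ℂ, D.E) (D.proj q)) ∈ D.line q)
    (h0 : (v : TangentSpace 𝓘(ℂ, D.E) (D.proj q)) ≠ 0) (u : D.V (D.proj q)) {t : ℂ} (ht : t ≠ 0) :
    D.eulerVec q (t • v) u = D.eulerVec q v (t⁻¹ • u) := by
  obtain ⟨F, hF⟩ := D.exists_chart q
  have hF' : q ∈ (D.frameChart F q).source := hF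
  have hx : D.proj q ∈ F.dom := hF.1
  have hv0 : F.co (D.proj q) v none ≠ 0 := (D.mem_frameChart_source_iff hx hv h0).1 hF
  have hv' : ((t • v : D.V (D.proj q)) : TangentSpace 𝓘(ℂ, D.E) (D.proj q)) ∈ D.line q :=
    Submodule.smul_mem _ t hv
  have h0' : ((t • v : D.V (D.proj q)) : TangentSpace 𝓘(ℂ, D.E) (D.proj q)) ≠ 0 :=
    smul_ne_zero ht h0
  refine D.mfderiv_frameChart_injective hF' ((D.mfderiv_frameChart_eulerVec hF' hv' h0' u).trans
    (Eq.trans ?_ (D.mfderiv_frameChart_eulerVec hF' hv h0 (t⁻¹ • u)).symm))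
  refine Prod.ext rfl (funext fun j => ?_)
  simp only [Submodule.coe_smul, F.co_smul hx v.2, F.co_smul hx u.2, Pi.smul_apply, smul_eq_mul]
  field_simp

/-! ### The tautological morphism of one stage -/

theorem exists_isDualVec {q : D.P} {v : D.V (D.proj q)}
    (hv : (v : TangentSpace 𝓘(ℂ, D.E) (D.proj q)) ∈ D.line q)
    (h0 : (v : TangentSpace 𝓘(ℂ, D.E) (D.proj q)) ≠ 0) : ∃ lam, D.IsDualVec q v lam := by
  let f : D.liftV q →ₗ[ℂ] Submodule.span ℂ {(v : TangentSpace 𝓘(ℂ, D.E) (D.proj q))} :=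
    LinearMap.codRestrict _ ((D.dproj q).toLinearMap ∘ₗ (D.liftV q).subtype) fun ξ => by
      rw [← D.line_eq_span hv h0]
      exact ξ.2
  refine ⟨(LinearEquiv.coord ℂ _ _ h0).toLinearMap ∘ₗ f, fun ξ => ?_⟩
  exact (LinearEquiv.coord_apply_smul ℂ _ _ h0 (f ξ)).symm

theorem IsDualVec.unique {q : D.P} {v : D.V (D.proj q)}
    (h0 : (v : TangentSpace 𝓘(ℂ, D.E) (D.proj q)) ≠ 0) {lam lam' : D.liftV q →ₗ[ℂ] ℂ}
    (h : D.IsDualVec q v lam) (h' : D.IsDualVec q v lam') : lam = lam' := by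
  ext ξ
  exact smul_left_injective ℂ h0 ((h ξ).symm.trans (h' ξ))

theorem IsWedge.eq_wedge {q : D.P} {m : ℕ} {lam : D.liftV q →ₗ[ℂ] ℂ} {γ : D.jet.Form m q}
    {β : D.jet.Form (m + 1) q} (h : D.IsWedge q lam γ β) : β = wedge (W := D.liftV q) lam γ := by
  refine AlternatingMap.ext fun ξ => ?_
  exact (h ξ).trans (wedge_apply (W := D.liftV q) lam γ ξ).symm

/-- The vertical vectors are the kernel of `lam` and the image of the Euler morphism, so `γ` is
determined where `lam ∧ γ` depends on it. -/
theorem IsTautStep.unique {m : ℕ} {q : D.P} {v : D.V (D.proj q)}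
    (hv : (v : TangentSpace 𝓘(ℂ, D.E) (D.proj q)) ∈ D.line q)
    (h0 : (v : TangentSpace 𝓘(ℂ, D.E) (D.proj q)) ≠ 0) {α : D.Form (m + 1) (D.proj q)}
    {β β' : D.jet.Form (m + 1) q} (h : D.IsTautStep q v α β) (h' : D.IsTautStep q v α β') :
    β = β' := by
  obtain ⟨γ, lam, h1, h2, h3⟩ := h
  obtain ⟨γ', lam', h1', h2', h3'⟩ := h'
  obtain rfl := IsDualVec.unique D h0 h2 h2'
  rw [IsWedge.eq_wedge D h3, IsWedge.eq_wedge D h3']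
  refine wedge_eq_of_eqOn_ker fun ξ hξ => ?_
  have h4 : ∀ i, ∃ u, (ξ i : TangentSpace 𝓘(ℂ, D.PE) q) = D.eulerVec q v u := fun i => by
    refine D.exists_eulerVec_eq hv h0 ?_
    rw [h2 (ξ i), hξ i, zero_smul]
  choose u hu using h4
  exact (h1 u ξ hu).trans (h1' u ξ hu).symm

/-- The one-stage morphism is homogeneous of degree `m` in the vector `v`. -/
theorem IsTautStep.smul {m : ℕ} {q : D.P} {v : D.V (D.proj q)}
    (hv : (v : TangentSpace 𝓘(ℂ, D.E) (D.proj q)) ∈ D.line q)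
    (h0 : (v : TangentSpace 𝓘(ℂ, D.E) (D.proj q)) ≠ 0) {α : D.Form (m + 1) (D.proj q)}
    {β : D.jet.Form (m + 1) q} (h : D.IsTautStep q v α β) {t : ℂ} (ht : t ≠ 0) :
    D.IsTautStep q (t • v) (t ^ (-(m : ℤ)) • α) β := by
  obtain ⟨γ, lam, h1, h2, h3⟩ := h
  refine ⟨t • γ, t⁻¹ • lam, fun u η hη => ?_, fun ξ => ?_, fun ξ => ?_⟩
  · have h4 := h1 (fun i => t⁻¹ • u i) η fun i => (hη i).trans (D.eulerVec_smul_left hv h0 (u i) ht)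
    change t • γ η = t ^ (-(m : ℤ)) • α (Fin.cons (t • v) u)
    have h5 : α (Fin.cons (t • v) u) = t * α (Fin.cons v u) := by
      have := congrArg (fun f => f u) (α.curryLeft.map_smul t v)
      exact this
    have h6 : α (Fin.cons v fun i => t⁻¹ • u i) = (t⁻¹) ^ m * α (Fin.cons v u) := by
      have := (α.curryLeft v).toMultilinearMap.map_smul_univ (fun _ => t⁻¹) u
      simpa using this
    rw [h4, h5, h6]
    simp only [smul_eq_mul, zpow_neg, zpow_natCast, inv_pow]
    ring
  · change _ = (t⁻¹ * lam ξ) • (t • (v : TangentSpace 𝓘(ℂ, D.E) (D.proj q)))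
    rw [smul_smul, mul_right_comm, inv_mul_cancel₀ ht, one_mul]
    exact h2 ξ
  · refine (h3 ξ).trans (Finset.sum_congr rfl fun i _ => ?_)
    change _ = _ * (t⁻¹ * lam (ξ i)) * (t * γ _)
    field_simp

/-- The vertical part of a tangent vector of `P(V)` in a standard chart, as a vector of `V`: it
maps `∂/∂aⱼ` to `eⱼ` and the horizontal coordinate vectors to zero. -/
noncomputable def vertPart (F : FrameChart D.V (r - 1)) (p q : D.P) (hq : D.proj q ∈ F.dom) :
    TangentSpace 𝓘(ℂ, D.PE) q →ₗ[ℂ] D.V (D.proj q) :=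
  ∑ j, ((LinearMap.proj j ∘ₗ LinearMap.snd ℂ D.E (Fin (r - 1) → ℂ)) ∘ₗ
      (show TangentSpace 𝓘(ℂ, D.PE) q →L[ℂ] D.PE from
        mfderiv 𝓘(ℂ, D.PE) 𝓘(ℂ, D.PE) (D.frameChart F p) q).toLinearMap).smulRight
    ⟨F.e (some j) (D.proj q), by
      rw [← F.frame.span_eq _ hq]
      exact Submodule.subset_span ⟨some j, rfl⟩⟩

theorem coe_vertPart (F : FrameChart D.V (r - 1)) (p q : D.P) (hq : D.proj q ∈ F.dom)
    (ξ : TangentSpace 𝓘(ℂ, D.PE) q) :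
    (D.vertPart F p q hq ξ : TangentSpace 𝓘(ℂ, D.E) (D.proj q)) =
      ∑ j, (mfderiv 𝓘(ℂ, D.PE) 𝓘(ℂ, D.PE) (D.frameChart F p) q ξ : D.PE).2 j •
        F.e (some j) (D.proj q) := by
  rw [vertPart, LinearMap.sum_apply, Submodule.coe_sum]
  rfl

/-- The generator of the line `q` whose first coordinate in the frame is `1`. -/
noncomputable def frameVec (F : FrameChart D.V (r - 1)) (p q : D.P)
    (hq : D.proj q ∈ F.dom) : D.V (D.proj q) :=
  ⟨F.vecAt (D.proj q) (D.frameChart F p q).2, F.vecAt_mem hq _⟩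

theorem frameVec_ne (F : FrameChart D.V (r - 1)) (p q : D.P) (hq : D.proj q ∈ F.dom) :
    (D.frameVec F p q hq : TangentSpace 𝓘(ℂ, D.E) (D.proj q)) ≠ 0 :=
  F.vecAt_ne hq _

/-- Modulo the line of `q`, the map `vertPart` is a left inverse of the Euler morphism. -/
theorem vertPart_eulerVec {F : FrameChart D.V (r - 1)} {p q : D.P}
    (hq : q ∈ (D.frameChart F p).source) (u : D.V (D.proj q)) :
    D.vertPart F p q hq.1 (D.eulerVec q (D.frameVec F p q hq.1) u) =
      u + (-F.co (D.proj q) u none) • D.frameVec F p q hq.1 := by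
  have hx : D.proj q ∈ F.dom := hq.1
  have h1 : F.co (D.proj q) (D.frameVec F p q hx) none = 1 := congrFun (F.co_vecAt hx _) none
  refine Subtype.ext ((D.coe_vertPart F p q hx _).trans ?_)
  rw [D.mfderiv_frameChart_eulerVec hq (D.vecAt_mem_line hq) (D.frameVec_ne F p q hx), h1]
  have h2 := D.sum_co hx u.2
  change _ = (u : TangentSpace 𝓘(ℂ, D.E) (D.proj q)) +
    (-F.co (D.proj q) u none) • F.vecAt (D.proj q) (D.frameChart F p q).2
  rw [FrameChart.vecAt, Finset.smul_sum]
  conv_rhs => enter [1]; rw [← h2]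
  rw [Fintype.sum_option, Fintype.sum_option]
  simp only [Option.elim_none, Option.elim_some, div_one, sub_smul, Finset.sum_sub_distrib,
    neg_smul, one_smul, smul_smul, neg_mul, Finset.sum_neg_distrib]
  simp only [mul_comm]
  abel

theorem isTautStep_frame {m : ℕ} {F : FrameChart D.V (r - 1)} {p q : D.P}
    (hq : q ∈ (D.frameChart F p).source) (α : D.Form (m + 1) (D.proj q)) {lam : D.liftV q →ₗ[ℂ] ℂ}
    (hlam : D.IsDualVec q (D.frameVec F p q hq.1) lam) :
    D.IsTautStep q (D.frameVec F p q hq.1) α (wedge (W := D.liftV q) lam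
      ((α.curryLeft (D.frameVec F p q hq.1)).compLinearMap
        (D.vertPart F p q hq.1 ∘ₗ (D.liftV q).subtype))) := by
  refine ⟨(α.curryLeft (D.frameVec F p q hq.1)).compLinearMap
    (D.vertPart F p q hq.1 ∘ₗ (D.liftV q).subtype), lam, fun u η hη => ?_, hlam, fun ξ => ?_⟩
  · change α (Fin.cons _ fun i => D.vertPart F p q hq.1 (η i)) = _
    rw [← map_cons_add_smul α _ u fun i => -F.co (D.proj q) (u i) none]
    congr 2
    funext i
    rw [hη i]
    exact D.vertPart_eulerVec hq (u i)
  · exact wedge_apply (W := D.liftV q) lam _ ξ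

theorem isDualVec_frame_apply {F : FrameChart D.V (r - 1)} {p q : D.P}
    (hq : q ∈ (D.frameChart F p).source) {lam : D.liftV q →ₗ[ℂ] ℂ}
    (hlam : D.IsDualVec q (D.frameVec F p q hq.1) lam) (ξ : D.liftV q) :
    lam ξ = F.co (D.proj q) (D.dproj q ξ) none := by
  have hx : D.proj q ∈ F.dom := hq.1
  have h1 : F.co (D.proj q) (D.frameVec F p q hx) none = 1 := congrFun (F.co_vecAt hx _) none
  rw [hlam ξ, F.co_smul hx (D.frameVec F p q hx).2, Pi.smul_apply, h1, smul_eq_mul, mul_one]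

/-- In a standard chart, the one-stage morphism wedges the coordinate of `dπ` with the contraction
of `α` by the generator of the line. -/
theorem IsTautStep.apply_eq {m : ℕ} {F : FrameChart D.V (r - 1)} {p q : D.P}
    (hq : q ∈ (D.frameChart F p).source) {α : D.Form (m + 1) (D.proj q)}
    {β : D.jet.Form (m + 1) q} (h : D.IsTautStep q (D.frameVec F p q hq.1) α β)
    (ξ : Fin (m + 1) → D.liftV q) :
    β ξ = ∑ i : Fin (m + 1), (-1 : ℂ) ^ (i : ℕ) * F.co (D.proj q) (D.dproj q (ξ i)) none *
      α (Fin.cons (D.frameVec F p q hq.1) fun j =>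
        D.vertPart F p q hq.1 (ξ (i.succAbove j) : TangentSpace 𝓘(ℂ, D.PE) q)) := by
  have hv : (D.frameVec F p q hq.1 : TangentSpace 𝓘(ℂ, D.E) (D.proj q)) ∈ D.line q :=
    D.vecAt_mem_line hq
  obtain ⟨lam, hlam⟩ := D.exists_isDualVec hv (D.frameVec_ne F p q hq.1)
  rw [IsTautStep.unique D hv (D.frameVec_ne F p q hq.1) h (D.isTautStep_frame hq α hlam)]
  refine (wedge_apply (W := D.liftV q) lam _ ξ).trans (Finset.sum_congr rfl fun i _ => ?_)
  rw [D.isDualVec_frame_apply hq hlam]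
  rfl

/-! ### Existence and uniqueness of the tautological morphisms -/

/-- The one-stage tautological morphism at `q`, with the line of `q` trivialized by a vector `v`. -/
theorem exists_tautStep (m : ℕ) (q : D.P) :
    ∃ (v : TangentSpace 𝓘(ℂ, D.E) (D.proj q)) (hv : v ∈ D.line q)
      (S : D.Form (m + 1) (D.proj q) →ₗ[ℂ] D.jet.Form (m + 1) q), v ≠ 0 ∧
      ∀ α, D.IsTautStep q ⟨v, D.line_le q hv⟩ α (S α) := by
  obtain ⟨F, hF⟩ := D.exists_chart q
  have hF' : q ∈ (D.frameChart F q).source := hF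
  have hv := D.vecAt_mem_line hF'
  obtain ⟨lam, hlam⟩ := D.exists_isDualVec (v := D.frameVec F q q hF.1) hv
    (D.frameVec_ne F q q hF.1)
  let S : D.Form (m + 1) (D.proj q) →ₗ[ℂ] (D.liftV q) [⋀^Fin (m + 1)]→ₗ[ℂ] ℂ :=
    { toFun := fun α => wedge (W := D.liftV q) lam
        ((α.curryLeft (D.frameVec F q q hF.1)).compLinearMap
          (D.vertPart F q q hF.1 ∘ₗ (D.liftV q).subtype))
      map_add' := fun α α' => AlternatingMap.ext fun ξ => by
        rw [AlternatingMap.add_apply, wedge_apply, wedge_apply, wedge_apply,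
          ← Finset.sum_add_distrib]
        refine Finset.sum_congr rfl fun i _ => ?_
        simp only [AlternatingMap.compLinearMap_apply, AlternatingMap.curryLeft_add,
          LinearMap.add_apply, AlternatingMap.add_apply, mul_add]
      map_smul' := fun a α => AlternatingMap.ext fun ξ => by
        rw [RingHom.id_apply, AlternatingMap.smul_apply, wedge_apply, wedge_apply, Finset.smul_sum]
        refine Finset.sum_congr rfl fun i _ => ?_
        simp only [AlternatingMap.compLinearMap_apply, AlternatingMap.curryLeft_smul,
          LinearMap.smul_apply, AlternatingMap.smul_apply, smul_eq_mul]
        ring }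
  exact ⟨_, hv, S, D.frameVec_ne F q q hF.1, fun α => D.isTautStep_frame hF' α hlam⟩

theorem exists_smul_eq {q : D.P} {v v' : TangentSpace 𝓘(ℂ, D.E) (D.proj q)}
    (hv : v ∈ D.line q) (h0 : v ≠ 0) (hv' : v' ∈ D.line q) (h0' : v' ≠ 0) :
    ∃ t : ℂ, t ≠ 0 ∧ t • v = v' := by
  obtain ⟨t, rfl⟩ := (D.mem_line_iff hv h0).1 hv'
  exact ⟨t, fun h => h0' (by rw [h, zero_smul]), rfl⟩

theorem evalLast_smul {p : ℕ} {m : ℤ} {k : ℕ} {w : (D.tower (k + 1)).M}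
    (σ : D.twisted p m (k + 1) w)
    {v v' : {v : TangentSpace 𝓘(ℂ, (D.tower k).E) ((D.tower k).proj w) //
      v ∈ (D.tower k).line w ∧ v ≠ 0}} {t : ℂ} (h : v'.1 = t • v.1) :
    D.evalLast σ v' = t ^ m • D.evalLast σ v :=
  Subtype.ext (funext fun c => σ.2.2 c v v' t h)

/-- The composite of the one-stage tautological morphisms. -/
noncomputable def tautMap (m : ℕ) : D.FiberMaps m
  | 0, _ =>
    { toFun := fun σ => σ.1 PUnit.unit
      map_add' := fun _ _ => rfl
      map_smul' := fun _ _ => rfl }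
  | k + 1, w =>
    (((D.tower k).exists_tautStep m w).choose_spec.choose_spec.choose) ∘ₗ
      (tautMap m k ((D.tower k).proj w)) ∘ₗ
      { toFun := fun σ => D.evalLast σ ⟨((D.tower k).exists_tautStep m w).choose,
          ((D.tower k).exists_tautStep m w).choose_spec.choose,
          ((D.tower k).exists_tautStep m w).choose_spec.choose_spec.choose_spec.1⟩
        map_add' := fun _ _ => rfl
        map_smul' := fun _ _ => rfl }

theorem isTautological_tautMap (m : ℕ) : D.IsTautological (D.tautMap m) := by
  refine ⟨fun _ _ => rfl, fun k w σ v => ?_⟩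
  have hv := ((D.tower k).exists_tautStep m w).choose_spec.choose
  have h0 := ((D.tower k).exists_tautStep m w).choose_spec.choose_spec.choose_spec.1
  have h1 := ((D.tower k).exists_tautStep m w).choose_spec.choose_spec.choose_spec.2
  set v₀ := ((D.tower k).exists_tautStep m w).choose
  obtain ⟨t, ht0, ht⟩ := (D.tower k).exists_smul_eq hv h0 v.2.1 v.2.2
  have h2 : D.tautMap m k ((D.tower k).proj w) (D.evalLast σ v) =
      t ^ (-(m : ℤ)) • D.tautMap m k ((D.tower k).proj w) (D.evalLast σ ⟨v₀, hv, h0⟩) := by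
    rw [D.evalLast_smul σ (v := ⟨v₀, hv, h0⟩) (v' := v) ht.symm, map_smul]
  have h3 := IsTautStep.smul (D.tower k) hv h0
    (h1 (D.tautMap m k ((D.tower k).proj w) (D.evalLast σ ⟨v₀, hv, h0⟩))) ht0
  rw [h2]
  have h4 : (t • ⟨v₀, (D.tower k).line_le w hv⟩ : (D.tower k).V ((D.tower k).proj w)) =
      ⟨v.1, (D.tower k).line_le w v.2.1⟩ := Subtype.ext ht
  rw [← h4]
  exact h3

theorem IsTautological.unique {m : ℕ} {Φ Ψ : D.FiberMaps m} (hΦ : D.IsTautological Φ)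
    (hΨ : D.IsTautological Ψ) : Φ = Ψ := by
  funext k
  induction k with
  | zero =>
    funext w
    exact LinearMap.ext fun σ => (hΦ.zero w σ).trans (hΨ.zero w σ).symm
  | succ k ih =>
    funext w
    refine LinearMap.ext fun σ => ?_
    let v : {v : TangentSpace 𝓘(ℂ, (D.tower k).E) ((D.tower k).proj w) //
        v ∈ (D.tower k).line w ∧ v ≠ 0} :=
      ⟨(D.tower k).vec w, (D.tower k).vec_mem_line w, (D.tower k).vec_ne w⟩
    have h1 := hΦ.succ k w σ v
    rw [ih] at h1
    exact IsTautStep.unique (D.tower k) v.2.1 v.2.2 h1 (hΨ.succ k w σ v)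

/-! ### Holomorphy of the tautological morphisms -/

section Holomorphy

variable {G : Type} [NormedAddCommGroup G] [NormedSpace ℂ G]
  {N : Type u} [TopologicalSpace N] [ChartedSpace G N]

theorem holAlongAt_vertPart {F : FrameChart D.V (r - 1)} {p : D.P} {g : N → D.P}
    {ξ : ∀ y, TangentSpace 𝓘(ℂ, D.PE) (g y)} {y₀ : N} (hξ : HolAlongAt G g ξ y₀)
    (hs : g y₀ ∈ (D.frameChart F p).source) :
    HolAlongAt G (fun y => D.proj (g y)) (fun y =>
      ∑ j, (mfderiv 𝓘(ℂ, D.PE) 𝓘(ℂ, D.PE) (D.frameChart F p) (g y) (ξ y) : D.PE).2 j •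
        F.e (some j) (D.proj (g y))) y₀ := by
  have hp : ContMDiffAt 𝓘(ℂ, G) 𝓘(ℂ, D.E) ω (fun y => D.proj (g y)) y₀ :=
    (D.contMDiff_proj _).comp y₀ hξ.base
  have h1 : ContMDiffAt 𝓘(ℂ, G) 𝓘(ℂ, D.PE) ω (fun y =>
      (mfderiv 𝓘(ℂ, D.PE) 𝓘(ℂ, D.PE) (D.frameChart F p) (g y) (ξ y) : D.PE)) y₀ :=
    (hξ.mfderiv (contMDiffOn_of_mem_maximalAtlas (IsManifold.subset_maximalAtlas
      (D.frameChart_mem_atlas F p))) (D.frameChart F p).open_source hs).vectorSpace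
  refine HolAlongAt.sum_smul hp (fun j => (F.frame.hol (some j)).holAlongAt
    (F.frame.isOpen.mem_nhds hs.1) hp) fun j => ?_
  have h2 : ContDiff ℂ ω (fun z : D.PE => z.2 j) := (contDiff_apply ℂ ℂ j).comp contDiff_snd
  exact h2.contMDiff.contMDiffAt.comp y₀ h1

/-- Holomorphy of the one-stage morphism, for families of forms parametrized by a manifold. -/
theorem contMDiffAt_of_isTautStep {m : ℕ} {F : FrameChart D.V (r - 1)} {p : D.P} {g : N → D.P}
    {U : Set N} (hU : IsOpen U) (hs : ∀ y ∈ U, g y ∈ (D.frameChart F p).source)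
    {α : ∀ y, D.Form (m + 1) (D.proj (g y))} {β : ∀ y, D.jet.Form (m + 1) (g y)}
    {v : ∀ y, D.V (D.proj (g y))}
    (hv : ∀ y ∈ U, (v y : TangentSpace 𝓘(ℂ, D.E) (D.proj (g y))) =
      F.vecAt (D.proj (g y)) (D.frameChart F p (g y)).2)
    (hβ : ∀ y ∈ U, D.IsTautStep (g y) (v y) (α y) (β y))
    (hα : ∀ ζ : Fin (m + 1) → ∀ y, D.V (D.proj (g y)),
      (∀ i, ∀ y ∈ U, HolAlongAt G (fun y => D.proj (g y)) (fun y => (ζ i y).1) y) →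
      ∀ y ∈ U, ContMDiffAt 𝓘(ℂ, G) 𝓘(ℂ) ω (fun y => α y fun i => ζ i y) y)
    {ξ : Fin (m + 1) → ∀ y, D.liftV (g y)}
    (hξ : ∀ i, ∀ y ∈ U, HolAlongAt G g (fun y => (ξ i y).1) y) {y₀ : N} (hy₀ : y₀ ∈ U) :
    ContMDiffAt 𝓘(ℂ, G) 𝓘(ℂ) ω (fun y => β y fun i => ξ i y) y₀ := by
  classical
  -- `ζ i` is the tuple at which `α` is evaluated in the `i`-th term of the formula of
  -- `IsTautStep.apply_eq`.
  let ζ : Fin (m + 1) → Fin (m + 1) → ∀ y, D.V (D.proj (g y)) := fun i =>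
    Fin.cons v fun j y => if h : D.proj (g y) ∈ F.dom then
      D.vertPart F p (g y) h (ξ (i.succAbove j) y).1 else 0
  have hζs : ∀ i j, ∀ y (hy : y ∈ U), ζ i j.succ y =
      D.vertPart F p (g y) (hs y hy).1 (ξ (i.succAbove j) y).1 := fun i j y hy =>
    dif_pos (show D.proj (g y) ∈ F.dom from (hs y hy).1)
  have hζ : ∀ i j, ∀ y ∈ U, HolAlongAt G (fun y => D.proj (g y)) (fun y => (ζ i j y).1) y := by
    intro i j y hy
    have hg : ContMDiffAt 𝓘(ℂ, G) 𝓘(ℂ, D.PE) ω g y := (hξ 0 y hy).base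
    refine Fin.cases ?_ (fun j => ?_) j
    · refine (D.holAlongAt_vecAt hg (hs y hy)).congr ?_
      filter_upwards [hU.mem_nhds hy] with y' hy'
      exact hv y' hy'
    · refine (D.holAlongAt_vertPart (hξ (i.succAbove j) y hy) (hs y hy)).congr ?_
      filter_upwards [hU.mem_nhds hy] with y' hy'
      rw [hζs i j y' hy']
      exact D.coe_vertPart F p (g y') (hs y' hy').1 _
  have h1 : ContMDiffAt 𝓘(ℂ, G) 𝓘(ℂ) ω (fun y => ∑ i : Fin (m + 1), (-1 : ℂ) ^ (i : ℕ) *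
      F.co (D.proj (g y)) (D.dproj (g y) (ξ i y)) none * α y (fun j => ζ i j y)) y₀ := by
    refine contMDiffAt_finsetSum (t := Finset.univ) fun i _ => ContMDiffAt.mul
      (ContMDiffAt.mul contMDiffAt_const ?_) (hα (ζ i) (hζ i) y₀ hy₀)
    have h2 : HolAlongAt G (fun y => D.proj (g y)) (fun y => D.dproj (g y) (ξ i y)) y₀ :=
      (hξ i y₀ hy₀).mfderiv D.contMDiff_proj.contMDiffOn isOpen_univ (mem_univ _)
    exact h2.coef F.frame (hs y₀ hy₀).1
      (Filter.Eventually.of_forall fun y => D.line_le _ (ξ i y).2) none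
  refine h1.congr_of_eventuallyEq ?_
  filter_upwards [hU.mem_nhds hy₀] with y hy
  have hvy : v y = D.frameVec F p (g y) (hs y hy).1 := Subtype.ext (hv y hy)
  have h3 := hβ y hy
  rw [hvy] at h3
  refine (IsTautStep.apply_eq D (hs y hy) h3 _).trans (Finset.sum_congr rfl fun i _ => ?_)
  congr 2
  funext j
  refine Fin.cases hvy.symm (fun j => ?_) j
  exact (hζs i j y hy).symm

/-- The family `σ` of elements of the fibers of `π_{k,0}^* Λ^p V^* ⊗ O_{X_k}(m·1)` at the points
`g y` is holomorphic on `U`. For `g = id` this is `IsHolTwisted`. -/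
def IsHolTwistedAlong {p : ℕ} {m : ℤ} (k : ℕ) (g : N → (D.tower k).M)
    (σ : ∀ y, D.twisted p m k (g y)) (U : Set N) : Prop :=
  ∀ (U' : Set N) (c : ∀ y, D.Cone k (g y)) (ξ : Fin p → ∀ y, D.V (D.toBase k (g y))),
    IsOpen U' → U' ⊆ U → D.IsHolCone (F := G) k g c U' →
    (∀ i, ContMDiffOn 𝓘(ℂ, G) 𝓘(ℂ, D.E).tangent ω
      (fun y => (⟨D.toBase k (g y), (ξ i y : TangentSpace 𝓘(ℂ, D.E) (D.toBase k (g y)))⟩ :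
        TangentBundle 𝓘(ℂ, D.E) D.M)) U') →
    ContMDiffOn 𝓘(ℂ, G) 𝓘(ℂ) ω (fun y => (σ y).1 (c y) (fun i => ξ i y)) U'

/-- Tautological morphisms map holomorphic families to holomorphic families. The induction on `k`
needs families along maps `g : N → X_k`, as a section over `X_{k+1}` with its last variable
evaluated is only a section along the projection to `X_k`. -/
theorem IsTautological.contMDiffAt {m : ℕ} {Φ : D.FiberMaps m} (hΦ : D.IsTautological Φ) (k : ℕ)
    {g : N → (D.tower k).M} {σ : ∀ y, D.twisted (m + 1) (-m) k (g y)} {U : Set N} (hU : IsOpen U)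
    (hσ : D.IsHolTwistedAlong (G := G) k g σ U) {ξ : Fin (m + 1) → ∀ y, (D.tower k).V (g y)}
    (hξ : ∀ i, ∀ y ∈ U, HolAlongAt G g (fun y => (ξ i y).1) y) {y₀ : N} (hy₀ : y₀ ∈ U) :
    ContMDiffAt 𝓘(ℂ, G) 𝓘(ℂ) ω (fun y => Φ k (g y) (σ y) fun i => ξ i y) y₀ := by
  classical
  induction k generalizing U y₀ with
  | zero =>
    have h1 := hσ U (fun _ => PUnit.unit) ξ hU subset_rfl trivial
      fun i y hy => ContMDiffAt.contMDiffWithinAt (hξ i y hy)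
    refine (h1.contMDiffAt (hU.mem_nhds hy₀)).congr_of_eventuallyEq
      (Filter.Eventually.of_forall fun y => ?_)
    exact DFunLike.congr_fun (hΦ.zero (g y) (σ y)) fun i => ξ i y
  | succ k ih =>
    have hg : ∀ y ∈ U, ContMDiffAt (M' := (D.tower k).P) 𝓘(ℂ, G) 𝓘(ℂ, (D.tower k).PE) ω g y :=
      fun y hy => (hξ 0 y hy).base
    obtain ⟨F, hF⟩ := (D.tower k).exists_chart (g y₀)
    have hF' : g y₀ ∈ ((D.tower k).frameChart F (g y₀)).source := hF
    set U₁ : Set N := U ∩ g ⁻¹' ((D.tower k).frameChart F (g y₀)).source with hU₁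
    have hU₁o : IsOpen U₁ := ContinuousOn.isOpen_inter_preimage
      (fun y hy => (hg y hy).continuousAt.continuousWithinAt) hU
      ((D.tower k).frameChart F (g y₀)).open_source
    -- Families are defined on all of `N`: outside the chart any nonzero vector of the line will do.
    let v : ∀ y, {v : TangentSpace 𝓘(ℂ, (D.tower k).E) ((D.tower k).proj (g y)) //
        v ∈ (D.tower k).line (g y) ∧ v ≠ 0} := fun y =>
      if h : g y ∈ ((D.tower k).frameChart F (g y₀)).source then
        ⟨_, (D.tower k).vecAt_mem_line h, F.vecAt_ne h.1 _⟩
      else ⟨(D.tower k).vec (g y), (D.tower k).vec_mem_line (g y), (D.tower k).vec_ne (g y)⟩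
    have hv : ∀ y ∈ U₁, (v y).1 = F.vecAt ((D.tower k).proj (g y))
        ((D.tower k).frameChart F (g y₀) (g y)).2 := fun y hy =>
      congrArg Subtype.val (dif_pos hy.2)
    have hvh : ∀ y ∈ U₁, HolAlongAt G (fun y => (D.tower k).proj (g y)) (fun y => (v y).1) y := by
      intro y hy
      refine ((D.tower k).holAlongAt_vecAt (p := g y₀) (hg y hy.1) hy.2).congr ?_
      filter_upwards [hU₁o.mem_nhds hy] with y' hy'
      exact hv y' hy'
    have hσ' : D.IsHolTwistedAlong (G := G) k (fun y => (D.tower k).proj (g y))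
        (fun y => D.evalLast (σ y) (v y)) U₁ := by
      intro U' c ζ hU' hU'₁ hc hζ
      exact hσ U' (fun y => (c y, v y)) ζ hU' (hU'₁.trans inter_subset_left)
        ⟨hc, fun y hy => ContMDiffAt.contMDiffWithinAt (hvh y (hU'₁ hy))⟩ hζ
    exact (D.tower k).contMDiffAt_of_isTautStep hU₁o (fun y hy => hy.2)
      (v := fun y => ⟨(v y).1, (D.tower k).line_le _ (v y).2.1⟩) hv
      (fun y _ => hΦ.succ k (g y) (σ y) (v y)) (fun ζ hζ y hy => ih hU₁o hσ' hζ hy)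
      (fun i y hy => hξ i y hy.1) (y₀ := y₀) ⟨hy₀, hF'⟩

end Holomorphy

theorem IsTautological.isHolMorphism {m : ℕ} {Φ : D.FiberMaps m} (hΦ : D.IsTautological Φ) :
    D.IsHolMorphism Φ := by
  intro k U σ hU hσ U' ξ hU' hU'U hξ y hy
  refine ContMDiffAt.contMDiffWithinAt ?_
  exact IsTautological.contMDiffAt D hΦ k (g := fun w => w) hU'
    (fun U'' c ζ hU'' hs => hσ U'' c ζ hU'' (hs.trans hU'U))
    (fun i y hy => (hξ i y hy).contMDiffAt (hU'.mem_nhds hy)) hy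

end DirectedManifold

/-! ### Functoriality of the tower -/

theorem ProjBundle.exists_smul_eq_of_mkVec_eq {E : Type} [NormedAddCommGroup E] [NormedSpace ℂ E]
    {M : Type*} [TopologicalSpace M] [ChartedSpace E M]
    {V : ∀ x : M, Submodule ℂ (TangentSpace 𝓘(ℂ, E) x)} {x : M} {v w : TangentSpace 𝓘(ℂ, E) x}
    {hv : v ∈ V x} {h0 : v ≠ 0} {hw : w ∈ V x} {hw0 : w ≠ 0}
    (h : ProjBundle.mkVec (V := V) x v hv h0 = ProjBundle.mkVec x w hw hw0) :
    ∃ c : ℂ, c • w = v := by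
  have h1 := eq_of_heq (ProjBundle.mk.inj h).2
  rw [Projectivization.mk_eq_mk_iff'] at h1
  obtain ⟨c, hc⟩ := h1
  exact ⟨c, congrArg Subtype.val hc⟩

/-- An injective holomorphic immersion `M → M'` whose differential maps `V` to `V'`. -/
structure DirectedImmersion {r r' : ℕ} (D : DirectedManifold.{u} r)
    (D' : DirectedManifold.{u} r') where
  toFun : D.M → D'.M
  contMDiff : ContMDiff 𝓘(ℂ, D.E) 𝓘(ℂ, D'.E) ω toFun
  injective : Function.Injective toFun
  injective_mfderiv : ∀ x, Function.Injective (mfderiv 𝓘(ℂ, D.E) 𝓘(ℂ, D'.E) toFun x)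
  mapsTo : ∀ x, ∀ ξ ∈ D.V x, mfderiv 𝓘(ℂ, D.E) 𝓘(ℂ, D'.E) toFun x ξ ∈ D'.V (toFun x)

namespace DirectedImmersion

variable {r r' : ℕ} {D : DirectedManifold.{u} r} {D' : DirectedManifold.{u} r'}
  (f : DirectedImmersion D D')

/-- The differential of `f`. -/
noncomputable def d (x : D.M) :
    TangentSpace 𝓘(ℂ, D.E) x →L[ℂ] TangentSpace 𝓘(ℂ, D'.E) (f.toFun x) :=
  mfderiv 𝓘(ℂ, D.E) 𝓘(ℂ, D'.E) f.toFun x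

/-- The restriction of the differential of `f` to `V`. -/
noncomputable def onV (x : D.M) : D.V x →ₗ[ℂ] D'.V (f.toFun x) :=
  (f.d x).toLinearMap.restrict (f.mapsTo x)

theorem d_ne {x : D.M} {v : TangentSpace 𝓘(ℂ, D.E) x} (h : v ≠ 0) : f.d x v ≠ 0 := fun h' =>
  h (f.injective_mfderiv x (h'.trans (map_zero (f.d x)).symm))

/-- The map `(x, [v]) ↦ (f x, [df v])`. -/
noncomputable def jetFun (q : D.P) : D'.P :=
  ProjBundle.mkVec (f.toFun (D.proj q)) (f.d (D.proj q) (D.vec q))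
    (f.mapsTo _ _ (D.vec_mem q)) (f.d_ne (D.vec_ne q))

theorem jetFun_eq {q : D.P} {v : TangentSpace 𝓘(ℂ, D.E) (D.proj q)} (hv : v ∈ D.line q)
    (h0 : v ≠ 0) : f.jetFun q = ProjBundle.mkVec (f.toFun (D.proj q)) (f.d (D.proj q) v)
      (f.mapsTo _ _ (D.line_le q hv)) (f.d_ne h0) := by
  obtain ⟨c, hc, hcv⟩ := D.exists_smul_eq hv h0 (D.vec_mem_line q) (D.vec_ne q)
  refine ProjBundle.mkVec_eq c ?_
  rw [← hcv, map_smul]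

theorem jetFun_mkVec {x : D.M} {v : TangentSpace 𝓘(ℂ, D.E) x} (hv : v ∈ D.V x) (h0 : v ≠ 0) :
    f.jetFun (ProjBundle.mkVec x v hv h0) = ProjBundle.mkVec (f.toFun x) (f.d x v)
      (f.mapsTo _ _ hv) (f.d_ne h0) :=
  f.jetFun_eq (D.mem_line_mkVec hv h0) h0

theorem d_mem_line {q : D.P} {v : TangentSpace 𝓘(ℂ, D.E) (D.proj q)} (hv : v ∈ D.line q) :
    f.d (D.proj q) v ∈ D'.line (f.jetFun q) := by
  have h1 : f.d (D.proj q) (D.vec q) ∈ D'.line (f.jetFun q) :=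
    D'.mem_line_mkVec (f.mapsTo _ _ (D.vec_mem q)) (f.d_ne (D.vec_ne q))
  rw [D.line_eq_span_vec, Submodule.mem_span_singleton] at hv
  obtain ⟨c, rfl⟩ := hv
  rw [map_smul]
  exact Submodule.smul_mem _ c h1

theorem contMDiff_jetFun : ContMDiff 𝓘(ℂ, D.PE) 𝓘(ℂ, D'.PE) ω f.jetFun := by
  intro q
  obtain ⟨F, hF⟩ := D.exists_chart q
  have hF' : q ∈ (D.frameChart F q).source := hF
  have h1 := (D.holAlongAt_vecAt (g := fun q' : D.P => q') contMDiffAt_id hF').mfderiv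
    f.contMDiff.contMDiffOn isOpen_univ (mem_univ _)
  refine D'.contMDiffAt_of_holAlongAt (h := f.jetFun) h1 ?_
  filter_upwards [(D.frameChart F q).open_source.mem_nhds hF'] with q' hq'
  exact ⟨f.d_mem_line (D.vecAt_mem_line hq'), f.d_ne (F.vecAt_ne hq'.1 _)⟩

theorem injective_jetFun : Function.Injective f.jetFun := by
  rintro q q' h
  have hx : D.proj q = D.proj q' := f.injective (congrArg D'.proj h)
  obtain ⟨x, l⟩ := q
  obtain ⟨x', l'⟩ := q'
  obtain rfl : x = x' := hx
  obtain ⟨c, hc⟩ := ProjBundle.exists_smul_eq_of_mkVec_eq h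
  have h1 : c • D.vec ⟨x, l'⟩ = D.vec ⟨x, l⟩ :=
    f.injective_mfderiv x ((map_smul (f.d x) c (D.vec ⟨x, l'⟩)).trans hc)
  rw [← D.mkVec_eq_of_mem_line (D.vec_mem_line ⟨x, l⟩) (D.vec_ne _),
    ← D.mkVec_eq_of_mem_line (D.vec_mem_line ⟨x, l'⟩) (D.vec_ne _)]
  exact ProjBundle.mkVec_eq c h1

/-- The differential of `jetFun`. -/
noncomputable def dJet (q : D.P) :
    TangentSpace 𝓘(ℂ, D.PE) q →L[ℂ] TangentSpace 𝓘(ℂ, D'.PE) (f.jetFun q) :=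
  mfderiv 𝓘(ℂ, D.PE) 𝓘(ℂ, D'.PE) f.jetFun q

theorem dproj_dJet (q : D.P) (ξ : TangentSpace 𝓘(ℂ, D.PE) q) :
    D'.dproj (f.jetFun q) (f.dJet q ξ) = f.d (D.proj q) (D.dproj q ξ) := by
  have h1 := mfderiv_comp q ((D'.contMDiff_proj (f.jetFun q)).mdifferentiableAt (by simp))
    ((f.contMDiff_jetFun q).mdifferentiableAt (by simp))
  have h2 := mfderiv_comp q ((f.contMDiff (D.proj q)).mdifferentiableAt (by simp))
    ((D.contMDiff_proj q).mdifferentiableAt (by simp))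
  have h3 : D'.proj ∘ f.jetFun = f.toFun ∘ D.proj := rfl
  rw [h3, h2] at h1
  exact (congrArg (fun L => L ξ) h1).symm

theorem jetFun_eulerCurve (q : D.P) (v u : D.V (D.proj q)) (t : ℂ) :
    f.jetFun (D.eulerCurve q v u t) =
      D'.eulerCurve (f.jetFun q) (f.onV _ v) (f.onV _ u) t := by
  have h1 : f.d (D.proj q) (v + t • u) = f.d (D.proj q) v + t • f.d (D.proj q) u := by
    rw [map_add, map_smul]
  by_cases h : (v : TangentSpace 𝓘(ℂ, D.E) (D.proj q)) +
      t • (u : TangentSpace 𝓘(ℂ, D.E) (D.proj q)) = 0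
  · rw [D.eulerCurve_of_eq h]
    refine (D'.eulerCurve_of_eq ?_).symm
    exact h1.symm.trans ((congrArg (f.d (D.proj q)) h).trans (map_zero _))
  · rw [D.eulerCurve_of_ne h]
    refine (f.jetFun_mkVec _ _).trans (Eq.trans ?_ (D'.eulerCurve_of_ne ?_).symm)
    · exact ProjBundle.mkVec_eq 1 ((one_smul _ _).trans h1.symm)
    · exact fun h' => f.d_ne h (h1.trans h')

/-- Naturality of the Euler morphism. -/
theorem dJet_eulerVec {q : D.P} {v : D.V (D.proj q)}
    (hv : (v : TangentSpace 𝓘(ℂ, D.E) (D.proj q)) ∈ D.line q)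
    (h0 : (v : TangentSpace 𝓘(ℂ, D.E) (D.proj q)) ≠ 0) (u : D.V (D.proj q)) :
    f.dJet q (D.eulerVec q v u) = D'.eulerVec (f.jetFun q) (f.onV _ v) (f.onV _ u) := by
  have h1 := DirectedManifold.mfderiv_comp_curve_apply
    ((f.contMDiff_jetFun q).mdifferentiableAt (by simp))
    ((D.contMDiffAt_eulerCurve h0 u).mdifferentiableAt (by simp)) (D.eulerCurve_zero hv h0 u)
  have h2 : f.jetFun ∘ D.eulerCurve q v u =
      D'.eulerCurve (f.jetFun q) (f.onV _ v) (f.onV _ u) := funext (f.jetFun_eulerCurve q v u)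
  rw [h2] at h1
  exact h1.symm

/-- A vector killed by the differential of `jetFun` is vertical, as `f` is an immersion, hence an
Euler vector, and the kernels of the two Euler morphisms are the two lines. -/
theorem injective_dJet (q : D.P) : Function.Injective (f.dJet q) := by
  refine (injective_iff_map_eq_zero (f.dJet q)).2 fun ξ hξ => ?_
  have h1 : D.dproj q ξ = 0 := by
    refine f.injective_mfderiv (D.proj q) ((f.dproj_dJet q ξ).symm.trans ?_)
    rw [hξ, map_zero]
    exact (map_zero (f.d (D.proj q))).symm
  let v : D.V (D.proj q) := ⟨D.vec q, D.vec_mem q⟩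
  have hv : (v : TangentSpace 𝓘(ℂ, D.E) (D.proj q)) ∈ D.line q := D.vec_mem_line q
  have h0 : (v : TangentSpace 𝓘(ℂ, D.E) (D.proj q)) ≠ 0 := D.vec_ne q
  obtain ⟨u, rfl⟩ := D.exists_eulerVec_eq hv h0 h1
  rw [f.dJet_eulerVec hv h0] at hξ
  obtain ⟨c, hc⟩ := (D'.mem_line_iff (q := f.jetFun q) (f.d_mem_line hv) (f.d_ne h0)).1
    ((D'.eulerVec_eq_zero_iff (q := f.jetFun q) (v := f.onV _ v) (f.d_mem_line hv)
      (f.d_ne h0) _).1 hξ)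
  have h3 : c • D.vec q = u :=
    f.injective_mfderiv (D.proj q) ((map_smul (f.d (D.proj q)) c (D.vec q)).trans hc)
  rw [D.eulerVec_eq_zero_iff hv h0, ← h3]
  exact Submodule.smul_mem _ c hv

theorem dJet_mem (q : D.P) {ξ : TangentSpace 𝓘(ℂ, D.PE) q} (hξ : ξ ∈ D.liftV q) :
    f.dJet q ξ ∈ D'.liftV (f.jetFun q) := by
  change D'.dproj (f.jetFun q) (f.dJet q ξ) ∈ D'.line (f.jetFun q)
  rw [f.dproj_dJet]
  exact f.d_mem_line hξ

/-- The immersion `P(V) → P(V')` induced by `f`. -/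
noncomputable def jet : DirectedImmersion D.jet D'.jet where
  toFun := f.jetFun
  contMDiff := f.contMDiff_jetFun
  injective := f.injective_jetFun
  injective_mfderiv := f.injective_dJet
  mapsTo q _ hξ := f.dJet_mem q hξ

/-- The immersions of all stages of the Semple towers induced by `f`. -/
noncomputable def tower : ∀ k, DirectedImmersion (D.tower k) (D'.tower k)
  | 0 => f
  | k + 1 => (tower k).jet

/-- The one-stage tautological morphism commutes with restriction of forms along an immersion. -/
theorem isTautStep_restrict {m : ℕ} {q : D.P} {v : D.V (D.proj q)}
    (hv : (v : TangentSpace 𝓘(ℂ, D.E) (D.proj q)) ∈ D.line q)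
    (h0 : (v : TangentSpace 𝓘(ℂ, D.E) (D.proj q)) ≠ 0)
    {α : D'.Form (m + 1) (f.toFun (D.proj q))} {β : D'.jet.Form (m + 1) (f.jetFun q)}
    (h : D'.IsTautStep (f.jetFun q) (f.onV _ v) α β) :
    D.IsTautStep q v (α.compLinearMap (f.onV (D.proj q))) (β.compLinearMap (f.jet.onV q)) := by
  obtain ⟨γ, lam, h1, h2, h3⟩ := h
  refine ⟨γ.compLinearMap (f.jet.onV q), lam ∘ₗ f.jet.onV q, fun u η hη => ?_, fun ξ => ?_,
    fun ξ => ?_⟩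
  · have h4 := h1 (fun i => f.onV _ (u i)) (fun i => f.jet.onV q (η i)) fun i => by
      refine Eq.trans ?_ (f.dJet_eulerVec hv h0 (u i))
      exact congrArg (f.dJet q) (hη i)
    refine h4.trans ?_
    rw [AlternatingMap.compLinearMap_apply]
    refine congrArg α (funext fun j => ?_)
    refine Fin.cases rfl (fun j => rfl) j
  · refine f.injective_mfderiv (D.proj q) ((f.dproj_dJet q ξ).symm.trans ((h2 (f.jet.onV q ξ)).trans
      (map_smul (f.d (D.proj q)) _ _).symm))
  · exact h3 fun i => f.jet.onV q (ξ i)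

/-! ### Restriction of forms along an immersion -/

/-- The images under the differentials of the stages of `f` of the vectors `v_1, …, v_k`. -/
noncomputable def pushCone : ∀ (k : ℕ) (w : (D.tower k).M), D.Cone k w →
    D'.Cone k ((f.tower k).toFun w)
  | 0, _, _ => PUnit.unit
  | k + 1, w, c => (pushCone k ((D.tower k).proj w) c.1,
      ⟨(f.tower k).d ((D.tower k).proj w) c.2.1, (f.tower k).d_mem_line c.2.2.1,
        (f.tower k).d_ne c.2.2.2⟩)

/-- The differential of `f` on `V` at `π_{k,0}(w)`. Its target is the fiber at `π_{k,0}` of the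
image of `w` in the tower of `D'`. -/
noncomputable def baseMap : ∀ (k : ℕ) (w : (D.tower k).M),
    D.V (D.toBase k w) →ₗ[ℂ] D'.V (D'.toBase k ((f.tower k).toFun w))
  | 0, w => f.onV w
  | k + 1, w => baseMap k ((D.tower k).proj w)

theorem isHomogeneous_pushCone {A B : Type} [AddCommGroup A] [Module ℂ A] [AddCommGroup B]
    [Module ℂ B] (L : A →ₗ[ℂ] B) (m : ℤ) : ∀ (k : ℕ) (w : (D.tower k).M)
      (g : D'.Cone k ((f.tower k).toFun w) → A), D'.IsHomogeneous m k ((f.tower k).toFun w) g →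
      D.IsHomogeneous m k w (fun c => L (g (f.pushCone k w c)))
  | 0, _, _, _ => trivial
  | k + 1, w, g, hg => by
    refine ⟨fun v => isHomogeneous_pushCone L m k _ _
      (hg.1 ⟨_, (f.tower k).d_mem_line v.2.1, (f.tower k).d_ne v.2.2⟩), fun c v v' t h => ?_⟩
    have h1 := hg.2 (f.pushCone k ((D.tower k).proj w) c)
      ⟨_, (f.tower k).d_mem_line v.2.1, (f.tower k).d_ne v.2.2⟩
      ⟨_, (f.tower k).d_mem_line v'.2.1, (f.tower k).d_ne v'.2.2⟩ t
      ((congrArg ((f.tower k).d ((D.tower k).proj w)) h).trans (map_smul _ _ _))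
    exact (congrArg L h1).trans (map_smul L _ _)

/-- Restriction along `baseMap` of forms at `π_{k,0}` of the image of `w`. -/
noncomputable def restrictForm (p k : ℕ) (w : (D.tower k).M) :
    D'.Form p (D'.toBase k ((f.tower k).toFun w)) →ₗ[ℂ] D.Form p (D.toBase k w) where
  toFun α := α.compLinearMap (f.baseMap k w)
  map_add' _ _ := rfl
  map_smul' _ _ := rfl

/-- The restriction to `V` of an element of the fiber of `π_{k,0}^* Λ^p V'^* ⊗ O(m·1)`. -/
noncomputable def restrict {p : ℕ} {m : ℤ} (k : ℕ) (w : (D.tower k).M)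
    (σ : D'.twisted p m k ((f.tower k).toFun w)) : D.twisted p m k w :=
  ⟨fun c => f.restrictForm p k w (σ.1 (f.pushCone k w c)),
    f.isHomogeneous_pushCone (f.restrictForm p k w) m k w σ.1 σ.2⟩

/-- The tautological morphisms commute with restriction of forms along an immersion. -/
theorem tautological_restrict {m : ℕ} {Φ : D.FiberMaps m} {Φ' : D'.FiberMaps m}
    (hΦ : D.IsTautological Φ) (hΦ' : D'.IsTautological Φ') (k : ℕ) (w : (D.tower k).M)
    (σ : D'.twisted (m + 1) (-m) k ((f.tower k).toFun w)) :
    Φ k w (f.restrict k w σ) =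
      (Φ' k ((f.tower k).toFun w) σ).compLinearMap ((f.tower k).onV w) := by
  induction k with
  | zero =>
    refine (hΦ.zero w _).trans ?_
    exact congrArg (fun β => AlternatingMap.compLinearMap β (f.onV w)) (hΦ'.zero _ σ).symm
  | succ k ih =>
    let v : {v : TangentSpace 𝓘(ℂ, (D.tower k).E) ((D.tower k).proj w) //
        v ∈ (D.tower k).line w ∧ v ≠ 0} :=
      ⟨(D.tower k).vec w, (D.tower k).vec_mem_line w, (D.tower k).vec_ne w⟩
    let v' : {v : TangentSpace 𝓘(ℂ, (D'.tower k).E) ((D'.tower k).proj ((f.tower k).jetFun w)) //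
        v ∈ (D'.tower k).line ((f.tower k).jetFun w) ∧ v ≠ 0} :=
      ⟨_, (f.tower k).d_mem_line v.2.1, (f.tower k).d_ne v.2.2⟩
    have h1 := hΦ.succ k w (f.restrict (k + 1) w σ) v
    have h2 : Φ k ((D.tower k).proj w) (D.evalLast (f.restrict (k + 1) w σ) v) = _ :=
      ih ((D.tower k).proj w) (D'.evalLast σ v')
    rw [h2] at h1
    refine DirectedManifold.IsTautStep.unique (D.tower k) v.2.1 v.2.2 h1 ?_
    exact (f.tower k).isTautStep_restrict (v := ⟨v.1, (D.tower k).line_le w v.2.1⟩) v.2.1 v.2.2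
      (hΦ'.succ k ((f.tower k).jetFun w) σ v')

end DirectedImmersion

/-! ### Forms on the closure -/

namespace DirectedManifold

variable {r : ℕ} (D : DirectedManifold.{u} r)

/-- The expression of a holomorphic form in a local frame is a continuous function of the tuple of
tangent vectors, so that its zeros are stable under limits. -/
theorem IsHolForm.eq_zero_of_mem_closure {m : ℕ} {β : ∀ x, D.Form (m + 1) x} {U : Set D.M}
    (hβ : D.IsHolForm β U) (hU : IsOpen U)
    {S : Set (Fin (m + 1) → TangentBundle 𝓘(ℂ, D.E) D.M)}
    (hS : ∀ Z ∈ S, ∃ (x : D.M) (ζ : Fin (m + 1) → D.V x),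
      (∀ i, Z i = ⟨x, (ζ i).1⟩) ∧ (x ∈ U → β x ζ = 0)) {z : D.M} (hz : z ∈ U)
    {ζ : Fin (m + 1) → D.V z}
    (hζ : (fun i => (⟨z, (ζ i).1⟩ : TangentBundle 𝓘(ℂ, D.E) D.M)) ∈ closure S) :
    β z ζ = 0 := by
  classical
  obtain ⟨e, U₁, hz₁, he⟩ := D.isHolSubbundle z
  obtain ⟨A, hA, hc⟩ := he.exists_coef_eq hz₁
  set T := trivializationAt D.E (TangentSpace 𝓘(ℂ, D.E) : D.M → Type _) z with hT
  have hzT : z ∈ T.baseSet := FiberBundle.mem_baseSet_trivializationAt' z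
  -- The frame as a family of sections of `V` on all of the manifold, with junk value `0`.
  let ε : Fin r → ∀ x, D.V x := fun j x => if h : e j x ∈ D.V x then ⟨e j x, h⟩ else 0
  have hε : ∀ j, ∀ x ∈ U₁, (ε j x).1 = e j x := fun j x hx => by
    have h : e j x ∈ D.V x := by
      rw [← he.span_eq x hx]
      exact Submodule.subset_span ⟨j, rfl⟩
    exact congrArg Subtype.val (dif_pos h)
  have hb : ∀ I : Fin (m + 1) → Fin r, ContinuousAt (fun x => β x fun i => ε (I i) x) z := by
    intro I
    have h1 := hβ (U ∩ U₁) (fun i => ε (I i)) (hU.inter he.isOpen) inter_subset_left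
      fun i => ContMDiffOn.congr ((he.hol (I i)).mono inter_subset_right) fun x hx => by
        simp only [hε (I i) x hx.2]
    exact h1.continuousOn.continuousAt ((hU.inter he.isOpen).mem_nhds ⟨hz, hz₁⟩)
  let Z₀ : Fin (m + 1) → TangentBundle 𝓘(ℂ, D.E) D.M := fun i => ⟨z, (ζ i).1⟩
  let Ω : (Fin (m + 1) → TangentBundle 𝓘(ℂ, D.E) D.M) → ℂ := fun Y =>
    ∑ I : Fin (m + 1) → Fin r, (∏ i, A (Y i).proj (T (Y i)).2 (I i)) *
      β (Y 0).proj fun i => ε (I i) (Y 0).proj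
  have hproj : ∀ i, ContinuousAt (fun Y : Fin (m + 1) → TangentBundle 𝓘(ℂ, D.E) D.M =>
      (Y i).proj) Z₀ := fun i =>
    ((FiberBundle.continuous_proj D.E _).comp (continuous_apply i)).continuousAt
  have hΩ : ContinuousAt Ω Z₀ := by
    refine tendsto_finsetSum _ fun I _ => Filter.Tendsto.mul
      (tendsto_finsetProd _ fun i _ => ?_)
      (ContinuousAt.comp (g := fun x => β x fun i => ε (I i) x) (hb I) (hproj 0))
    have h1 : ContinuousAt (fun Y : Fin (m + 1) → TangentBundle 𝓘(ℂ, D.E) D.M => (T (Y i)).2)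
        Z₀ := by
      have h2 : ContinuousAt T (Z₀ i) :=
        T.continuousOn.continuousAt (T.open_source.mem_nhds (T.mem_source.2 hzT))
      exact continuous_snd.continuousAt.comp
        (ContinuousAt.comp (f := fun Y : Fin (m + 1) → TangentBundle 𝓘(ℂ, D.E) D.M => Y i)
          h2 (continuous_apply i).continuousAt)
    have h3 : ContinuousAt (fun Y : Fin (m + 1) → TangentBundle 𝓘(ℂ, D.E) D.M => A (Y i).proj)
        Z₀ := ContinuousAt.comp (g := A) hA.continuousAt (hproj i)
    exact ((continuous_apply (I i)).continuousAt).comp (h3.clm_apply h1)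
  have key : ∀ᶠ x in 𝓝 z, ∀ ξ : Fin (m + 1) → D.V x, Ω (fun i => ⟨x, (ξ i).1⟩) = β x ξ := by
    filter_upwards [hc, he.isOpen.mem_nhds hz₁] with x h1 h2 ξ
    have h3 : ∀ i, ξ i = ∑ j, coef (fun j => e j x) (ξ i).1 j • ε j x := by
      intro i
      refine Subtype.ext ?_
      rw [Submodule.coe_sum]
      simp only [Submodule.coe_smul, hε _ x h2]
      exact (sum_coef (by rw [he.span_eq x h2]; exact (ξ i).2)).symm
    have h4 : β x ξ = β x fun i => ∑ j, coef (fun j => e j x) (ξ i).1 j • ε j x :=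
      congrArg (β x) (funext h3)
    rw [h4]
    refine Eq.trans ?_ ((β x).toMultilinearMap.map_sum fun i j =>
      coef (fun j => e j x) (ξ i).1 j • ε j x).symm
    refine Finset.sum_congr rfl fun I _ => ?_
    refine Eq.trans ?_ ((β x).toMultilinearMap.map_smul_univ _ _).symm
    refine congrArg (· * β x fun i => ε (I i) x) (Finset.prod_congr rfl fun i _ => ?_)
    exact (congrFun (h1 _ (ξ i).2) (I i)).symm
  rw [← key.self_of_nhds ζ]
  by_contra h0
  have h1 : ∃ᶠ Y in 𝓝 Z₀, Y ∈ S := mem_closure_iff_frequently.1 hζ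
  have h2 : ∀ᶠ Y in 𝓝 Z₀, Ω Y ≠ 0 := hΩ.eventually_ne h0
  have h3 : ∀ᶠ Y in 𝓝 Z₀, (∀ ξ : Fin (m + 1) → D.V (Y 0).proj,
      Ω (fun i => ⟨(Y 0).proj, (ξ i).1⟩) = β (Y 0).proj ξ) ∧ (Y 0).proj ∈ U :=
    (hproj 0).eventually (key.and (hU.mem_nhds hz))
  obtain ⟨Y, hYS, hY2, hY3, hYU⟩ := (h1.and_eventually (h2.and h3)).exists
  obtain ⟨x, ξ, hξ, hξ0⟩ := hS Y hYS
  obtain rfl : Y = fun i => ⟨x, (ξ i).1⟩ := funext hξ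
  exact hY2 ((hY3 ξ).trans (hξ0 hYU))

end DirectedManifold

/-! ### The regular part of a directed structure -/

namespace DirectedStructure

variable {n : ℕ} {X : Type u} [TopologicalSpace X] [ChartedSpace (EuclideanSpace ℂ (Fin n)) X]
  [IsManifold 𝓘(ℂ, EuclideanSpace ℂ (Fin n)) ω X] (V : DirectedStructure n X)

/-- The inclusion `(X', V') → (X, T_X)`. -/
noncomputable def inclusion : DirectedImmersion V.regularPart (absolute n X) where
  toFun := (Subtype.val : V.regular → X)
  contMDiff := (contMDiff_subtype_val : ContMDiff 𝓘(ℂ, EuclideanSpace ℂ (Fin n))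
    𝓘(ℂ, EuclideanSpace ℂ (Fin n)) ω (Subtype.val : V.regular → X))
  injective := Subtype.val_injective
  injective_mfderiv := fun (y : V.regular) => by
    have : Nonempty V.regular := ⟨y⟩
    let f := V.regular.openPartialHomeomorphSubtypeCoe this
    have hf : f.MDifferentiable 𝓘(ℂ, EuclideanSpace ℂ (Fin n))
        𝓘(ℂ, EuclideanSpace ℂ (Fin n)) := by
      refine ⟨(contMDiff_subtype_val (n := 1)).contMDiffOn.mdifferentiableOn (by simp), ?_⟩
      rintro z hz
      have hz' : z ∈ V.regular := by simpa [f] using hz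
      refine MDifferentiableAt.mdifferentiableWithinAt ?_
      have h2 : ContMDiffAt 𝓘(ℂ, EuclideanSpace ℂ (Fin n)) 𝓘(ℂ, EuclideanSpace ℂ (Fin n)) 1
          (fun y : V.regular => f.symm y) ⟨z, hz'⟩ := by
        refine contMDiffAt_id.congr_of_eventuallyEq (Filter.Eventually.of_forall fun y => ?_)
        exact f.left_inv (x := y) (by simp [f])
      exact (contMDiffAt_subtype_iff.1 h2).mdifferentiableAt (by simp)
    exact (hf.mfderiv (x := y) (by simp [f])).injective
  mapsTo _ _ _ := trivial

/-- The inclusion `X'_k → X^a_k`. -/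
noncomputable def towerInclusion (k : ℕ) : (V.reg k).M → (absTower n X k).M :=
  (V.inclusion.tower k).toFun

theorem isInclusion_towerInclusion : V.IsInclusion V.towerInclusion where
  zero _ := rfl
  succ k q _ hv h0 := ⟨(V.inclusion.tower k).mapsTo _ _ ((V.reg k).line_le q hv),
    (V.inclusion.tower k).d_ne h0, (V.inclusion.tower k).jetFun_eq hv h0⟩
  contMDiff k := (V.inclusion.tower k).contMDiff
  injective k := (V.inclusion.tower k).injective
  injective_mfderiv k := (V.inclusion.tower k).injective_mfderiv
  mapsTo k := (V.inclusion.tower k).mapsTo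

theorem coneRel_towerInclusion_iff : ∀ (k : ℕ) (w : (V.reg k).M) (c : V.regularPart.Cone k w)
    (c' : (absolute n X).Cone k (V.towerInclusion k w)),
    V.ConeRel V.towerInclusion k w c (V.towerInclusion k w) c' ↔ c' = V.inclusion.pushCone k w c
  | 0, _, _, _ => ⟨fun _ => rfl, fun _ => trivial⟩
  | k + 1, w, c, c' => by
    have h1 := coneRel_towerInclusion_iff k ((V.reg k).proj w) c.1 c'.1
    constructor
    · rintro ⟨h2, h3⟩
      refine Prod.ext (h1.1 h2) (Subtype.ext ?_)
      exact (Bundle.TotalSpace.mk_inj.1 h3).symm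
    · rintro rfl
      exact ⟨h1.2 rfl, rfl⟩

theorem tmap_toBase (k : ℕ) (w : (V.reg k).M) (ξ : V.regularPart.V (V.regularPart.toBase k w)) :
    V.tmap V.towerInclusion 0 ⟨V.regularPart.toBase k w, ξ.1⟩ =
      ⟨(absolute n X).toBase k (V.towerInclusion k w), (V.inclusion.baseMap k w ξ).1⟩ := by
  induction k with
  | zero => rfl
  | succ k ih => exact ih ((V.reg k).proj w) ξ

theorem isRestrTwisted_iff {p : ℕ} {m : ℤ} {k : ℕ} {w : (V.reg k).M}
    {σ : (absolute n X).twisted p m k (V.towerInclusion k w)}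
    {σ' : V.regularPart.twisted p m k w} :
    V.IsRestrTwisted V.towerInclusion σ σ' ↔ σ' = V.inclusion.restrict k w σ := by
  constructor
  · intro h
    refine Subtype.ext (funext fun c => AlternatingMap.ext fun ξ => ?_)
    exact h c _ ((V.coneRel_towerInclusion_iff k w c _).2 rfl) ξ
      (fun i => V.inclusion.baseMap k w (ξ i)) fun i => V.tmap_toBase k w (ξ i)
  · rintro rfl c c' hc ξ ζ hζ
    obtain rfl := (V.coneRel_towerInclusion_iff k w c c').1 hc
    have h1 : ζ = fun i => V.inclusion.baseMap k w (ξ i) := funext fun i => Subtype.ext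
      (Bundle.TotalSpace.mk_inj.1 ((V.tmap_toBase k w (ξ i)).symm.trans (hζ i))).symm
    rw [h1]
    rfl

theorem isRestrForm_iff {p : ℕ} {k : ℕ} {w : (V.reg k).M}
    {β : (absTower n X k).Form p (V.towerInclusion k w)} {β' : (V.reg k).Form p w} :
    V.IsRestrForm V.towerInclusion β β' ↔
      β' = β.compLinearMap ((V.inclusion.tower k).onV w) := by
  constructor
  · intro h
    exact AlternatingMap.ext fun ξ => h ξ (fun i => (V.inclusion.tower k).onV w (ξ i)) fun _ => rfl
  · rintro rfl ξ ζ hζ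
    have h1 : ζ = fun i => (V.inclusion.tower k).onV w (ξ i) :=
      funext fun i => Subtype.ext (hζ i)
    rw [h1]
    rfl

end DirectedStructure

end Semple

theorem proposition6p9 :
    (∀ (r : ℕ) (D : Semple.DirectedManifold.{u} r) (m : ℕ), m + 1 ≤ r →
      ∃ Φ : D.FiberMaps m, D.IsTautological Φ ∧ D.IsHolMorphism Φ ∧
        ∀ Ψ : D.FiberMaps m, D.IsTautological Ψ → Ψ = Φ) ∧
    (∀ (n : ℕ) (X : Type u) [TopologicalSpace X] [ChartedSpace (EuclideanSpace ℂ (Fin n)) X]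
      [IsManifold 𝓘(ℂ, EuclideanSpace ℂ (Fin n)) ω X] (V : Semple.DirectedStructure n X) (m : ℕ),
      m + 1 ≤ V.rank →
      ∃ ι : ∀ k, (V.reg k).M → (Semple.absTower n X k).M, V.IsInclusion ι ∧
        ∀ (Φ : V.regularPart.FiberMaps m) (Φa : (Semple.absolute n X).FiberMaps m),
          V.regularPart.IsTautological Φ → (Semple.absolute n X).IsTautological Φa →
          (∀ k w σ σ', V.IsRestrTwisted ι (k := k) (w := w) σ σ' →
            V.IsRestrForm ι (Φa k (ι k w) σ) (Φ k w σ')) ∧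
          (∀ k U σ', IsOpen U → V.IsTwistedSection ι (k := k) σ' U →
            V.IsFormSection ι (fun w => Φ k w (σ' w)) U) ∧
          (∀ k U (σ : ∀ z, (Semple.absolute n X).twisted (m + 1) (-m) k z), IsOpen U →
            (Semple.absolute n X).IsHolTwisted σ U →
            (∀ w, ι k w ∈ U → ∀ σ', V.IsRestrTwisted ι (w := w) (σ (ι k w)) σ' → σ' = 0) →
            ∀ z ∈ U, ∀ ζ : Fin (m + 1) → (Semple.absTower n X k).V z,
              (fun i => ⟨z, (ζ i).1⟩) ∈ V.closedV ι (m + 1) k → Φa k z (σ z) ζ = 0)) := by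
  refine ⟨fun r D m _ => ⟨D.tautMap m, D.isTautological_tautMap m,
    (D.isTautological_tautMap m).isHolMorphism D,
    fun Ψ hΨ => hΨ.unique D (D.isTautological_tautMap m)⟩,
    fun n X _ _ _ V m _ => ⟨V.towerInclusion, V.isInclusion_towerInclusion,
      fun Φ Φa hΦ hΦa => ?_⟩⟩
  have ha : ∀ k w σ σ', V.IsRestrTwisted V.towerInclusion (k := k) (w := w) σ σ' →
      V.IsRestrForm V.towerInclusion (Φa k (V.towerInclusion k w) σ) (Φ k w σ') := by
    intro k w σ σ' h
    obtain rfl := V.isRestrTwisted_iff.1 h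
    exact V.isRestrForm_iff.2 (V.inclusion.tautological_restrict hΦ hΦa k w σ)
  refine ⟨ha, fun k U σ' _ hσ' z hz => ?_, fun k U σ hU hσ h0 z hz ζ hζ => ?_⟩
  · obtain ⟨O, σ, hO, hzO, hσ, hr⟩ := hσ' z hz
    exact ⟨O, fun y => Φa k y (σ y), hO, hzO, hΦa.isHolMorphism _ k O σ hO hσ,
      fun w hw => ha k w _ _ (hr w hw)⟩
  · refine (hΦa.isHolMorphism _ k U σ hU hσ).eq_zero_of_mem_closure _ hU ?_ hz hζ
    rintro Z ⟨w, ξ, hZ⟩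
    refine ⟨V.towerInclusion k w, fun i => (V.inclusion.tower k).onV w (ξ i), hZ, fun hw => ?_⟩
    have h1 := V.inclusion.tautological_restrict hΦ hΦa k w (σ (V.towerInclusion k w))
    rw [h0 w hw _ (V.isRestrTwisted_iff.2 rfl), map_zero] at h1
    exact (DFunLike.congr_fun h1 ξ).symm
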